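/- **Setting.** A class $\mathrm{ND}$ of network design problems consists of networks; each network has a finite set $\mathcal E$ of elements and a collection of requests, and each request $q$ is satisfied by the members of a nonempty upwards-closed family $X_q\subseteq 2^{\mathcal E}$. Elements have costs $c:\mathcal E\to\mathbb R_{\ge 0}$. *Prize-collecting variant (PCND).* Given requests $Q$ and penalties $\pi:Q\to\mathbb R_{\ge 0}$, a solution is a set $S\subseteq\mathcal E$ serving (i.e. satisfying) the requests of some $Q'\subseteq Q$; it costs $\sum_{e\in S}c(e)+\sum_{q\in Q\setminus Q'}\pi(q)$. A $\gamma$-approximation ($\gamma\ge 1$, possibly depending on the network) returns a solution of cost at most $\gamma$ times the optimum on every instance. A randomized one satisfies this for every outcome of its randomness, and its running time is measured in expectation. *ND with delay.* The network and costs are given in advance. Finitely many requests arrive over time; $q$ is released at time $r_q$, when its delay function $d_q$ is revealed as well. $d_q$ is continuous and nondecreasing, $d_q(r_q)\ge 0$, and $d_q(t)\to\infty$ as $t\to\infty$. At any time one may transmit a set $E\subseteq\mathcal E$ at cost $\sum_{e\in E}c(e)$; this serves all pending requests $q$ with $E\in X_q$. All requests must be served, and the total cost is the cost of all transmissions plus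 $\sum_q d_q(t_q)$, where $t_q$ is the time at which $q$ is first served. An online algorithm is $\rho$-competitive if on every input (and, if randomized, for every outcome) it serves all requests at total cost at most $\rho$ times that of any schedule that serves all requests. **The delay framework**, for a given $\gamma$-approximation algorithm $\mathrm{PCND}$. Each pending request $q$ has an investment counter $h_q$ (initially $0$) and a level $\ell_q\in\mathbb Z$; put $\rho_q(t)=\max(0,d_q(t)-h_q)$ and, for a time $s\ge t$, $\pi_{t\to s}(q)=\max(0,d_q(s)-h_q(t))$. Logarithms are to base $2$. * *On the release of $q$:* compute a solution $S_q$ serving $q$ alone, by calling PCND on $\{q\}$ with a prohibitive penalty. If $c(S_q)=0$, transmit $S_q$ at once. Otherwise set $\ell_q=\lfloor\log(c(S_q)/\gamma)\rfloor$. * *A level $j$ is critical* when the pending requests of level at most $j$ have total residual delay $\sum\rho_q(t)\ge 2^j$. At the first time $t$ at which a level becomes critical, take the lowest critical level $j$ and start a service of level $\ell=j+1$: let $Q_\lambda$ be the pending requests of level at most $\ell$; raise $h_q$ by $\rho_q(t)$ for every $q\in Q_\lambda$; let $E_0=\{e\in\mathcal E: c(e)\le 2^{\ell}/|\mathcal E|\}$;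 let $(\tau,S,Q')=\mathrm{ForwardTime}$. If $Q'=\emptyset$, let $q$ be the first request in the list that holds $Q_\lambda$ and put $Q'=\{q\}$, $S=S_q$. For every $q\in Q_\lambda\setminus Q'$ raise $h_q$ by $\pi_{t\to\tau}(q)$ and set $\ell_q=\ell$. Transmit $E_0\cup S$; the requests of $Q'$ are no longer pending. * *ForwardTime:* start with $t'=t$, $S=Q'=\emptyset$. While $Q'\ne Q_\lambda$: let $t''>t$ be the first time at which $\sum_{q\in Q_\lambda\setminus Q'}(\pi_{t\to t''}(q)-\pi_{t\to t'}(q))$ reaches $\gamma 2^{\ell}$; call PCND on $Q_\lambda$ with penalties $\pi_{t\to t''}$ and with the costs of the elements of $E_0$ set to $0$; if the solution returned costs at least $\gamma 2^\ell$, return $(t'',S,Q')$; otherwise replace $S$ and $Q'$ by this solution and the requests it serves, and put $t'=t''$. If the loop ends with $Q'=Q_\lambda$, return $(t',S,Q')$. **Theorem.** There is an absolute constant $C>0$ such that, for every class $\mathrm{ND}$ and every $\gamma$-approximation algorithm for PCND, the following hold for the resulting delay framework. 1. It is an online algorithm for ND with delay, it terminates, and it is $C\gamma(1+\log|\mathcal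 E|)$-competitive, i.e. $O(\gamma\log|\mathcal E|)$-competitive when $|\mathcal E|\ge 2$. (For $\mathcal E=\emptyset$ read $\log|\mathcal E|$ as $0$.) 2. If the approximation algorithm is deterministic, so is the framework. 3. If the approximation algorithm runs in polynomial time, so does the framework (in expectation, if randomized). Running time is counted in elementary steps: real arithmetic and comparisons, $2^j$, $\lfloor\log x\rfloor$ and evaluations of delay functions take one step. Finding the first time at which a sum of residual delays of $m$ requests reaches a threshold takes $m+1$ steps. A call to PCND takes its own number of steps, plus the steps for writing its input and reading its output. "Polynomial" is in the description size of the network and requests, where costs and delay functions have unit size, plus $|\mathcal E|$ and the number of requests. -/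

import Mathlib

open scoped NNReal ENNReal
open Filter

noncomputable section

namespace NetworkDesign

/-! ## Step-counted computations

The machine model is a real-arithmetic RAM with unit-cost elementary operations.
Programs are written with the charged primitives below. -/

/-- The outcome of a computation together with the number of elementary steps it took. -/
structure Timed (α : Type) where
  val : α
  steps : ℕ

namespace Timed

instance : Monad Timed where
  pure a := ⟨a, 0⟩
  bind x f := ⟨(f x.val).val, x.steps + (f x.val).steps⟩

/-- Spend `n` steps. -/
def tick (n : ℕ) : Timed Unit := ⟨(), n⟩

/-- One elementary operation with result `a`: an arithmetic operation or comparison on reals or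
integers, an integer power of two, `⌊log₂ x⌋`, or the evaluation of a delay function. -/
def op {α : Type} (a : α) : Timed α := ⟨a, 1⟩

/-- A fixed number `k` of elementary operations with final result `a`. -/
def ops {α : Type} (k : ℕ) (a : α) : Timed α := ⟨a, k⟩

/-- A loop over a finite index set; it costs the steps of the loop bodies and one step per
iteration. -/
def each {ι β : Type} [Fintype ι] (f : ι → Timed β) : Timed (ι → β) :=
  ⟨fun i => (f i).val, Fintype.card ι + ∑ i, (f i).steps⟩

/-- Collect the indices with a given (elementary) property, by one scan. -/
def select {ι : Type} [Fintype ι] (p : ι → Prop) [DecidablePred p] : Timed (Finset ι) :=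
  ⟨Finset.univ.filter p, Fintype.card ι⟩

/-- Add up the entries of an array over a set of indices, by one scan. -/
def sumOn {ι : Type} [Fintype ι] (T : Finset ι) (a : ι → ℝ) : Timed ℝ :=
  ⟨∑ i ∈ T, a i, Fintype.card ι⟩

/-- The query that gives access to the (clairvoyantly revealed) delay functions: the first time
from `t` on at which the sum over `T` of the given functions of time reaches `θ`. It is used only
for residual delays (up to additive constants), and is charged one step for each index and one
more. -/
def hittingTime {ι : Type} [Fintype ι] (T : Finset ι) (f : ι → ℝ → ℝ) (t θ : ℝ) : Timed ℝ :=
  ⟨sInf {s | t ≤ s ∧ θ ≤ ∑ i ∈ T, f i s}, Fintype.card ι + 1⟩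

end Timed

/-- A randomized step-counted computation (it halts with probability one). -/
def RTimed (α : Type) : Type := PMF (Timed α)

namespace RTimed

instance : Monad RTimed where
  pure a := PMF.pure ⟨a, 0⟩
  bind x f := PMF.bind x fun a => PMF.map (fun b => ⟨b.val, a.steps + b.steps⟩) (f a.val)

instance : MonadLift Timed RTimed where
  monadLift x := PMF.pure x

/-- The expected number of steps. -/
def expectedSteps {α : Type} (x : RTimed α) : ℝ≥0∞ :=
  ∑' a : Timed α, (show PMF (Timed α) from x) a * (a.steps : ℝ≥0∞)

/-- The possible outcomes. -/
def outcomes {α : Type} (x : RTimed α) : Set (Timed α) :=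
  (show PMF (Timed α) from x).support

/-- No randomness is used. -/
def IsDeterministic {α : Type} (x : RTimed α) : Prop := ∃ a : Timed α, x = PMF.pure a

end RTimed

/-! ## Network design problems and their prize-collecting variant -/

/-- A class of network design problems. Each network has a finite set of elements and a type of
requests; a request `q` is satisfied by the members of a nonempty upwards-closed family
`{E | Serves E q}` of sets of elements. Costs of elements are not part of the network.
`netSize` and `reqSize` are the lengths of the descriptions of networks and requests. -/
structure NDClass where
  Net : Type
  Elem : Net → Type
  elemFintype : ∀ N, Fintype (Elem N)
  elemDecEq : ∀ N, DecidableEq (Elem N)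
  Req : Net → Type
  Serves : ∀ {N : Net}, Finset (Elem N) → Req N → Prop
  serves_mono : ∀ {N : Net} {E₁ E₂ : Finset (Elem N)} {q : Req N},
    E₁ ⊆ E₂ → Serves E₁ q → Serves E₂ q
  exists_serves : ∀ {N : Net} (q : Req N), ∃ E : Finset (Elem N), Serves E q
  netSize : Net → ℕ
  reqSize : ∀ {N : Net}, Req N → ℕ

attribute [instance] NDClass.elemFintype NDClass.elemDecEq

variable {P : NDClass} {N : P.Net}

/-- An instance of the prize-collecting problem on the network `N`: element costs, and `n` requests
with penalties. -/
structure PCInstance (P : NDClass) (N : P.Net) where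
  cost : P.Elem N → ℝ≥0
  n : ℕ
  req : Fin n → P.Req N
  pen : Fin n → ℝ≥0

namespace PCInstance

/-- A candidate solution: a set of elements, and the set of requests that it is used to serve. -/
structure Solution (I : PCInstance P N) where
  elems : Finset (P.Elem N)
  served : Finset (Fin I.n)

def Solution.Feasible {I : PCInstance P N} (S : I.Solution) : Prop :=
  ∀ i ∈ S.served, P.Serves S.elems (I.req i)

/-- Cost of the elements bought plus penalties of the requests that are not served. -/
def Solution.cost {I : PCInstance P N} (S : I.Solution) : ℝ :=
  ∑ e ∈ S.elems, (I.cost e : ℝ) + ∑ i ∈ S.servedᶜ, (I.pen i : ℝ)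

/-- Input length (numbers have unit size). -/
def size (I : PCInstance P N) : ℕ :=
  P.netSize N + Fintype.card (P.Elem N) + ∑ i, (1 + P.reqSize (I.req i))

end PCInstance

/-- A (possibly randomized) algorithm for the prize-collecting variant of the class `P`. -/
def PCAlgorithm (P : NDClass) : Type :=
  ∀ (N : P.Net) (I : PCInstance P N), RTimed I.Solution

namespace PCAlgorithm

/-- Every possible outcome is feasible and costs at most `γ` times any feasible solution; the ratio
may depend on the network. -/
def IsApprox (A : PCAlgorithm P) (γ : P.Net → ℝ) : Prop :=
  ∀ (N : P.Net) (I : PCInstance P N), ∀ S ∈ (A N I).outcomes,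
    S.val.Feasible ∧ ∀ S' : I.Solution, S'.Feasible → S.val.cost ≤ γ N * S'.cost

def IsDeterministic (A : PCAlgorithm P) : Prop :=
  ∀ (N : P.Net) (I : PCInstance P N), (A N I).IsDeterministic

/-- The expected running time (for a deterministic algorithm: the running time) is polynomial. -/
def PolyTime (A : PCAlgorithm P) : Prop :=
  ∃ p : Polynomial ℕ, ∀ (N : P.Net) (I : PCInstance P N),
    (A N I).expectedSteps ≤ ((p.eval I.size : ℕ) : ℝ≥0∞)

end PCAlgorithm

/-! ## The online problem with delay -/

/-- A request of the online problem: what it asks for, its release time, its delay function. -/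
structure Arrival (P : NDClass) (N : P.Net) where
  req : P.Req N
  release : ℝ
  delay : ℝ → ℝ

/-- The delay function is continuous, nondecreasing, nonnegative from the release time on, and
tends to infinity. -/
def Arrival.Valid (q : Arrival P N) : Prop :=
  Continuous q.delay ∧ Monotone q.delay ∧ 0 ≤ q.delay q.release ∧ Tendsto q.delay atTop atTop

/-- A legal input: valid requests, listed by order of release. -/
def ValidInput (Q : List (Arrival P N)) : Prop :=
  Q.Pairwise (fun q q' => q.release ≤ q'.release) ∧ ∀ q ∈ Q, q.Valid

/-- Length of an online input (numbers and delay functions have unit size). -/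
def inputSize (Q : List (Arrival P N)) : ℕ :=
  P.netSize N + Fintype.card (P.Elem N) + (Q.map fun q => 1 + P.reqSize q.req).sum

/-- A schedule: the sets of elements transmitted, with the times of the transmissions. -/
abbrev Schedule (P : NDClass) (N : P.Net) : Type := List (ℝ × Finset (P.Elem N))

namespace Schedule

/-- The times of the transmissions that satisfy `q` after its release. -/
def servingTimes (σ : Schedule P N) (q : Arrival P N) : Set ℝ :=
  {t | ∃ E, (t, E) ∈ σ ∧ q.release ≤ t ∧ P.Serves E q.req}

/-- Every request is served. -/
def Feasible (σ : Schedule P N) (Q : List (Arrival P N)) : Prop :=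
  ∀ q ∈ Q, (σ.servingTimes q).Nonempty

/-- Transmission costs, plus for every request its delay at the first time it is served. -/
def totalCost (σ : Schedule P N) (c : P.Elem N → ℝ≥0) (Q : List (Arrival P N)) : ℝ :=
  (σ.map fun x => ∑ e ∈ x.2, (c e : ℝ)).sum
    + (Q.map fun q => q.delay (sInf (σ.servingTimes q))).sum

end Schedule

/-! ## Online algorithms -/

/-- What an online algorithm wants to do after an activation: go on computing at the present time,
wait until a time (or until the next request, whichever comes first), or wait for the next
request. -/
inductive Next where
  | resume
  | wakeAt (t : ℝ)
  | sleep

/-- The result of an activation: new internal state, possibly a transmission made now, and what to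
do next. -/
structure Response (P : NDClass) (N : P.Net) (State : Type) where
  state : State
  transmit : Option (Finset (P.Elem N))
  next : Next

/-- An online algorithm on a network. It learns of a request, and of its delay function, only when
it is released. The real number handed to an activation is the present time. -/
structure OnlineAlgorithm (P : NDClass) (N : P.Net) where
  State : Type
  start : State
  onRequest : State → ℝ → Arrival P N → RTimed (Response P N State)
  onWake : State → ℝ → RTimed (Response P N State)

namespace OnlineAlgorithm

/-- A snapshot of a run: internal state, present time, what the algorithm waits for, the requests
not yet released, the transmissions made, and the number of steps used. -/
structure Config (alg : OnlineAlgorithm P N) where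
  state : alg.State
  now : ℝ
  next : Next
  future : List (Arrival P N)
  log : Schedule P N
  clock : ℕ

variable (alg : OnlineAlgorithm P N)

/-- Nothing is left to do and no request will come any more. -/
def Config.Halted {alg : OnlineAlgorithm P N} (x : alg.Config) : Prop :=
  x.next = Next.sleep ∧ x.future = []

/-- Carry out an activation at time `t`; the activation itself counts as one step. -/
def activate (x : alg.Config) (t : ℝ) (future : List (Arrival P N))
    (r : RTimed (Response P N alg.State)) : PMF alg.Config :=
  PMF.map
    (fun y : Timed (Response P N alg.State) =>
      { state := y.val.state
        now := t
        next := y.val.next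
        future := future
        log := x.log ++ (y.val.transmit.toList.map fun E => (t, E))
        clock := x.clock + y.steps + 1 }) r

/-- One activation of the algorithm. Requests released at the time the algorithm wants to wake up
are delivered first. -/
def step (x : alg.Config) : PMF alg.Config :=
  match x.next, x.future with
  | .resume, future => alg.activate x x.now future (alg.onWake x.state x.now)
  | .wakeAt s, [] => alg.activate x (max x.now s) [] (alg.onWake x.state (max x.now s))
  | .wakeAt s, q :: future =>
      if q.release ≤ max x.now s then
        alg.activate x q.release future (alg.onRequest x.state q.release q)
      else
        alg.activate x (max x.now s) (q :: future) (alg.onWake x.state (max x.now s))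
  | .sleep, q :: future => alg.activate x q.release future (alg.onRequest x.state q.release q)
  | .sleep, [] => PMF.pure x

/-- The distribution of the snapshot after `n` activations. -/
def run (alg : OnlineAlgorithm P N) (Q : List (Arrival P N)) : ℕ → PMF alg.Config
  | 0 => PMF.pure
      { state := alg.start, now := 0, next := .sleep, future := Q, log := [], clock := 0 }
  | n + 1 => (alg.run Q n).bind alg.step

/-- The expected number of steps used in the first `n` activations. -/
def expectedClock (Q : List (Arrival P N)) (n : ℕ) : ℝ≥0∞ :=
  ∑' x : alg.Config, alg.run Q n x * (x.clock : ℝ≥0∞)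

def IsDeterministic : Prop :=
  (∀ s t q, (alg.onRequest s t q).IsDeterministic) ∧ ∀ s t, (alg.onWake s t).IsDeterministic

end OnlineAlgorithm

/-- An online algorithm for a class of problems, given the network and the element costs. -/
abbrev OnlineFamily (P : NDClass) : Type 1 :=
  ∀ N : P.Net, (P.Elem N → ℝ≥0) → OnlineAlgorithm P N

namespace OnlineFamily

/-- On every legal input the algorithm halts after finitely many activations, and every possible
outcome serves all requests at a cost of at most `ρ` times that of any schedule that serves all
requests. -/
def IsCompetitive (F : OnlineFamily P) (ρ : P.Net → ℝ) : Prop :=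
  ∀ (N : P.Net) (c : P.Elem N → ℝ≥0) (Q : List (Arrival P N)), ValidInput Q →
    ∃ n : ℕ, ∀ x ∈ ((F N c).run Q n).support,
      x.Halted ∧ x.log.Feasible Q ∧
        ∀ σ : Schedule P N, σ.Feasible Q → x.log.totalCost c Q ≤ ρ N * σ.totalCost c Q

def IsDeterministic (F : OnlineFamily P) : Prop :=
  ∀ (N : P.Net) (c : P.Elem N → ℝ≥0), (F N c).IsDeterministic

/-- The expected running time of the whole run (for a deterministic algorithm: the running time) is
polynomial in the length of the input. -/
def PolyTime (F : OnlineFamily P) : Prop :=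
  ∃ p : Polynomial ℕ, ∀ (N : P.Net) (c : P.Elem N → ℝ≥0) (Q : List (Arrival P N)), ValidInput Q →
    ∀ n : ℕ, (F N c).expectedClock Q n ≤ ((p.eval (inputSize Q) : ℕ) : ℝ≥0∞)

end OnlineFamily

/-! ## The delay framework -/

namespace Framework

/-- What the framework keeps for a pending request: its number in the order of arrival, what it
asks for, its delay function, its investment counter, its level, and the solution computed for it
alone. -/
structure Pending (P : NDClass) (N : P.Net) where
  index : ℕ
  req : P.Req N
  delay : ℝ → ℝ
  counter : ℝ
  level : ℤ
  single : Finset (P.Elem N)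

/-- With `s` the present time this is the residual delay; with `s` a future time it is the penalty
of the request for forwarding to time `s`. -/
def Pending.residual (q : Pending P N) (s : ℝ) : ℝ := max 0 (q.delay s - q.counter)

/-- A service in progress: its level, the cheap elements, its eligible requests, and the variables
of the time-forwarding loop, namely the time forwarded to so far and the current solution (as a set
of elements and a set of requests served). -/
structure Service (P : NDClass) (N : P.Net) where
  level : ℤ
  cheap : Finset (P.Elem N)
  eligible : List (Pending P N)
  time : ℝ
  served : Finset (Fin eligible.length)
  elems : Finset (P.Elem N)

/-- The state of the framework. During a service, `pending` holds the requests that are not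
eligible. -/
structure State (P : NDClass) (N : P.Net) where
  arrived : ℕ
  pending : List (Pending P N)
  service : Option (Service P N)

variable (A : PCAlgorithm P) (γ : ℝ) (c : P.Elem N → ℝ≥0)

/-- A call to the prize-collecting algorithm: besides the steps of the call itself, one step is
charged for each number written into its input and for each entry read from its output. -/
def call (I : PCInstance P N) : RTimed I.Solution := do
  Timed.tick (2 * (Fintype.card (P.Elem N) + I.n))
  A N I

/-- When to wake up: at the first time from `t` on at which a level becomes critical, that is, the
residual delay of the requests of level at most `j` reaches `2 ^ j`. Only levels of pending
requests have to be considered, since the first level to become critical is one of them. -/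
def nextCritical (L : List (Pending P N)) (t : ℝ) : Timed Next := do
  let times ← Timed.each fun i : Fin L.length => do
    let lower ← Timed.select fun k : Fin L.length => (L.get k).level ≤ (L.get i).level
    let threshold ← Timed.op ((2 : ℝ) ^ (L.get i).level)
    Timed.hittingTime lower (fun k => (L.get k).residual) t threshold
  Timed.tick L.length
  match L with
  | [] => pure .sleep
  | _ :: _ => pure (.wakeAt (⨅ i, times i))

/-- A request is released at time `t`. The solution for it alone comes from a prize-collecting
instance whose penalty exceeds `γ` times the cost of all elements, so that it acts as an infinite
penalty. If that solution is free, the level would be `⌊log 0⌋ = -∞`, and the request is served at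
once. -/
def uponRequest (st : State P N) (t : ℝ) (q : Arrival P N) :
    RTimed (Response P N (State P N)) := do
  let total ← Timed.sumOn Finset.univ (fun e => (c e : ℝ))
  let scaled ← Timed.op (γ * total)
  let penalty ← Timed.op (scaled + 1)
  let sol ← call A
    { cost := c, n := 1, req := fun _ => q.req, pen := fun _ => penalty.toNNReal }
  let price ← Timed.sumOn sol.elems (fun e => (c e : ℝ))
  let free ← Timed.op (decide (price = 0))
  if free then
    let next ← nextCritical st.pending t
    pure
      { state := { st with arrived := st.arrived + 1 }
        transmit := some sol.elems
        next := next }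
  else
    let estimate ← Timed.op (price / γ)
    let level ← Timed.op ⌊Real.logb 2 estimate⌋
    let pending := st.pending ++
      [{ index := st.arrived, req := q.req, delay := q.delay, counter := 0, level := level
         single := sol.elems }]
    let next ← nextCritical pending t
    Timed.tick 2
    pure
      { state := { st with arrived := st.arrived + 1, pending := pending }
        transmit := none
        next := next }

/-- Set `h_q ← h_q + ρ_q(t)`. -/
def Pending.clean (q : Pending P N) (t : ℝ) : Pending P N :=
  { q with counter := q.counter + q.residual t }

/-- Raise the counter by the penalty for forwarding to time `τ`, and set the level. -/
def Pending.upgrade (q : Pending P N) (τ : ℝ) (level : ℤ) : Pending P N :=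
  { q with counter := q.counter + q.residual τ, level := level }

/-- A level becomes critical at time `t` (the lowest one, if there are several): a service of the
next higher level starts. It cleans the residual delay of the eligible requests and determines the
cheap elements; then the time-forwarding loop begins. -/
def uponCritical (st : State P N) (t : ℝ) : Timed (Response P N (State P N)) := do
  let L := st.pending
  let ρ ← Timed.each fun i : Fin L.length => Timed.ops 3 ((L.get i).residual t)
  let excess ← Timed.each fun i : Fin L.length => do
    let lower ← Timed.select fun k : Fin L.length => (L.get k).level ≤ (L.get i).level
    let amount ← Timed.sumOn lower ρ
    let threshold ← Timed.op ((2 : ℝ) ^ (L.get i).level)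
    Timed.op (amount - threshold)
  let critical ← Timed.select fun i => 0 ≤ excess i
  if h : critical.Nonempty then
    Timed.tick L.length
    let level ← Timed.op (critical.inf' h (fun i => (L.get i).level) + 1)
    let eligible := (L.filter fun q => q.level ≤ level).map fun q => q.clean t
    let others := L.filter fun q => level < q.level
    Timed.tick (2 * L.length + 5 * eligible.length)
    let budget ← Timed.op ((2 : ℝ) ^ level)
    let bound ← Timed.op (budget / (Fintype.card (P.Elem N) : ℝ))
    let cheap ← Timed.select fun e => (c e : ℝ) ≤ bound
    pure
      { state :=
          { st with
            pending := others
            service := some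
              { level := level, cheap := cheap, eligible := eligible, time := t
                served := ∅, elems := ∅ } }
        transmit := none
        next := .resume }
  else
    let next ← nextCritical L t
    pure { state := st, transmit := none, next := next }

/-- The end of a service at time `t`, once time forwarding has returned the time `τ` and the
solution stored in `v`. If the solution serves no request, it is replaced by the solution for one
eligible request. Eligible requests that are not served get their investment and their new level;
the solution is transmitted together with the cheap elements. -/
def finishService (st : State P N) (v : Service P N) (t τ : ℝ) :
    Timed (Response P N (State P N)) := do
  let choice : Finset (Fin v.eligible.length) × Finset (P.Elem N) :=
    if v.served = ∅ then
      if h : 0 < v.eligible.length then ({⟨0, h⟩}, (v.eligible.get ⟨0, h⟩).single)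
      else (∅, v.elems)
    else (v.served, v.elems)
  Timed.tick (v.eligible.length + Fintype.card (P.Elem N))
  let upgraded ← Timed.each fun i : Fin v.eligible.length =>
    Timed.ops 5 ((v.eligible.get i).upgrade τ v.level)
  Timed.tick (v.eligible.length + st.pending.length + Fintype.card (P.Elem N))
  let pending := st.pending ++
    ((List.finRange v.eligible.length).filter fun i => i ∉ choice.1).map upgraded
  let next ← nextCritical pending t
  pure
    { state := { st with pending := pending, service := none }
      transmit := some (v.cheap ∪ choice.2)
      next := next }

/-- One pass through the time-forwarding loop of the service `v`, at time `t`. The loop ends when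
the current solution serves all eligible requests, or when the new solution costs `γ * 2 ^ level` or
more. In the first case the time returned is the one forwarded to so far; in the second it is the
new time, with the previous solution. -/
def forwardTime (st : State P N) (v : Service P N) (t : ℝ) :
    RTimed (Response P N (State P N)) := do
  let unserved ← Timed.select fun i => i ∉ v.served
  if unserved = ∅ then
    finishService st v t v.time
  else
    let budget ← Timed.op ((2 : ℝ) ^ v.level)
    let limit ← Timed.op (γ * budget)
    let reached ← Timed.each fun i : Fin v.eligible.length =>
      Timed.ops 3 ((v.eligible.get i).residual v.time)
    let time ← Timed.hittingTime unserved
      (fun i s => (v.eligible.get i).residual s - reached i) t limit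
    let penalty ← Timed.each fun i : Fin v.eligible.length =>
      Timed.ops 3 ((v.eligible.get i).residual time)
    let reduced ← Timed.each fun e => Timed.ops 2 (if e ∈ v.cheap then 0 else c e)
    let sol ← call A
      { cost := reduced, n := v.eligible.length, req := fun i => (v.eligible.get i).req
        pen := fun i => (penalty i).toNNReal }
    let bought ← Timed.sumOn sol.elems (fun e => (reduced e : ℝ))
    let fined ← Timed.sumOn sol.servedᶜ penalty
    let price ← Timed.op (bought + fined)
    let full ← Timed.op (decide (limit ≤ price))
    if full then
      finishService st v t time
    else
      pure
        { state :=
            { st with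
              service := some
                { level := v.level, cheap := v.cheap, eligible := v.eligible, time := time
                  served := sol.served, elems := sol.elems } }
          transmit := none
          next := .resume }

/-- The framework as an online algorithm. -/
def algorithm : OnlineAlgorithm P N where
  State := State P N
  start := { arrived := 0, pending := [], service := none }
  onRequest := uponRequest A γ c
  onWake st t :=
    match st.service with
    | none => liftM (uponCritical c st t)
    | some v => forwardTime A γ c st v t

end Framework

/-- The delay framework, applied to a prize-collecting algorithm `A` with ratio `γ`. -/
def delayFramework (A : PCAlgorithm P) (γ : P.Net → ℝ) : OnlineFamily P :=
  fun N c => Framework.algorithm A (γ N) c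

end NetworkDesign

end

/-!
The analysis compares the framework with a fixed schedule `σ` that serves all requests. Its measure
is the *work* `W`, the sum of `2 ^ ℓ` over all services of level `ℓ`.

*The framework pays `O(γ W)` beyond unavoidable delay.* A service of level `ℓ` transmits elements of
cost at most `3 γ 2 ^ ℓ` (`choice_spec`), and the investment counters dominate the delay of the
requests that are served. Cleaning raises the counters by at most `2 ^ ℓ`, because no level was
overcritical before; forwarding time raises those of the requests left behind by at most
`2 γ 2 ^ ℓ`. The only exception is delay that a request has on its release already, which `σ` pays
as well.

*The work is paid by `σ`, up to a logarithm.* Let a service of level `j + 1` start at time `t`. The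
lowest critical level is `j`, so the requests of level `j` itself have residual delay `2 ^ j / 2` at
least; this work is charged by `charge`. If some of that delay belongs to a request that an earlier
service moved to level `j`, then `t` lies beyond the horizon of the last service of level `j`. That
service ended because the prize-collecting algorithm returned a solution of cost `γ 2 ^ j` or more,
so the transmissions of `σ` up to the horizon, with the penalties of the requests that `σ` did not
serve by then, cost at least `2 ^ j` (`claim_of_le_cost`). Otherwise the delay belongs to requests
that cost `2 ^ j` on their own. Either `σ` has served one of them, or it pays their delay. Delay
of `σ` is charged at most once because the charge is for an increase of `min (counter, delay in σ)`.
A transmission of `σ` is charged at most once by each level, because a service of level `j + 1`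
leaves no request of level up to `j` that was released earlier. The charge by level `j` is
truncated at `2 ^ j` and omits the elements that are cheap at this level, so that every element
counts fully for `O(log |ℰ|)` levels only, with `ℰ` the set of elements, and in a geometric series
for the others (`sum_load_le`).

*Termination and running time.* In each round of the time-forwarding loop the penalties, truncated at
`2 γ 2 ^ ℓ`, grow by `γ 2 ^ ℓ` in total, so that a service of `n` requests has at most `2 n` rounds
(`Busy.round_le`). Each service serves a request. This bounds the number of activations
quadratically (`inv_run`), and each activation takes polynomially many expected steps
(`expectedClock_step_le`).

The accounting is an invariant of the possible snapshots of a run (`Idle`, `Busy`); it speaks about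
a ledger that is not part of the algorithm, and is preserved by `request_step`, `critical_step`,
`finish_step` and `forward_step`.
-/

noncomputable section

namespace NetworkDesign

variable {P : NDClass} {N : P.Net}

/-! ### Values and expected steps of randomized computations -/

@[simp] theorem Timed.val_bind {α β : Type} (x : Timed α) (f : α → Timed β) :
    (x >>= f).val = (f x.val).val := rfl

@[simp] theorem Timed.steps_bind {α β : Type} (x : Timed α) (f : α → Timed β) :
    (x >>= f).steps = x.steps + (f x.val).steps := rfl

@[simp] theorem Timed.steps_pure {α : Type} (a : α) : (pure a : Timed α).steps = 0 := rfl

namespace RTimed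

/-- The distribution of results and step counts that a randomized computation stands for. -/
def toPMF {α : Type} (x : RTimed α) : PMF (Timed α) := x

/-- The possible results of a randomized computation, without their step counts. -/
def vals {α : Type} (x : RTimed α) : Set α := {a | ∃ y ∈ x.toPMF.support, y.val = a}

theorem toPMF_bind {α β : Type} (x : RTimed α) (f : α → RTimed β) :
    (x >>= f).toPMF =
      x.toPMF.bind fun a => (f a.val).toPMF.map fun b => ⟨b.val, a.steps + b.steps⟩ := rfl

theorem toPMF_lift {α : Type} (x : Timed α) : (liftM x : RTimed α).toPMF = PMF.pure x := rfl

theorem expectedSteps_def {α : Type} (x : RTimed α) :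
    x.expectedSteps = ∑' a, x.toPMF a * (a.steps : ℝ≥0∞) := rfl

@[simp] theorem mem_vals_lift {α : Type} {a : α} {x : Timed α} :
    a ∈ vals (liftM x : RTimed α) ↔ a = x.val := by
  simp [vals, toPMF_lift, eq_comm]

@[simp] theorem mem_vals_pure {α : Type} {a b : α} : a ∈ vals (pure b : RTimed α) ↔ a = b :=
  mem_vals_lift (x := pure b)

@[simp] theorem mem_vals_bind {α β : Type} {x : RTimed α} {f : α → RTimed β} {b : β} :
    b ∈ vals (x >>= f) ↔ ∃ a ∈ vals x, b ∈ vals (f a) := by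
  constructor
  · rintro ⟨y, hy, rfl⟩
    rw [toPMF_bind, PMF.mem_support_bind_iff] at hy
    obtain ⟨a, ha, hy⟩ := hy
    rw [PMF.mem_support_map_iff] at hy
    obtain ⟨z, hz, rfl⟩ := hy
    exact ⟨a.val, ⟨a, ha, rfl⟩, z, hz, rfl⟩
  · rintro ⟨_, ⟨a, ha, rfl⟩, z, hz, rfl⟩
    refine ⟨⟨z.val, a.steps + z.steps⟩, ?_, rfl⟩
    rw [toPMF_bind, PMF.mem_support_bind_iff]
    refine ⟨a, ha, ?_⟩
    rw [PMF.mem_support_map_iff]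
    exact ⟨z, hz, rfl⟩

theorem expectedSteps_lift {α : Type} (x : Timed α) :
    expectedSteps (liftM x : RTimed α) = x.steps := by
  rw [expectedSteps_def, toPMF_lift, tsum_eq_single x]
  · simp
  · intro b hb
    simp [PMF.pure_apply, hb]

@[simp] theorem expectedSteps_pure {α : Type} (a : α) :
    expectedSteps (pure a : RTimed α) = 0 :=
  (expectedSteps_lift (pure a : Timed α)).trans (by simp)

end RTimed

/-- The expectation of a function under a bind, as an iterated expectation. -/
theorem tsum_bind_mul {α β : Type*} (p : PMF α) (f : α → PMF β) (g : β → ℝ≥0∞) :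
    ∑' b, (p.bind f) b * g b = ∑' a, p a * ∑' b, f a b * g b := by
  simp only [PMF.bind_apply, ← ENNReal.tsum_mul_right, ← ENNReal.tsum_mul_left]
  rw [ENNReal.tsum_comm]
  simp only [mul_assoc]

/-- The expectation of a function under the image of a distribution. -/
theorem tsum_map_mul {α β : Type*} (p : PMF α) (f : α → β) (g : β → ℝ≥0∞) :
    ∑' b, (p.map f) b * g b = ∑' a, p a * g (f a) := by
  rw [← PMF.bind_pure_comp, tsum_bind_mul]
  refine tsum_congr fun a => ?_
  congr 1
  rw [tsum_eq_single (f a)]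
  · simp
  · intro b hb
    simp [PMF.pure_apply, hb]

/-- An expectation is at most any bound that holds on the support. -/
theorem tsum_pmf_mul_le {α : Type*} (p : PMF α) (g : α → ℝ≥0∞) (B : ℝ≥0∞)
    (h : ∀ a ∈ p.support, g a ≤ B) : ∑' a, p a * g a ≤ B := by
  calc ∑' a, p a * g a ≤ ∑' a, p a * B := by
        refine ENNReal.tsum_le_tsum fun a => ?_
        by_cases ha : a ∈ p.support
        · gcongr
          exact h a ha
        · rw [PMF.mem_support_iff, not_not] at ha
          simp [ha]
    _ = B := by rw [ENNReal.tsum_mul_right, PMF.tsum_coe, one_mul]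

theorem RTimed.expectedSteps_bind {α β : Type} (x : RTimed α) (f : α → RTimed β) :
    (x >>= f).expectedSteps =
      x.expectedSteps + ∑' a, x.toPMF a * (f a.val).expectedSteps := by
  simp only [RTimed.expectedSteps_def, RTimed.toPMF_bind, tsum_bind_mul]
  rw [← ENNReal.tsum_add]
  refine tsum_congr fun a => ?_
  rw [tsum_map_mul, ← mul_add]
  push_cast
  simp only [mul_add]
  rw [ENNReal.tsum_add, ENNReal.tsum_mul_right, PMF.tsum_coe, one_mul, mul_add]

theorem RTimed.expectedSteps_bind_le {α β : Type} (x : RTimed α) (f : α → RTimed β)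
    (B : ℝ≥0∞) (h : ∀ a ∈ x.vals, (f a).expectedSteps ≤ B) :
    (x >>= f).expectedSteps ≤ x.expectedSteps + B := by
  rw [RTimed.expectedSteps_bind]
  gcongr
  exact tsum_pmf_mul_le _ _ _ fun a ha => h a.val ⟨a, ha, rfl⟩

theorem RTimed.expectedSteps_lift_bind {α β : Type} (x : Timed α) (f : α → RTimed β) :
    (liftM x >>= f : RTimed β).expectedSteps = x.steps + (f x.val).expectedSteps := by
  rw [RTimed.expectedSteps_bind, RTimed.expectedSteps_lift, RTimed.toPMF_lift, tsum_eq_single x]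
  · simp
  · intro b hb
    simp [PMF.pure_apply, hb]

theorem RTimed.IsDeterministic.bind {α β : Type} {x : RTimed α} {f : α → RTimed β}
    (hx : x.IsDeterministic) (hf : ∀ a, (f a).IsDeterministic) : (x >>= f).IsDeterministic := by
  obtain ⟨a, ha⟩ := hx
  obtain ⟨b, hb⟩ := hf a.val
  refine ⟨⟨b.val, a.steps + b.steps⟩, ?_⟩
  have ha' : x.toPMF = PMF.pure a := ha
  have hb' : (f a.val).toPMF = PMF.pure b := hb
  change (x >>= f).toPMF = _
  rw [RTimed.toPMF_bind, ha', PMF.pure_bind, hb', PMF.pure_map]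

theorem RTimed.isDeterministic_lift {α : Type} (x : Timed α) :
    (liftM x : RTimed α).IsDeterministic := ⟨x, rfl⟩

theorem RTimed.isDeterministic_pure {α : Type} (a : α) :
    (pure a : RTimed α).IsDeterministic := ⟨⟨a, 0⟩, rfl⟩

namespace Framework

/-! ### Determinism -/

theorem call_isDeterministic {A : PCAlgorithm P} (hA : A.IsDeterministic) (I : PCInstance P N) :
    (call A I).IsDeterministic :=
  (RTimed.isDeterministic_lift _).bind fun _ => hA N I

theorem uponRequest_isDeterministic {A : PCAlgorithm P} (hA : A.IsDeterministic) (γ : ℝ)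
    (c : P.Elem N → ℝ≥0) (st : State P N) (t : ℝ) (q : Arrival P N) :
    (uponRequest A γ c st t q).IsDeterministic := by
  unfold uponRequest
  refine (RTimed.isDeterministic_lift _).bind fun _ => ?_
  refine (RTimed.isDeterministic_lift _).bind fun _ => ?_
  refine (RTimed.isDeterministic_lift _).bind fun _ => ?_
  refine (call_isDeterministic hA _).bind fun _ => ?_
  refine (RTimed.isDeterministic_lift _).bind fun _ => ?_
  refine (RTimed.isDeterministic_lift _).bind fun free => ?_
  cases free
  · refine (RTimed.isDeterministic_lift _).bind fun _ => ?_
    refine (RTimed.isDeterministic_lift _).bind fun _ => ?_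
    refine (RTimed.isDeterministic_lift _).bind fun _ => ?_
    refine (RTimed.isDeterministic_lift _).bind fun _ => ?_
    exact RTimed.isDeterministic_pure _
  · refine (RTimed.isDeterministic_lift _).bind fun _ => ?_
    exact RTimed.isDeterministic_pure _

theorem forwardTime_isDeterministic {A : PCAlgorithm P} (hA : A.IsDeterministic) (γ : ℝ)
    (c : P.Elem N → ℝ≥0) (st : State P N) (v : Service P N) (t : ℝ) :
    (forwardTime A γ c st v t).IsDeterministic := by
  unfold forwardTime
  refine (RTimed.isDeterministic_lift _).bind fun unserved => ?_
  split
  · exact RTimed.isDeterministic_lift _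
  · refine (RTimed.isDeterministic_lift _).bind fun _ => ?_
    refine (RTimed.isDeterministic_lift _).bind fun _ => ?_
    refine (RTimed.isDeterministic_lift _).bind fun _ => ?_
    refine (RTimed.isDeterministic_lift _).bind fun _ => ?_
    refine (RTimed.isDeterministic_lift _).bind fun _ => ?_
    refine (RTimed.isDeterministic_lift _).bind fun _ => ?_
    refine (call_isDeterministic hA _).bind fun _ => ?_
    refine (RTimed.isDeterministic_lift _).bind fun _ => ?_
    refine (RTimed.isDeterministic_lift _).bind fun _ => ?_
    refine (RTimed.isDeterministic_lift _).bind fun _ => ?_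
    refine (RTimed.isDeterministic_lift _).bind fun full => ?_
    cases full
    · exact RTimed.isDeterministic_pure _
    · exact RTimed.isDeterministic_lift _

theorem algorithm_isDeterministic {A : PCAlgorithm P} (hA : A.IsDeterministic) (γ : ℝ)
    (c : P.Elem N → ℝ≥0) : (algorithm A γ c).IsDeterministic := by
  refine ⟨fun st t q => uponRequest_isDeterministic hA γ c st t q, fun st t => ?_⟩
  change RTimed.IsDeterministic (match (st : State P N).service with
    | none => liftM (uponCritical c st t)
    | some v => forwardTime A γ c st v t)
  split
  · exact RTimed.isDeterministic_lift _
  · exact forwardTime_isDeterministic hA γ c _ _ t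

end Framework

/-! ### Sums over lists -/

theorem sum_get {α : Type*} (L : List α) (φ : α → ℝ) :
    ∑ i : Fin L.length, φ (L.get i) = (L.map φ).sum := by
  simp [Fin.sum_univ_fun_getElem]

theorem sum_finRange_filter {n : ℕ} (p : Fin n → Prop) [DecidablePred p] (φ : Fin n → ℝ) :
    (((List.finRange n).filter fun i => p i).map φ).sum = ∑ i with p i, φ i := by
  rw [← List.sum_toFinset _ ((List.nodup_finRange n).filter _)]
  refine Finset.sum_congr ?_ fun _ _ => rfl
  ext i
  simp

theorem sum_get_filter {α : Type*} (L : List α) (p : α → Prop) [DecidablePred p] (φ : α → ℝ) :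
    ∑ i : Fin L.length with p (L.get i), φ (L.get i) = ((L.filter fun a => p a).map φ).sum := by
  induction L with
  | nil => simp
  | cons a L ih =>
    rw [Finset.sum_filter] at ih ⊢
    simp only [List.get_eq_getElem] at ih
    simp only [List.length_cons, Fin.sum_univ_succ, List.get_eq_getElem, Fin.val_succ,
      List.getElem_cons_succ, ih]
    by_cases h : p a <;> simp [h]

theorem sum_filter_add_sum_filter_not {α : Type*} (L : List α) (p r : α → Prop) [DecidablePred p]
    [DecidablePred r] (h : ∀ a, r a ↔ ¬ p a) (φ : α → ℝ) :
    ((L.filter fun a => p a).map φ).sum + ((L.filter fun a => r a).map φ).sum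
      = (L.map φ).sum := by
  induction L with
  | nil => simp
  | cons a L ih =>
    by_cases hp : p a
    · simp [hp, h, ← ih, add_assoc]
    · simp [hp, h, ← ih]; ring

theorem sum_filter_le {α : Type*} (L : List α) (p : α → Prop) [DecidablePred p] (φ : α → ℝ)
    (h : ∀ a ∈ L, ¬ p a → 0 ≤ φ a) : ((L.filter fun a => p a).map φ).sum ≤ (L.map φ).sum := by
  induction L with
  | nil => simp
  | cons a L ih =>
    have ih' := ih fun a ha => h a (by simp [ha])
    by_cases hp : p a
    · simp [hp, ih']
    · have := h a (by simp) hp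
      simp [hp]; linarith

theorem sum_map_le {α : Type*} (L : List α) (φ ψ : α → ℝ) (h : ∀ a ∈ L, φ a ≤ ψ a) :
    (L.map φ).sum ≤ (L.map ψ).sum := List.sum_le_sum h

theorem sum_map_nonneg {α : Type*} (L : List α) (φ : α → ℝ) (h : ∀ a ∈ L, 0 ≤ φ a) :
    0 ≤ (L.map φ).sum := List.sum_nonneg (by simpa using h)

theorem le_sum_map {α : Type*} (L : List α) (φ : α → ℝ) (h : ∀ a ∈ L, 0 ≤ φ a) {a : α}
    (ha : a ∈ L) : φ a ≤ (L.map φ).sum :=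
  List.single_le_sum (by simpa using h) _ (List.mem_map_of_mem ha)

theorem continuous_sum_map {α : Type*} (L : List α) (φ : α → ℝ → ℝ)
    (h : ∀ a ∈ L, Continuous (φ a)) : Continuous fun s => (L.map fun a => φ a s).sum :=
  continuous_list_sum L h

/-! ### Geometric sums over levels -/

theorem sum_zpow_le (S : Finset ℤ) (m : ℤ) (h : ∀ j ∈ S, j ≤ m) :
    ∑ j ∈ S, (2 : ℝ) ^ j ≤ 2 ^ (m + 1) := by
  induction S using Finset.induction_on_max generalizing m with
  | empty => simp; positivity
  | insert a S ha ih =>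
    have h1 := ih (a - 1) fun j hj => by have := ha j hj; omega
    rw [Finset.sum_insert fun hmem => lt_irrefl _ (ha a hmem)]
    have h2 : (2 : ℝ) ^ (a + 1) ≤ 2 ^ (m + 1) :=
      zpow_le_zpow_right₀ (by norm_num) (by have := h a (by simp); omega)
    rw [zpow_add_one₀ (by norm_num)] at h2
    rw [sub_add_cancel] at h1
    linarith

theorem zpow_le_iff_le_floor_logb {a : ℝ} (ha : 0 < a) (j : ℤ) :
    (2 : ℝ) ^ j ≤ a ↔ j ≤ ⌊Real.logb 2 a⌋ := by
  rw [Int.le_floor, Real.le_logb_iff_rpow_le (by norm_num) ha, Real.rpow_intCast]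

theorem sum_zpow_le_of_le (S : Finset ℤ) (a : ℝ) (ha : 0 ≤ a) :
    ∑ j ∈ S, (if (2 : ℝ) ^ j ≤ a then (2 : ℝ) ^ j else 0) ≤ 2 * a := by
  rcases ha.eq_or_lt with rfl | ha
  · refine (Finset.sum_eq_zero fun j _ => if_neg ?_).le.trans (by simp)
    exact not_le.2 (by positivity)
  · rw [← Finset.sum_filter]
    refine (sum_zpow_le _ ⌊Real.logb 2 a⌋ fun j hj => ?_).trans ?_
    · exact (zpow_le_iff_le_floor_logb ha j).1 (Finset.mem_filter.1 hj).2
    · rw [zpow_add_one₀ (by norm_num)]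
      have := (zpow_le_iff_le_floor_logb ha _).2 le_rfl
      linarith

/-- Levels below an element's price contribute a geometric series, and only about `log₂ n` of the
levels above its price are not so high that the element counts as cheap. -/
theorem sum_min_zpow_le (S : Finset ℤ) (n : ℕ) (hn : 1 ≤ n) (a : ℝ) (ha : 0 ≤ a) :
    ∑ j ∈ S, (if (2 : ℝ) ^ j < n * a then min a ((2 : ℝ) ^ j) else 0)
      ≤ (3 + Real.logb 2 n) * a := by
  rcases ha.eq_or_lt with rfl | ha
  · refine (Finset.sum_eq_zero fun j _ => if_neg ?_).le.trans (by simp)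
    simp only [mul_zero, not_lt]
    positivity
  · have hn' : (1 : ℝ) ≤ n := by exact_mod_cast hn
    have hna : 0 < n * a := by positivity
    set lo := ⌊Real.logb 2 a⌋
    set hi := ⌊Real.logb 2 (n * a)⌋
    have h1 : ∑ j ∈ S, (if (2 : ℝ) ^ j < n * a then min a ((2 : ℝ) ^ j) else 0)
        ≤ ∑ j ∈ S, ((if (2 : ℝ) ^ j ≤ a then (2 : ℝ) ^ j else 0)
          + if j ∈ Finset.Ioc lo hi then a else 0) := by
      refine Finset.sum_le_sum fun j _ => ?_
      by_cases hj : (2 : ℝ) ^ j < n * a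
      · rw [if_pos hj]
        by_cases hj' : (2 : ℝ) ^ j ≤ a
        · rw [if_pos hj']
          have : (0 : ℝ) ≤ if j ∈ Finset.Ioc lo hi then a else 0 := by split <;> linarith
          linarith [min_le_right a ((2 : ℝ) ^ j)]
        · have hlo : lo < j := by
            rw [zpow_le_iff_le_floor_logb ha] at hj'
            exact not_le.1 hj'
          have hhi : j ≤ hi := (zpow_le_iff_le_floor_logb hna j).1 hj.le
          rw [if_neg hj', if_pos (Finset.mem_Ioc.2 ⟨hlo, hhi⟩), zero_add]
          exact min_le_left _ _
      · rw [if_neg hj]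
        refine add_nonneg ?_ ?_ <;> split <;> positivity
    refine h1.trans ?_
    rw [Finset.sum_add_distrib]
    have h2 : ∑ j ∈ S, (if j ∈ Finset.Ioc lo hi then a else 0) ≤ (Real.logb 2 n + 1) * a := by
      rw [← Finset.sum_filter, Finset.sum_const, nsmul_eq_mul]
      refine mul_le_mul_of_nonneg_right ?_ ha.le
      have hc : (S.filter (· ∈ Finset.Ioc lo hi)).card ≤ (Finset.Ioc lo hi).card :=
        Finset.card_le_card fun j hj => (Finset.mem_filter.1 hj).2
      have hle : lo ≤ hi :=
        Int.floor_le_floor (Real.logb_le_logb_of_le (by norm_num) ha (by nlinarith))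
      have hc' : ((Finset.Ioc lo hi).card : ℝ) = hi - lo := by
        rw [Int.card_Ioc]
        have : ((hi - lo).toNat : ℤ) = hi - lo := Int.toNat_of_nonneg (by omega)
        exact_mod_cast this
      have h3 : (hi : ℝ) ≤ Real.logb 2 n + Real.logb 2 a := by
        rw [← Real.logb_mul (by positivity) (by positivity)]
        exact Int.floor_le _
      have h4 : Real.logb 2 a < lo + 1 := Int.lt_floor_add_one _
      have : ((S.filter (· ∈ Finset.Ioc lo hi)).card : ℝ) ≤ (Finset.Ioc lo hi).card := by
        exact_mod_cast hc
      linarith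
    linarith [sum_zpow_le_of_le S a ha.le]

theorem logb_two_le (n : ℕ) (hn : 1 ≤ n) : Real.logb 2 n ≤ 2 * Real.log n := by
  have h0 : 0 ≤ Real.log n := Real.log_nonneg (by exact_mod_cast hn)
  have h2 := Real.log_two_gt_d9
  rw [Real.logb, div_le_iff₀ (by linarith)]
  nlinarith

/-! ### Hitting times of continuous functions -/

theorem le_of_forall_Ico_le {g : ℝ → ℝ} (hg : Continuous g) {a r θ : ℝ} (har : a < r)
    (h : ∀ s, a ≤ s → s < r → g s ≤ θ) : g r ≤ θ := by
  have hev : ∀ᶠ s in nhdsWithin r (Set.Iio r), g s ≤ θ := by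
    filter_upwards [Ico_mem_nhdsLT har] with s hs using h s hs.1 hs.2
  exact le_of_tendsto (hg.continuousWithinAt (s := Set.Iio r)) hev

/-- The first time from `t` on at which `f` reaches `θ`. -/
def firstHit (f : ℝ → ℝ) (t θ : ℝ) : ℝ := sInf {s | t ≤ s ∧ θ ≤ f s}

theorem firstHit_spec {f : ℝ → ℝ} (hf : Continuous f) (hf' : Tendsto f atTop atTop) (t θ : ℝ) :
    t ≤ firstHit f t θ ∧ θ ≤ f (firstHit f t θ) := by
  have hne : {s | t ≤ s ∧ θ ≤ f s}.Nonempty :=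
    ((eventually_ge_atTop t).and (hf'.eventually_ge_atTop θ)).exists
  have hcl : IsClosed {s | t ≤ s ∧ θ ≤ f s} :=
    (isClosed_Ici (a := t)).inter (isClosed_le continuous_const hf)
  exact hcl.csInf_mem hne ⟨t, fun s hs => hs.1⟩

theorem lt_of_lt_firstHit {f : ℝ → ℝ} {t θ s : ℝ} (hs : t ≤ s) (hs' : s < firstHit f t θ) :
    f s < θ := by
  by_contra! h
  exact absurd (csInf_le ⟨t, fun s hs => hs.1⟩ (show s ∈ {s | t ≤ s ∧ θ ≤ f s} from ⟨hs, h⟩))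
    (not_le.2 hs')

theorem firstHit_eq {f : ℝ → ℝ} (hf : Continuous f) (hf' : Tendsto f atTop atTop) {t θ : ℝ}
    (h : f t ≤ θ) : f (firstHit f t θ) = θ := by
  obtain ⟨h1, h2⟩ := firstHit_spec hf hf' t θ
  refine le_antisymm ?_ h2
  rcases h1.eq_or_lt with h3 | h3
  · rwa [← h3]
  · exact le_of_forall_Ico_le hf h3 fun s hs hs' => (lt_of_lt_firstHit hs hs').le

/-! ### First serving times -/

namespace Schedule

/-- The delay that a schedule incurs for a request. -/
def due (σ : Schedule P N) (a : Arrival P N) : ℝ := a.delay (sInf (σ.servingTimes a))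

theorem finite_servingTimes (σ : Schedule P N) (a : Arrival P N) : (σ.servingTimes a).Finite := by
  refine (List.finite_toSet (σ.map Prod.fst)).subset ?_
  rintro t ⟨E, hE, -⟩
  exact List.mem_map.2 ⟨_, hE, rfl⟩

theorem sInf_mem_servingTimes {σ : Schedule P N} {a : Arrival P N}
    (h : (σ.servingTimes a).Nonempty) : sInf (σ.servingTimes a) ∈ σ.servingTimes a :=
  h.csInf_mem (finite_servingTimes σ a)

theorem due_le {σ : Schedule P N} {a : Arrival P N} (ha : Monotone a.delay) {t : ℝ}
    (ht : t ∈ σ.servingTimes a) : σ.due a ≤ a.delay t :=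
  ha (csInf_le (finite_servingTimes σ a).bddBelow ht)

theorem delay_release_le_due {σ : Schedule P N} {a : Arrival P N} (ha : Monotone a.delay)
    (h : (σ.servingTimes a).Nonempty) : a.delay a.release ≤ σ.due a := by
  obtain ⟨E, -, hr, -⟩ := sInf_mem_servingTimes h
  exact ha hr

theorem servingTimes_append (σ σ' : Schedule P N) (a : Arrival P N) :
    σ.servingTimes a ⊆ Schedule.servingTimes (σ ++ σ') a := by
  rintro t ⟨E, hE, h⟩
  exact ⟨E, List.mem_append_left _ hE, h⟩

theorem due_append_le {σ : Schedule P N} (σ' : Schedule P N) {a : Arrival P N}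
    (ha : Monotone a.delay) (h : (σ.servingTimes a).Nonempty) :
    Schedule.due (σ ++ σ') a ≤ σ.due a :=
  due_le ha (servingTimes_append σ σ' a (sInf_mem_servingTimes h))

end Schedule

namespace Framework

/-! ### Prices and loads -/

/-- The cost of a set of elements. -/
def price (c : P.Elem N → ℝ≥0) (E : Finset (P.Elem N)) : ℝ := ∑ e ∈ E, (c e : ℝ)

theorem price_nonneg (c : P.Elem N → ℝ≥0) (E : Finset (P.Elem N)) : 0 ≤ price c E :=
  Finset.sum_nonneg fun _ _ => NNReal.coe_nonneg _

/-- The amount that a transmission of `E` may be charged by a service one level above `j`. It is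
truncated at `2 ^ j`, and elements that are cheap at level `j` do not count. -/
def load (c : P.Elem N → ℝ≥0) (E : Finset (P.Elem N)) (j : ℤ) : ℝ :=
  (if (2 : ℝ) ^ j ≤ price c E then (2 : ℝ) ^ j else 0)
    + ∑ e ∈ E, if (2 : ℝ) ^ j < Fintype.card (P.Elem N) * (c e : ℝ)
        then min (c e : ℝ) ((2 : ℝ) ^ j) else 0

theorem load_nonneg (c : P.Elem N → ℝ≥0) (E : Finset (P.Elem N)) (j : ℤ) : 0 ≤ load c E j := by
  unfold load
  refine add_nonneg ?_ (Finset.sum_nonneg fun e _ => ?_)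
  · split <;> positivity
  · split
    · exact le_min (NNReal.coe_nonneg _) (by positivity)
    · exact le_rfl

/-- The source of the logarithm: charged once by each level, a transmission pays only a logarithmic
factor more than its cost. -/
theorem sum_load_le (c : P.Elem N → ℝ≥0) (E : Finset (P.Elem N)) (S : Finset ℤ) :
    ∑ j ∈ S, load c E j ≤ 5 * (1 + Real.log (Fintype.card (P.Elem N))) * price c E := by
  unfold load
  rw [Finset.sum_add_distrib, Finset.sum_comm]
  have h1 := sum_zpow_le_of_le S (price c E) (price_nonneg c E)
  have h2 : ∑ e ∈ E, ∑ j ∈ S, (if (2 : ℝ) ^ j < Fintype.card (P.Elem N) * (c e : ℝ)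
      then min (c e : ℝ) ((2 : ℝ) ^ j) else 0)
      ≤ (3 + 2 * Real.log (Fintype.card (P.Elem N))) * price c E := by
    unfold price
    rw [Finset.mul_sum]
    refine Finset.sum_le_sum fun e _ => ?_
    have hn : 1 ≤ Fintype.card (P.Elem N) := Fintype.card_pos_iff.2 ⟨e⟩
    refine (sum_min_zpow_le S _ hn (c e) (NNReal.coe_nonneg _)).trans ?_
    have := logb_two_le _ hn
    exact mul_le_mul_of_nonneg_right (by linarith) (NNReal.coe_nonneg _)
  have h3 : 0 ≤ Real.log (Fintype.card (P.Elem N)) := Real.log_natCast_nonneg _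
  have h4 := price_nonneg c E
  nlinarith [mul_nonneg h3 h4]

/-- The load at level `j` of the transmissions of `σ` in the time interval `[a, b)`. -/
def loadWithin (c : P.Elem N → ℝ≥0) (σ : Schedule P N) (j : ℤ) (a b : ℝ) : ℝ :=
  (σ.map fun x => if a ≤ x.1 ∧ x.1 < b then load c x.2 j else 0).sum

theorem loadWithin_mono (c : P.Elem N → ℝ≥0) (σ : Schedule P N) (j : ℤ) (a : ℝ) {b b' : ℝ}
    (h : b ≤ b') : loadWithin c σ j a b ≤ loadWithin c σ j a b' := by
  refine sum_map_le _ _ _ fun x _ => ?_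
  by_cases h1 : a ≤ x.1 ∧ x.1 < b
  · rw [if_pos h1, if_pos ⟨h1.1, h1.2.trans_le h⟩]
  · rw [if_neg h1]
    split
    · exact load_nonneg _ _ _
    · exact le_rfl

theorem load_le_loadWithin (c : P.Elem N → ℝ≥0) (σ : Schedule P N) (j : ℤ) {a b : ℝ}
    {x : ℝ × Finset (P.Elem N)} (hx : x ∈ σ) (ha : a ≤ x.1) (hb : x.1 < b) :
    load c x.2 j ≤ loadWithin c σ j a b := by
  have := le_sum_map σ (fun x => if a ≤ x.1 ∧ x.1 < b then load c x.2 j else 0) (fun y _ => by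
    split
    · exact load_nonneg _ _ _
    · exact le_rfl) hx
  rwa [if_pos ⟨ha, hb⟩] at this

theorem loadWithin_nonneg (c : P.Elem N → ℝ≥0) (σ : Schedule P N) (j : ℤ) (a b : ℝ) :
    0 ≤ loadWithin c σ j a b :=
  sum_map_nonneg _ _ fun x _ => by
    split
    · exact load_nonneg _ _ _
    · exact le_rfl

/-! ### Pending requests -/

/-- The release time of a pending request, looked up in the input. -/
def release (Q : List (Arrival P N)) (q : Pending P N) : ℝ :=
  (Q[q.index]?.map Arrival.release).getD 0

/-- The arrival that a pending request stems from. -/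
def arrival (Q : List (Arrival P N)) (q : Pending P N) : Arrival P N :=
  ⟨q.req, release Q q, q.delay⟩

/-- The level that a request has when it is released. -/
def homeLevel (γ : ℝ) (c : P.Elem N → ℝ≥0) (q : Pending P N) : ℤ :=
  ⌊Real.logb 2 (price c q.single / γ)⌋

/-- The properties of a pending request that hold throughout: it stems from the input, and
`q.single` is a `γ`-approximate solution for it alone. -/
structure Sound (γ : ℝ) (c : P.Elem N → ℝ≥0) (Q : List (Arrival P N)) (q : Pending P N) : Prop where
  mem : arrival Q q ∈ Q
  serves : P.Serves q.single q.req
  price_pos : 0 < price c q.single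
  price_le : ∀ E, P.Serves E q.req → price c q.single ≤ γ * price c E
  home_le : homeLevel γ c q ≤ q.level
  counter_nonneg : 0 ≤ q.counter

theorem residual_nonneg (q : Pending P N) (s : ℝ) : 0 ≤ q.residual s := le_max_left _ _

theorem le_counter_add_residual (q : Pending P N) (s : ℝ) :
    q.delay s ≤ q.counter + q.residual s := by
  have : q.delay s - q.counter ≤ q.residual s := le_max_right _ _
  linarith

theorem counter_add_residual_of_pos {q : Pending P N} {s : ℝ} (h : 0 < q.residual s) :
    q.counter + q.residual s = q.delay s := by
  unfold Pending.residual at *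
  rcases le_total (q.delay s - q.counter) 0 with h1 | h1
  · rw [max_eq_left h1] at h; exact absurd h (lt_irrefl _)
  · rw [max_eq_right h1]; ring

theorem residual_mono {q : Pending P N} (h : Monotone q.delay) : Monotone q.residual :=
  fun _ _ hs => max_le_max le_rfl (sub_le_sub_right (h hs) _)

theorem residual_continuous {q : Pending P N} (h : Continuous q.delay) :
    Continuous q.residual := by
  unfold Pending.residual
  fun_prop

theorem residual_tendsto {q : Pending P N} (h : Tendsto q.delay atTop atTop) :
    Tendsto q.residual atTop atTop :=
  tendsto_atTop_mono (fun s => le_max_right 0 (q.delay s - q.counter))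
    (tendsto_atTop_add_const_right _ (-q.counter) h)

theorem Sound.valid {γ : ℝ} {c : P.Elem N → ℝ≥0} {Q : List (Arrival P N)} {q : Pending P N}
    (h : Sound γ c Q q) (hQ : ∀ a ∈ Q, a.Valid) : (arrival Q q).Valid := hQ _ h.mem

theorem Sound.mono {γ : ℝ} {c : P.Elem N → ℝ≥0} {Q : List (Arrival P N)} {q : Pending P N}
    (h : Sound γ c Q q) (hQ : ∀ a ∈ Q, a.Valid) : Monotone q.delay := (h.valid hQ).2.1

theorem Sound.cont {γ : ℝ} {c : P.Elem N → ℝ≥0} {Q : List (Arrival P N)} {q : Pending P N}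
    (h : Sound γ c Q q) (hQ : ∀ a ∈ Q, a.Valid) : Continuous q.delay := (h.valid hQ).1

theorem Sound.tendsto {γ : ℝ} {c : P.Elem N → ℝ≥0} {Q : List (Arrival P N)} {q : Pending P N}
    (h : Sound γ c Q q) (hQ : ∀ a ∈ Q, a.Valid) : Tendsto q.delay atTop atTop := (h.valid hQ).2.2.2

/-- Serving the request alone costs at least `2` to the power of its home level. -/
theorem Sound.zpow_home_le {γ : ℝ} {c : P.Elem N → ℝ≥0} {Q : List (Arrival P N)}
    {q : Pending P N} (h : Sound γ c Q q) (hγ : 1 ≤ γ) {E : Finset (P.Elem N)}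
    (hE : P.Serves E q.req) : (2 : ℝ) ^ homeLevel γ c q ≤ price c E := by
  have hγ0 : 0 < γ := by linarith
  have h1 : (2 : ℝ) ^ homeLevel γ c q ≤ price c q.single / γ :=
    (zpow_le_iff_le_floor_logb (div_pos h.price_pos hγ0) _).2 le_rfl
  refine h1.trans ?_
  rw [div_le_iff₀ hγ0, mul_comm]
  exact h.price_le E hE

theorem Sound.price_single_le {γ : ℝ} {c : P.Elem N → ℝ≥0} {Q : List (Arrival P N)}
    {q : Pending P N} (h : Sound γ c Q q) (hγ : 1 ≤ γ) {ℓ : ℤ} (hℓ : q.level ≤ ℓ) :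
    price c q.single ≤ 2 * (γ * 2 ^ ℓ) := by
  have hγ0 : 0 < γ := by linarith
  have h1 : ¬ (2 : ℝ) ^ (homeLevel γ c q + 1) ≤ price c q.single / γ := by
    rw [zpow_le_iff_le_floor_logb (div_pos h.price_pos hγ0)]
    simp [homeLevel]
  rw [not_le, div_lt_iff₀ hγ0] at h1
  have h2 : (2 : ℝ) ^ (homeLevel γ c q + 1) ≤ 2 ^ (ℓ + 1) :=
    zpow_le_zpow_right₀ (by norm_num) (by have := h.home_le; omega)
  rw [zpow_add_one₀ (by norm_num) ℓ] at h2
  nlinarith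

/-- The investment in a request, where the delay that it has on release counts as invested. -/
def paid (Q : List (Arrival P N)) (q : Pending P N) : ℝ :=
  max q.counter (q.delay (release Q q))

/-- The residual delay, where the delay that a request has on release counts as invested. -/
def late (Q : List (Arrival P N)) (q : Pending P N) (s : ℝ) : ℝ :=
  max 0 (q.delay s - paid Q q)

theorem late_le_residual (Q : List (Arrival P N)) (q : Pending P N) (s : ℝ) :
    late Q q s ≤ q.residual s :=
  max_le_max le_rfl (sub_le_sub_left (le_max_left _ _) _)

/-- The residual delay of the requests of level at most `j`. -/
def lowerSum (L : List (Pending P N)) (j : ℤ) (s : ℝ) : ℝ :=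
  ((L.filter fun q => q.level ≤ j).map fun q => q.residual s).sum

/-- If no level of a pending request is overcritical, then no level is. -/
theorem lowerSum_le {L : List (Pending P N)} {j : ℤ} {s : ℝ}
    (h : ∀ q ∈ L, q.level ≤ j → lowerSum L q.level s ≤ 2 ^ q.level) : lowerSum L j s ≤ 2 ^ j := by
  by_cases hne : ∃ q ∈ L, q.level ≤ j
  · have hfin : {q | q ∈ L.filter fun q => q.level ≤ j}.Finite := List.finite_toSet _
    obtain ⟨q₀, hq₀, hq₀'⟩ := hne
    obtain ⟨q, hq, hmax⟩ := Set.exists_max_image _ (fun q : Pending P N => q.level) hfin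
      ⟨q₀, by simp [hq₀, hq₀']⟩
    have hq' : q ∈ L ∧ q.level ≤ j := by simpa using hq
    have heq : lowerSum L j s = lowerSum L q.level s := by
      unfold lowerSum
      congr 2
      refine List.filter_congr fun p hp => ?_
      simp only [decide_eq_decide]
      exact ⟨fun hpj => hmax p (by simp [hp, hpj]), fun hpq => hpq.trans hq'.2⟩
    rw [heq]
    exact (h q hq'.1 hq'.2).trans (zpow_le_zpow_right₀ (by norm_num) hq'.2)
  · push Not at hne
    have : L.filter (fun q => decide (q.level ≤ j)) = [] := by
      simpa [List.filter_eq_nil_iff] using hne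
    simp only [lowerSum, this]
    simp only [List.map_nil, List.sum_nil]
    positivity

/-- `s` is the first time from `t` on at which a level is critical. -/
structure FirstCritical (L : List (Pending P N)) (t s : ℝ) : Prop where
  le : t ≤ s
  critical : ∃ q ∈ L, 2 ^ q.level ≤ lowerSum L q.level s
  before : ∀ s', t ≤ s' → s' < s → ∀ q ∈ L, lowerSum L q.level s' < 2 ^ q.level

theorem nextCritical_nil (t : ℝ) : (nextCritical ([] : List (Pending P N)) t).val = .sleep := rfl

theorem lowerSum_continuous {L : List (Pending P N)} (hc : ∀ q ∈ L, Continuous q.delay) (j : ℤ) :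
    Continuous (lowerSum L j) :=
  continuous_sum_map _ _ fun q hq => residual_continuous (hc q (List.mem_of_mem_filter hq))

theorem lowerSum_tendsto {L : List (Pending P N)} (ht : ∀ q ∈ L, Tendsto q.delay atTop atTop)
    {q : Pending P N} (hq : q ∈ L) {j : ℤ} (hj : q.level ≤ j) :
    Tendsto (lowerSum L j) atTop atTop := by
  refine tendsto_atTop_mono (fun s => ?_) (residual_tendsto (ht q hq))
  exact le_sum_map (L.filter fun q => q.level ≤ j) (fun q => q.residual s)
    (fun p _ => residual_nonneg p s) (a := q) (by simp [hq, hj])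

theorem nextCritical_val {L : List (Pending P N)} (hL : L ≠ [])
    (hc : ∀ q ∈ L, Continuous q.delay) (ht : ∀ q ∈ L, Tendsto q.delay atTop atTop) (t : ℝ) :
    ∃ s, (nextCritical L t).val = .wakeAt s ∧ FirstCritical L t s := by
  have hval : (nextCritical L t).val
      = .wakeAt (⨅ i : Fin L.length, firstHit (lowerSum L (L.get i).level) t
          (2 ^ (L.get i).level)) := by
    cases L with
    | nil => exact absurd rfl hL
    | cons a L' =>
      have : ∀ i : Fin (a :: L').length, lowerSum (a :: L') ((a :: L').get i).level = fun s =>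
          ∑ k : Fin (a :: L').length with ((a :: L').get k).level ≤ ((a :: L').get i).level,
            ((a :: L').get k).residual s := fun i => funext fun s =>
        (sum_get_filter (a :: L') (fun q => q.level ≤ ((a :: L').get i).level)
          (fun q => q.residual s)).symm
      simp only [this]
      rfl
  refine ⟨_, hval, ?_⟩
  have hne : Nonempty (Fin L.length) := ⟨⟨0, List.length_pos_iff.2 hL⟩⟩
  set T : Fin L.length → ℝ := fun i => firstHit (lowerSum L (L.get i).level) t
    (2 ^ (L.get i).level)
  have hspec := fun i : Fin L.length => firstHit_spec (lowerSum_continuous hc (L.get i).level)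
    (lowerSum_tendsto ht (List.get_mem L i) le_rfl) t (2 ^ (L.get i).level)
  obtain ⟨i, hi⟩ := exists_eq_ciInf_of_finite (f := T)
  refine ⟨?_, ⟨L.get i, List.get_mem L i, ?_⟩, fun s' hs' hs'' q hq => ?_⟩
  · rw [← hi]; exact (hspec i).1
  · rw [← hi]; exact (hspec i).2
  · obtain ⟨k, rfl⟩ := List.get_of_mem hq
    exact lt_of_lt_firstHit hs' (hs''.trans_le (ciInf_le (Set.finite_range T).bddBelow k))

/-! ### Charging a service -/

/-- The part of the delay cost of `σ` for `q` that is accounted for once the counter of `q` stands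
at `h`. -/
def covered (σ : Schedule P N) (Q : List (Arrival P N)) (q : Pending P N) (h : ℝ) : ℝ :=
  min h (σ.due (arrival Q q))

theorem covered_mono (σ : Schedule P N) (Q : List (Arrival P N)) (q : Pending P N) :
    Monotone (covered σ Q q) := fun _ _ h => min_le_min_right _ h

/-- Investing the residual delay at a time before which `σ` does not serve `q` is fully covered by
the delay cost of `σ`. -/
theorem covered_residual {γ : ℝ} {c : P.Elem N → ℝ≥0} {Q : List (Arrival P N)} {q : Pending P N}
    (hq : Sound γ c Q q) (hQ : ∀ a ∈ Q, a.Valid) (σ : Schedule P N) {s : ℝ}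
    (hs : s ≤ sInf (σ.servingTimes (arrival Q q))) :
    q.residual s ≤ covered σ Q q (q.counter + q.residual s) - covered σ Q q q.counter := by
  rcases (residual_nonneg q s).eq_or_lt with h | h
  · rw [← h]; simp
  · have h1 : q.counter + q.residual s ≤ σ.due (arrival Q q) := by
      rw [counter_add_residual_of_pos h]
      exact hq.mono hQ hs
    unfold covered
    rw [min_eq_left h1, min_eq_left (by linarith)]
    linarith

/-- A ledger of the analysis, kept along a run in comparison with a fixed schedule `σ`.
`work` is the sum of `2 ^ ℓ` over all services of level `ℓ` so far. Pending requests of level at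
most `j` have been released at time `floor j` or later. `charged T` is the set of the levels at
which the transmissions of `σ` at time `T` have been charged. `live` is the set of levels `j` for
which a service of level `j` has left requests behind and no service of a higher level came
later; the last such service forwarded time to `horizon j`, and `credit j` is the part of the delay
cost of `σ` that it can claim. `served` lists the requests that have been served. -/
structure Ledger (P : NDClass) (N : P.Net) where
  work : ℝ
  floor : ℤ → ℝ
  charged : ℝ → Finset ℤ
  live : Finset ℤ
  credit : ℤ → ℝ
  horizon : ℤ → ℝ
  served : List (Arrival P N)

/-- The claims of a ledger about its live levels. -/
def Ledger.Backed (g : Ledger P N) (c : P.Elem N → ℝ≥0) (σ : Schedule P N) : Prop :=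
  ∀ j ∈ g.live, 0 ≤ g.credit j ∧
    (2 : ℝ) ^ j ≤ loadWithin c σ j (g.floor j) (g.horizon j) + g.credit j

/-- A pending request that has been moved to its level by a service is covered by a live level. -/
def Ledger.Tracks (g : Ledger P N) (γ : ℝ) (c : P.Elem N → ℝ≥0) (q : Pending P N) : Prop :=
  homeLevel γ c q ≠ q.level → q.level ∈ g.live ∧ q.delay (g.horizon q.level) ≤ q.counter

/-- When level `j` is the lowest critical level, the work of the service that starts can be charged
to transmissions of `σ` since `floor j`, to delay cost of `σ` that becomes covered when the eligible
requests are cleaned, and to the credit of level `j`. If a request that has been moved to level `j`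
has residual delay, then the present time lies beyond the horizon of the service that moved it,
and the claim of that service is used. Otherwise, requests whose home level is `j` have residual
delay at least `2 ^ j / 2`: either `σ` has served one of them, for at least `2 ^ j`, or it pays all
that delay. -/
theorem charge {γ : ℝ} (hγ : 1 ≤ γ) {c : P.Elem N → ℝ≥0} {Q : List (Arrival P N)}
    (hQ : ∀ a ∈ Q, a.Valid) {σ : Schedule P N} (hσ : σ.Feasible Q) {g : Ledger P N}
    (hg : g.Backed c σ) {L : List (Pending P N)} {t : ℝ} {j : ℤ} (hL : ∀ q ∈ L, Sound γ c Q q)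
    (hfloor : ∀ q ∈ L, q.level ≤ j → g.floor j ≤ release Q q)
    (htrack : ∀ q ∈ L, g.Tracks γ c q) (hcrit : 2 ^ j ≤ lowerSum L j t)
    (hlow : ∀ q ∈ L, q.level < j → lowerSum L q.level t < 2 ^ q.level) :
    (2 : ℝ) ^ (j + 1) ≤ 4 * (loadWithin c σ j (g.floor j) t
      + ((L.filter fun q => q.level ≤ j + 1).map fun q =>
          covered σ Q q (q.counter + q.residual t) - covered σ Q q q.counter).sum
      + if j ∈ g.live then g.credit j else 0) := by
  have hpos : (0 : ℝ) < 2 ^ j := by positivity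
  have hcov : ∀ q : Pending P N,
      0 ≤ covered σ Q q (q.counter + q.residual t) - covered σ Q q q.counter := fun q =>
    sub_nonneg.2 (covered_mono σ Q q (by linarith [residual_nonneg q t]))
  have hgain := sum_map_nonneg (L.filter fun q => q.level ≤ j + 1) _ fun q _ => hcov q
  have hcredit : 0 ≤ if j ∈ g.live then g.credit j else 0 := by
    split
    · exact (hg j ‹_›).1
    · exact le_rfl
  have hload := loadWithin_nonneg c σ j (g.floor j) t
  rw [zpow_add_one₀ (by norm_num)]
  by_cases hmoved : ∃ q ∈ L, q.level = j ∧ 0 < q.residual t ∧ homeLevel γ c q ≠ j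
  · obtain ⟨q, hq, rfl, hres, hhome⟩ := hmoved
    obtain ⟨hlive, hhor⟩ := htrack q hq hhome
    have hlt : g.horizon q.level < t := by
      by_contra! hle
      have h1 := (hL q hq).mono hQ hle
      have h2 := counter_add_residual_of_pos hres
      linarith
    have h1 := (hg _ hlive).2
    have h2 := loadWithin_mono c σ q.level (g.floor q.level) hlt.le
    rw [if_pos hlive] at hcredit ⊢
    linarith
  · push Not at hmoved
    by_cases hserved : ∃ q ∈ L, q.level = j ∧ 0 < q.residual t ∧
        sInf (σ.servingTimes (arrival Q q)) < t
    · obtain ⟨q, hq, hj, hres, hlt⟩ := hserved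
      obtain ⟨E, hE, hr, hs⟩ := Schedule.sInf_mem_servingTimes (hσ _ (hL q hq).mem)
      have h1 := (hL q hq).zpow_home_le hγ hs
      rw [hmoved q hq hj hres] at h1
      have h2 := load_le_loadWithin c σ j hE ((hfloor q hq hj.le).trans hr) hlt
      have h3 : (2 : ℝ) ^ j ≤ load c E j := by
        unfold load
        rw [if_pos h1]
        refine le_add_of_nonneg_right (Finset.sum_nonneg fun e _ => ?_)
        split
        · exact le_min (NNReal.coe_nonneg _) hpos.le
        · exact le_rfl
      have h4 : load c E j ≤ loadWithin c σ j (g.floor j) t := h2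
      linarith
    · push Not at hserved
      have hsub : lowerSum L (j - 1) t ≤ 2 ^ (j - 1) :=
        lowerSum_le fun q hq hqj => (hlow q hq (by omega)).le
      have hhalf : (2 : ℝ) ^ (j - 1) * 2 = 2 ^ j := by
        rw [← zpow_add_one₀ (by norm_num), sub_add_cancel]
      have hsplit : lowerSum L j t ≤ lowerSum L (j - 1) t
          + ((L.filter fun q => q.level ≤ j + 1).map fun q =>
          covered σ Q q (q.counter + q.residual t) - covered σ Q q q.counter).sum := by
        unfold lowerSum
        clear hcrit hlow hfloor htrack hgain hsub
        induction L with
        | nil => simp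
        | cons a L ih =>
          have ih' := ih (fun q hq => hL q (by simp [hq])) (fun q hq => hmoved q (by simp [hq]))
            (fun q hq => hserved q (by simp [hq]))
          have hca := hcov a
          rcases lt_trichotomy a.level j with h | h | h
          · have h1 : a.level ≤ j - 1 := by omega
            have h2 : a.level ≤ j + 1 := by omega
            simp only [h.le, h1, h2, decide_true, List.filter_cons_of_pos, List.map_cons,
              List.sum_cons]
            linarith
          · have h1 : ¬ a.level ≤ j - 1 := by omega
            have h2 : a.level ≤ j + 1 := by omega
            simp only [h.le, h1, h2, decide_true, decide_false, List.filter_cons_of_pos,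
              List.map_cons, List.sum_cons, Bool.false_eq_true, not_false_eq_true,
              List.filter_cons_of_neg]
            have h3 : a.residual t
                ≤ covered σ Q a (a.counter + a.residual t) - covered σ Q a a.counter := by
              rcases (residual_nonneg a t).eq_or_lt with h0 | h0
              · rw [← h0]; simp
              · exact covered_residual (hL a (by simp)) hQ σ (hserved a (by simp) h h0)
            linarith
          · have h1 : ¬ a.level ≤ j - 1 := by omega
            have h2 : ¬ a.level ≤ j := by omega
            simp only [h1, h2, decide_false, Bool.false_eq_true, not_false_eq_true,
              List.filter_cons_of_neg]
            by_cases h3 : a.level ≤ j + 1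
            · simp only [h3, decide_true, List.filter_cons_of_pos, List.map_cons, List.sum_cons]
              linarith
            · simp only [h3, decide_false, Bool.false_eq_true, not_false_eq_true,
                List.filter_cons_of_neg]
              exact ih'
      linarith

end Framework

/-! ### The results of the activations -/

namespace Framework

theorem feasible_and_cost_le_of_mem_vals {A : PCAlgorithm P} {γ : P.Net → ℝ} (hA : A.IsApprox γ)
    {I : PCInstance P N} {S : I.Solution} (hS : S ∈ (A N I).vals) :
    S.Feasible ∧ ∀ S' : I.Solution, S'.Feasible → S.cost ≤ γ N * S'.cost := by
  obtain ⟨y, hy, rfl⟩ := hS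
  exact hA N I y hy

@[simp] theorem mem_vals_call {A : PCAlgorithm P} {I : PCInstance P N} {S : I.Solution} :
    S ∈ (call A I).vals ↔ S ∈ (A N I).vals := by
  simp [call]

/-- The prize-collecting instance solved when a request is released. -/
def singleInstance (γ : ℝ) (c : P.Elem N → ℝ≥0) (a : Arrival P N) : PCInstance P N where
  cost := c
  n := 1
  req := fun _ => a.req
  pen := fun _ => (γ * price c Finset.univ + 1).toNNReal

theorem mem_vals_uponRequest {A : PCAlgorithm P} {γ : ℝ} {c : P.Elem N → ℝ≥0} {st : State P N}
    {t : ℝ} {a : Arrival P N} {r : Response P N (State P N)}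
    (h : r ∈ (uponRequest A γ c st t a).vals) :
    ∃ sol ∈ (A N (singleInstance γ c a)).vals,
      (price c sol.elems = 0 ∧
        r = { state := { st with arrived := st.arrived + 1 }
              transmit := some sol.elems
              next := (nextCritical st.pending t).val }) ∨
      (price c sol.elems ≠ 0 ∧
        r = { state :=
                { st with
                  arrived := st.arrived + 1
                  pending := st.pending ++
                    [{ index := st.arrived, req := a.req, delay := a.delay, counter := 0
                       level := ⌊Real.logb 2 (price c sol.elems / γ)⌋
                       single := sol.elems }] }
              transmit := none
              next := (nextCritical (st.pending ++
                    [{ index := st.arrived, req := a.req, delay := a.delay, counter := 0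
                       level := ⌊Real.logb 2 (price c sol.elems / γ)⌋
                       single := sol.elems }]) t).val }) := by
  unfold uponRequest at h
  simp only [RTimed.mem_vals_bind, RTimed.mem_vals_lift, exists_eq_left, mem_vals_call] at h
  obtain ⟨sol, hsol, h⟩ := h
  refine ⟨sol, hsol, ?_⟩
  by_cases hp : price c sol.elems = 0
  · left
    have hp' : (Timed.op (decide ((Timed.sumOn sol.elems fun e => (c e : ℝ)).val = 0))).val
        = true := decide_eq_true hp
    rw [hp'] at h
    simp only [if_true, RTimed.mem_vals_bind, RTimed.mem_vals_lift, exists_eq_left,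
      RTimed.mem_vals_pure] at h
    exact ⟨hp, h⟩
  · right
    have hp' : (Timed.op (decide ((Timed.sumOn sol.elems fun e => (c e : ℝ)).val = 0))).val
        = false := decide_eq_false hp
    rw [hp'] at h
    simp only [Bool.false_eq_true, if_false, RTimed.mem_vals_bind, RTimed.mem_vals_lift,
      exists_eq_left, RTimed.mem_vals_pure] at h
    obtain ⟨_, -, h⟩ := h
    exact ⟨hp, h⟩

theorem sumOn_lowerSum (L : List (Pending P N)) (j : ℤ) (t : ℝ) :
    ∑ k : Fin L.length with (L.get k).level ≤ j, (L.get k).residual t = lowerSum L j t :=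
  sum_get_filter L (fun q => q.level ≤ j) (fun q => q.residual t)

/-- The elements that are cheap for a service of level `ℓ`. -/
def cheapAt (c : P.Elem N → ℝ≥0) (ℓ : ℤ) : Finset (P.Elem N) :=
  Finset.univ.filter fun e => (c e : ℝ) ≤ 2 ^ ℓ / (Fintype.card (P.Elem N) : ℝ)

/-- The service of level `ℓ` that starts at time `t` with the requests `L` pending. -/
def newService (c : P.Elem N → ℝ≥0) (L : List (Pending P N)) (t : ℝ) (ℓ : ℤ) : Service P N where
  level := ℓ
  cheap := cheapAt c ℓ
  eligible := (L.filter fun q => q.level ≤ ℓ).map fun q => q.clean t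
  time := t
  served := ∅
  elems := ∅

/-- If a level is critical, a service starts, one level above the lowest critical level. -/
theorem uponCritical_val (c : P.Elem N → ℝ≥0) (st : State P N) (t : ℝ)
    (h : ∃ q ∈ st.pending, 2 ^ q.level ≤ lowerSum st.pending q.level t) :
    ∃ j : ℤ, 2 ^ j ≤ lowerSum st.pending j t ∧ (∃ q ∈ st.pending, q.level = j) ∧
      (∀ q ∈ st.pending, q.level < j → lowerSum st.pending q.level t < 2 ^ q.level) ∧
      (uponCritical c st t).val =
        { state :=
            { st with
              pending := st.pending.filter fun q => j + 1 < q.level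
              service := some (newService c st.pending t (j + 1)) }
          transmit := none
          next := .resume } := by
  classical
  set critical : Finset (Fin st.pending.length) := Finset.univ.filter fun i =>
    0 ≤ lowerSum st.pending (st.pending.get i).level t - (2 : ℝ) ^ (st.pending.get i).level
    with hcrit
  have hval : (uponCritical c st t).val = if h : critical.Nonempty then
      { state :=
            { st with
              pending := st.pending.filter fun q =>
                critical.inf' h (fun i => (st.pending.get i).level) + 1 < q.level
              service := some (newService c st.pending t
                (critical.inf' h (fun i => (st.pending.get i).level) + 1)) }
        transmit := none
        next := .resume }
      else { state := st, transmit := none, next := (nextCritical st.pending t).val } := by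
    have hsel : (Timed.select fun i : Fin st.pending.length => 0 ≤ (Timed.each
        fun i : Fin st.pending.length => do
          let lower ← Timed.select fun k : Fin st.pending.length =>
            (st.pending.get k).level ≤ (st.pending.get i).level
          let amount ← Timed.sumOn lower (Timed.each fun i : Fin st.pending.length =>
            Timed.ops 3 ((st.pending.get i).residual t)).val
          let threshold ← Timed.op ((2 : ℝ) ^ (st.pending.get i).level)
          Timed.op (amount - threshold)).val i).val = critical := by
      simp only [hcrit, ← sumOn_lowerSum]
      rfl
    unfold uponCritical
    simp only [Timed.val_bind]
    rw [hsel]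
    split <;> rfl
  have hne : critical.Nonempty := by
    obtain ⟨q, hq, hqc⟩ := h
    obtain ⟨i, rfl⟩ := List.get_of_mem hq
    exact ⟨i, by simpa [hcrit] using hqc⟩
  rw [dif_pos hne] at hval
  obtain ⟨i, hi, hmin⟩ := Finset.exists_mem_eq_inf' hne fun i => (st.pending.get i).level
  refine ⟨critical.inf' hne fun i => (st.pending.get i).level, ?_, ?_, ?_, hval⟩
  · rw [hmin]
    simpa [hcrit] using hi
  · exact ⟨_, List.get_mem _ i, hmin.symm⟩
  · intro q hq hlt
    obtain ⟨k, rfl⟩ := List.get_of_mem hq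
    by_contra! hk
    have : k ∈ critical := by simpa [hcrit] using hk
    exact absurd (Finset.inf'_le (fun i => (st.pending.get i).level) this) (not_le.2 hlt)

/-- The requests served at the end of a service, and the elements bought for them. -/
def choice (v : Service P N) : Finset (Fin v.eligible.length) × Finset (P.Elem N) :=
  if v.served = ∅ then
    if h : 0 < v.eligible.length then ({⟨0, h⟩}, (v.eligible.get ⟨0, h⟩).single)
    else (∅, v.elems)
  else (v.served, v.elems)

/-- The eligible requests that a service leaves behind, on their new level. -/
def leftover (v : Service P N) (τ : ℝ) : List (Pending P N) :=
  ((List.finRange v.eligible.length).filter fun i => i ∉ (choice v).1).map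
    fun i => (v.eligible.get i).upgrade τ v.level

theorem finishService_val (st : State P N) (v : Service P N) (t τ : ℝ) :
    (finishService st v t τ).val =
      { state := { st with pending := st.pending ++ leftover v τ, service := none }
        transmit := some (v.cheap ∪ (choice v).2)
        next := (nextCritical (st.pending ++ leftover v τ) t).val } := rfl

/-- The elements' costs in a service: cheap elements are free. -/
def reducedCost (c : P.Elem N → ℝ≥0) (cheap : Finset (P.Elem N)) (e : P.Elem N) : ℝ≥0 :=
  if e ∈ cheap then 0 else c e

/-- The prize-collecting instance for forwarding time to `s`. -/
def forwardInstance (c : P.Elem N → ℝ≥0) (v : Service P N) (s : ℝ) : PCInstance P N where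
  cost := reducedCost c v.cheap
  n := v.eligible.length
  req := fun i => (v.eligible.get i).req
  pen := fun i => ((v.eligible.get i).residual s).toNNReal

/-- The time to which the next round of a service forwards time. -/
def nextTime (γ : ℝ) (v : Service P N) (t : ℝ) : ℝ :=
  firstHit (fun s => ∑ i with i ∉ v.served,
    ((v.eligible.get i).residual s - (v.eligible.get i).residual v.time)) t (γ * 2 ^ v.level)

theorem forwardInstance_cost (c : P.Elem N → ℝ≥0) (v : Service P N) (s : ℝ)
    (S : (forwardInstance c v s).Solution) :
    S.cost = ∑ e ∈ S.elems, (reducedCost c v.cheap e : ℝ)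
      + ∑ i ∈ S.servedᶜ, (v.eligible.get i).residual s := by
  unfold PCInstance.Solution.cost
  congr 1
  exact Finset.sum_congr rfl fun i _ => Real.coe_toNNReal _ (residual_nonneg _ _)

theorem mem_vals_forwardTime {A : PCAlgorithm P} {γ : ℝ} {c : P.Elem N → ℝ≥0} {st : State P N}
    {v : Service P N} {t : ℝ} {r : Response P N (State P N)}
    (h : r ∈ (forwardTime A γ c st v t).vals) :
    ((∀ i, i ∈ v.served) ∧ r = (finishService st v t v.time).val) ∨
    ((∃ i, i ∉ v.served) ∧ ∃ sol ∈ (A N (forwardInstance c v (nextTime γ v t))).vals,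
      (γ * 2 ^ v.level ≤ sol.cost ∧ r = (finishService st v t (nextTime γ v t)).val) ∨
      (sol.cost < γ * 2 ^ v.level ∧
        r = { state :=
                { st with
                  service := some
                    { level := v.level, cheap := v.cheap, eligible := v.eligible
                      time := nextTime γ v t, served := sol.served, elems := sol.elems } }
              transmit := none
              next := .resume })) := by
  unfold forwardTime at h
  rw [RTimed.mem_vals_bind] at h
  obtain ⟨_, h0, h⟩ := h
  rw [RTimed.mem_vals_lift] at h0
  subst h0
  split at h
  · rename_i hall
    left
    rw [RTimed.mem_vals_lift] at h
    refine ⟨fun i => ?_, h⟩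
    by_contra hi
    have : i ∈ (Timed.select fun i => i ∉ v.served).val := by simp [Timed.select, hi]
    rw [hall] at this
    simp at this
  · rename_i hall
    right
    refine ⟨?_, ?_⟩
    · by_contra! hc
      exact hall (by simp [Timed.select, hc])
    simp only [RTimed.mem_vals_bind, RTimed.mem_vals_lift, exists_eq_left, mem_vals_call] at h
    obtain ⟨sol, hsol, h⟩ := h
    refine ⟨sol, hsol, ?_⟩
    have hcost := forwardInstance_cost c v (nextTime γ v t) sol
    by_cases hfull : γ * 2 ^ v.level ≤ sol.cost
    · left
      refine ⟨hfull, ?_⟩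
      have hfull' := le_of_le_of_eq hfull hcost
      split at h
      · exact RTimed.mem_vals_lift.1 h
      · rename_i hn
        exact absurd (decide_eq_true hfull') hn
    · right
      refine ⟨not_le.1 hfull, ?_⟩
      split at h
      · rename_i hn
        exact absurd (le_of_le_of_eq (of_decide_eq_true hn) hcost.symm) hfull
      · exact RTimed.mem_vals_pure.1 h

end Framework

/-! ### The invariant -/

namespace Framework

/-- What holds at all times, for the requests `R` that have been released and not served. The fields
`budget`, `delays` and `buys` are the cost accounting: the work is paid by charges to `σ`, while
investments and transmissions of the framework are paid by its work. `slack` is the part of this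
payment that is reserved for the service in progress. -/
structure Accounted (γ : ℝ) (c : P.Elem N → ℝ≥0) (Q : List (Arrival P N)) (σ : Schedule P N)
    (g : Ledger P N) (R : List (Pending P N)) (now : ℝ) (future : List (Arrival P N))
    (log : Schedule P N) (slack : ℝ) : Prop where
  perm : (g.served ++ R.map (arrival Q) ++ future).Perm Q
  sound : ∀ q ∈ R, Sound γ c Q q
  release_le : ∀ q ∈ R, release Q q ≤ now
  floor_le_now : ∀ j, g.floor j ≤ now
  floor_le_future : ∀ a ∈ future, ∀ j, g.floor j ≤ a.release
  charged_lt : ∀ T j, j ∈ g.charged T → T < g.floor j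
  backed : g.Backed c σ
  served : ∀ a ∈ g.served, (log.servingTimes a).Nonempty
  budget : g.work + 4 * ∑ j ∈ g.live, g.credit j
    ≤ 4 * (σ.map fun x => ∑ j ∈ g.charged x.1, load c x.2 j).sum
      + 4 * ((R.map fun q => covered σ Q q q.counter).sum + (g.served.map σ.due).sum)
  delays : (g.served.map log.due).sum + (R.map (paid Q)).sum + 2 * slack
    ≤ (g.served.map fun a => a.delay a.release).sum
      + (R.map fun q => q.delay (release Q q)).sum + 3 * γ * g.work
  buys : (log.map fun x => price c x.2).sum + 3 * slack ≤ 3 * γ * g.work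

/-- The factor by which the number of pending requests bounds the number of activations that their
services need. -/
def rounds (Q : List (Arrival P N)) : ℕ := 2 * Q.length + 3

/-- The invariant between services. At most `m` activations remain. -/
structure Idle (γ : ℝ) (c : P.Elem N → ℝ≥0) (Q : List (Arrival P N)) (σ : Schedule P N)
    (g : Ledger P N) (st : State P N) (now : ℝ) (next : Next) (future : List (Arrival P N))
    (log : Schedule P N) (m : ℕ) : Prop where
  accounted : Accounted γ c Q σ g st.pending now future log 0
  service : st.service = none
  future_eq : future = Q.drop st.arrived
  floor_le : ∀ q ∈ st.pending, ∀ j, q.level ≤ j → g.floor j ≤ release Q q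
  tracks : ∀ q ∈ st.pending, g.Tracks γ c q
  late_le : ∀ j, ((st.pending.filter fun q => q.level ≤ j).map fun q => late Q q now).sum ≤ 2 ^ j
  next_eq : (next = .sleep ∧ st.pending = []) ∨
    ((∀ a ∈ future, now ≤ a.release) ∧ ∃ s, next = .wakeAt s ∧ FirstCritical st.pending now s)
  fuel : future.length * (rounds Q + 1) + st.pending.length * rounds Q ≤ m

/-- The invariant during a service `v`, after `k` rounds of its time-forwarding loop. The penalties,
truncated at twice the limit `γ * 2 ^ v.level`, have grown by at least that limit in each
round. -/
structure Busy (γ : ℝ) (c : P.Elem N → ℝ≥0) (Q : List (Arrival P N)) (σ : Schedule P N)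
    (g : Ledger P N) (st : State P N) (v : Service P N) (k : ℕ) (now : ℝ) (next : Next)
    (future : List (Arrival P N)) (log : Schedule P N) (m : ℕ) : Prop where
  accounted : Accounted γ c Q σ g (st.pending ++ v.eligible) now future log (γ * 2 ^ v.level)
  service : st.service = some v
  future_eq : future = Q.drop st.arrived
  now_le : ∀ a ∈ future, now ≤ a.release
  floor_le : ∀ q ∈ st.pending, ∀ j, q.level ≤ j → g.floor j ≤ release Q q
  floor_le_eligible : ∀ q ∈ v.eligible, ∀ j, v.level ≤ j → g.floor j ≤ release Q q
  tracks : ∀ q ∈ st.pending, g.Tracks γ c q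
  late_le : ∀ j, ((st.pending.filter fun q => q.level ≤ j).map fun q => late Q q now).sum ≤ 2 ^ j
  next_eq : next = .resume
  high : ∀ q ∈ st.pending, v.level < q.level
  live_high : ∀ j ∈ g.live, v.level < j
  low : ∀ q ∈ v.eligible, q.level ≤ v.level
  clean : ∀ q ∈ v.eligible, q.delay now ≤ q.counter
  nonempty : v.eligible ≠ []
  cheap : v.cheap = cheapAt c v.level
  time_le : now ≤ v.time
  serves : ∀ i ∈ v.served, P.Serves v.elems (v.eligible.get i).req
  elems_le : ∑ e ∈ v.elems, (reducedCost c v.cheap e : ℝ) ≤ γ * 2 ^ v.level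
  unserved_le : ∑ i with i ∉ v.served, (v.eligible.get i).residual v.time ≤ γ * 2 ^ v.level
  progress : k * (γ * 2 ^ v.level)
    ≤ ∑ i, min ((v.eligible.get i).residual v.time) (2 * (γ * 2 ^ v.level))
  fuel : future.length * (rounds Q + 1) + (st.pending.length + v.eligible.length) * rounds Q
    + 2 * v.eligible.length + 1 ≤ m + k + rounds Q

/-- Up to the first critical time, no level is overcritical, but for delays that requests have on
release. -/
theorem late_le_of_firstCritical {γ : ℝ} {c : P.Elem N → ℝ≥0} {Q : List (Arrival P N)}
    (hQ : ∀ a ∈ Q, a.Valid) {L : List (Pending P N)} (hL : ∀ q ∈ L, Sound γ c Q q)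
    {now s r : ℝ} (h : FirstCritical L now s) (hr : now ≤ r) (hrs : r ≤ s)
    (hnow : ∀ j : ℤ, ((L.filter fun q => q.level ≤ j).map fun q => late Q q now).sum ≤ 2 ^ j)
    (j : ℤ) : ((L.filter fun q => q.level ≤ j).map fun q => late Q q r).sum ≤ 2 ^ j := by
  rcases hr.eq_or_lt with rfl | hr
  · exact hnow j
  · refine (sum_map_le _ _ _ fun q _ => late_le_residual Q q r).trans (lowerSum_le ?_)
    intro q hq _
    exact le_of_forall_Ico_le (lowerSum_continuous (fun p hp => (hL p hp).cont hQ) q.level) hr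
      fun s' h1 h2 => (h.before s' h1 (h2.trans_le hrs) q hq).le

theorem nextCritical_eq {γ : ℝ} {c : P.Elem N → ℝ≥0} {Q : List (Arrival P N)}
    (hQ : ∀ a ∈ Q, a.Valid) {L : List (Pending P N)} (hL : ∀ q ∈ L, Sound γ c Q q)
    {now : ℝ} {future : List (Arrival P N)} (h : ∀ a ∈ future, now ≤ a.release) :
    ((nextCritical L now).val = .sleep ∧ L = []) ∨
      ((∀ a ∈ future, now ≤ a.release) ∧
        ∃ s, (nextCritical L now).val = .wakeAt s ∧ FirstCritical L now s) := by
  by_cases hne : L = []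
  · subst hne
    exact Or.inl ⟨nextCritical_nil now, rfl⟩
  · exact Or.inr ⟨h, nextCritical_val hne (fun q hq => (hL q hq).cont hQ)
      (fun q hq => (hL q hq).tendsto hQ) now⟩

theorem drop_eq_cons {α : Type*} {Q : List α} {k : ℕ} {a : α} {l : List α}
    (h : a :: l = Q.drop k) : Q[k]? = some a ∧ l = Q.drop (k + 1) := by
  constructor
  · rw [← List.head?_drop, ← h]; rfl
  · rw [← List.tail_drop, ← h]; rfl

/-- The sums of first delays can only decrease when transmissions are added. -/
theorem sum_due_append_le {Q : List (Arrival P N)} (hQ : ∀ a ∈ Q, a.Valid)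
    {l : List (Arrival P N)} (hl : ∀ a ∈ l, a ∈ Q) {log : Schedule P N}
    (hs : ∀ a ∈ l, (log.servingTimes a).Nonempty) (log' : Schedule P N) :
    (l.map (Schedule.due (log ++ log'))).sum ≤ (l.map log.due).sum :=
  sum_map_le _ _ _ fun a ha => Schedule.due_append_le log' (hQ a (hl a ha)).2.1 (hs a ha)

/-! ### Release of a request -/

/-- The penalty of the instance for a single request is prohibitive, so that its solution serves the
request, at a cost within a factor `γ` of the optimum. -/
theorem single_spec {A : PCAlgorithm P} {γ : P.Net → ℝ} (hγ : 1 ≤ γ N) (hA : A.IsApprox γ)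
    {c : P.Elem N → ℝ≥0} {a : Arrival P N} {sol : (singleInstance (γ N) c a).Solution}
    (hsol : sol ∈ (A N (singleInstance (γ N) c a)).vals) :
    P.Serves sol.elems a.req ∧ ∀ E, P.Serves E a.req → price c sol.elems ≤ γ N * price c E := by
  obtain ⟨hfeas, hcost⟩ := feasible_and_cost_le_of_mem_vals hA hsol
  have hpen0 : 0 ≤ γ N * price c Finset.univ := by
    have := price_nonneg c (Finset.univ : Finset (P.Elem N))
    positivity
  have hcompare : ∀ E, P.Serves E a.req → sol.cost ≤ γ N * price c E := by
    intro E hE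
    refine (hcost ⟨E, Finset.univ⟩ fun i _ => hE).trans_eq ?_
    unfold PCInstance.Solution.cost
    rw [Finset.compl_univ, Finset.sum_empty, add_zero]
    rfl
  have hle : price c sol.elems ≤ sol.cost :=
    le_add_of_nonneg_right (Finset.sum_nonneg fun _ _ => NNReal.coe_nonneg _)
  refine ⟨?_, fun E hE => hle.trans (hcompare E hE)⟩
  by_contra hns
  have h0 : (⟨0, Nat.one_pos⟩ : Fin 1) ∉ sol.served := fun h => hns (hfeas _ h)
  obtain ⟨E, hE⟩ := P.exists_serves a.req
  have h1 := hcompare _ (P.serves_mono (Finset.subset_univ E) hE)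
  have h2 : (((singleInstance (γ N) c a).pen ⟨0, Nat.one_pos⟩ : ℝ≥0) : ℝ)
      ≤ ∑ i ∈ sol.servedᶜ, ((singleInstance (γ N) c a).pen i : ℝ) :=
    Finset.single_le_sum (f := fun i => ((singleInstance (γ N) c a).pen i : ℝ))
      (fun _ _ => NNReal.coe_nonneg _) (Finset.mem_compl.2 h0)
  have h3 : (((singleInstance (γ N) c a).pen ⟨0, Nat.one_pos⟩ : ℝ≥0) : ℝ)
      = γ N * price c Finset.univ + 1 := Real.coe_toNNReal _ (by linarith)
  have h4 : ∑ i ∈ sol.servedᶜ, ((singleInstance (γ N) c a).pen i : ℝ) ≤ sol.cost :=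
    le_add_of_nonneg_left (Finset.sum_nonneg fun _ _ => NNReal.coe_nonneg _)
  linarith

/-- The release of a request preserves the invariant. A request that is served at once costs nothing
but the delay that it has on release. -/
theorem request_step {A : PCAlgorithm P} {γ : P.Net → ℝ} (hγ : 1 ≤ γ N) (hA : A.IsApprox γ)
    {c : P.Elem N → ℝ≥0} {Q : List (Arrival P N)} (hQ : ValidInput Q) {σ : Schedule P N}
    (hσ : σ.Feasible Q) {g : Ledger P N} {st : State P N} {now : ℝ} {next : Next}
    {a : Arrival P N} {future : List (Arrival P N)} {log : Schedule P N} {m : ℕ}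
    (h : Idle (γ N) c Q σ g st now next (a :: future) log m)
    (hnext : ∀ s, next = .wakeAt s → a.release ≤ max now s)
    {r : Response P N (State P N)} (hr : r ∈ (uponRequest A (γ N) c st a.release a).vals) :
    ∃ g' m', m' < m ∧ Idle (γ N) c Q σ g' r.state a.release r.next future
      (log ++ r.transmit.toList.map fun E => (a.release, E)) m' := by
  have hγ0 : 0 < γ N := by linarith
  obtain ⟨hget, hdrop⟩ := drop_eq_cons h.future_eq
  have haQ : a ∈ Q := List.mem_of_getElem? hget
  have hav := hQ.2 a haQ
  have hacc := h.accounted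
  have hservedQ : ∀ b ∈ g.served, b ∈ Q := fun b hb => hacc.perm.subset (by simp [hb])
  have hsorted : ∀ b ∈ future, a.release ≤ b.release := by
    have : (a :: future).Pairwise fun q q' => q.release ≤ q'.release := by
      rw [h.future_eq]
      exact hQ.1.sublist (List.drop_sublist _ _)
    exact (List.pairwise_cons.1 this).1
  have hafter : st.pending = [] ∨ now ≤ a.release ∧ ∃ s, FirstCritical st.pending now s ∧
      a.release ≤ s := by
    rcases h.next_eq with ⟨-, h1⟩ | ⟨h1, s, h2, h3⟩
    · exact Or.inl h1
    · refine Or.inr ⟨h1 a (by simp), s, h3, ?_⟩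
      have := hnext s h2
      rwa [max_eq_right h3.le] at this
  have hrel : ∀ q ∈ st.pending, release Q q ≤ a.release := by
    intro q hq
    rcases hafter with h1 | ⟨h1, -⟩
    · simp [h1] at hq
    · exact (hacc.release_le q hq).trans h1
  have hlate : ∀ j : ℤ, ((st.pending.filter fun q => q.level ≤ j).map
      fun q => late Q q a.release).sum ≤ 2 ^ j := by
    intro j
    rcases hafter with h1 | ⟨h1, s, h2, h3⟩
    · simp only [h1, List.filter_nil, List.map_nil, List.sum_nil]; positivity
    · exact late_le_of_firstCritical hQ.2 hacc.sound h2 h1 h3 h.late_le j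
  have hdue0 : 0 ≤ σ.due a :=
    hav.2.2.1.trans (Schedule.delay_release_le_due hav.2.1 (hσ a haQ))
  obtain ⟨sol, hsol, hcase⟩ := mem_vals_uponRequest hr
  obtain ⟨hserves, hopt⟩ := single_spec hγ hA hsol
  have hfuel := h.fuel
  simp only [List.length_cons] at hfuel
  rcases hcase with ⟨hp, rfl⟩ | ⟨hp, rfl⟩
  · refine ⟨{ g with served := g.served ++ [a] },
      future.length * (rounds Q + 1) + st.pending.length * rounds Q, by nlinarith, ?_⟩
    have hserved : a.release ∈ Schedule.servingTimes (log ++ [(a.release, sol.elems)]) a :=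
      ⟨sol.elems, by simp, le_rfl, hserves⟩
    constructor
    · simp only [Option.toList_some, List.map_cons, List.map_nil]
      constructor
      · refine List.Perm.trans ?_ hacc.perm
        classical
        rw [List.perm_iff_count]
        intro x
        simp [List.count_append, List.count_cons]
        omega
      · exact hacc.sound
      · exact hrel
      · exact fun j => hacc.floor_le_future a (by simp) j
      · exact fun b hb => hacc.floor_le_future b (by simp [hb])
      · exact hacc.charged_lt
      · exact hacc.backed
      · intro b hb
        rcases List.mem_append.1 hb with hb | hb
        · exact (hacc.served b hb).mono (Schedule.servingTimes_append _ _ _)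
        · obtain rfl := List.mem_singleton.1 hb
          exact ⟨_, hserved⟩
      · have := hacc.budget
        simp only [List.map_append, List.sum_append, List.map_cons, List.map_nil, List.sum_cons,
          List.sum_nil]
        linarith
      · have h1 := hacc.delays
        have h2 := sum_due_append_le hQ.2 hservedQ hacc.served [(a.release, sol.elems)]
        have h3 := Schedule.due_le hav.2.1 hserved
        simp only [List.map_append, List.sum_append, List.map_cons, List.map_nil, List.sum_cons,
          List.sum_nil]
        linarith
      · have := hacc.buys
        simp only [List.map_append, List.sum_append, List.map_cons, List.map_nil, List.sum_cons,
          List.sum_nil, hp]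
        linarith
    · exact h.service
    · exact hdrop
    · exact h.floor_le
    · exact h.tracks
    · exact hlate
    · exact nextCritical_eq hQ.2 hacc.sound hsorted
    · exact le_rfl
  · set q : Pending P N :=
      { index := st.arrived, req := a.req, delay := a.delay, counter := 0
        level := ⌊Real.logb 2 (price c sol.elems / γ N)⌋, single := sol.elems } with hq
    have hrelq : release Q q = a.release := by simp [release, hq, hget]
    have harr : arrival Q q = a := by unfold arrival; rw [hrelq]
    have hsound : ∀ p ∈ st.pending ++ [q], Sound (γ N) c Q p := by
      intro p hp'
      rcases List.mem_append.1 hp' with hp' | hp'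
      · exact hacc.sound p hp'
      · obtain rfl := List.mem_singleton.1 hp'
        exact ⟨harr ▸ haQ, hserves, lt_of_le_of_ne (price_nonneg _ _) (Ne.symm hp), hopt, le_rfl,
          le_rfl⟩
    have hpaid : paid Q q = a.delay a.release := by
      simp only [paid, hrelq]
      exact max_eq_right hav.2.2.1
    refine ⟨g, future.length * (rounds Q + 1) + (st.pending.length + 1) * rounds Q,
      by nlinarith, ?_⟩
    constructor
    · simp only [Option.toList_none, List.map_nil, List.append_nil]
      constructor
      · refine List.Perm.trans ?_ hacc.perm
        classical
        rw [List.perm_iff_count]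
        intro x
        simp [List.count_append, List.count_cons, harr]
      · exact hsound
      · intro p hp'
        rcases List.mem_append.1 hp' with hp' | hp'
        · exact hrel p hp'
        · obtain rfl := List.mem_singleton.1 hp'
          exact hrelq.le
      · exact fun j => hacc.floor_le_future a (by simp) j
      · exact fun b hb => hacc.floor_le_future b (by simp [hb])
      · exact hacc.charged_lt
      · exact hacc.backed
      · exact hacc.served
      · have h1 := hacc.budget
        have h2 : 0 ≤ covered σ Q q q.counter := le_min le_rfl (harr.symm ▸ hdue0)
        simp only [List.map_append, List.sum_append, List.map_cons, List.map_nil, List.sum_cons,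
          List.sum_nil]
        linarith
      · have h1 := hacc.delays
        have h2 : q.delay (release Q q) = a.delay a.release := by rw [hrelq]
        simp only [List.map_append, List.sum_append, List.map_cons, List.map_nil, List.sum_cons,
          List.sum_nil, hpaid, h2]
        linarith
      · exact hacc.buys
    · exact h.service
    · exact hdrop
    · intro p hp' j hj
      rcases List.mem_append.1 hp' with hp' | hp'
      · exact h.floor_le p hp' j hj
      · obtain rfl := List.mem_singleton.1 hp'
        rw [hrelq]
        exact hacc.floor_le_future a (by simp) j
    · intro p hp'
      rcases List.mem_append.1 hp' with hp' | hp'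
      · exact h.tracks p hp'
      · obtain rfl := List.mem_singleton.1 hp'
        exact fun hne => absurd rfl hne
    · intro j
      have h1 := hlate j
      have h2 : late Q q a.release = 0 := by
        unfold late
        rw [hpaid, sub_self, max_self]
      rw [List.filter_append, List.map_append, List.sum_append]
      by_cases h3 : q.level ≤ j <;> simpa [h3, h2] using h1
    · exact nextCritical_eq hQ.2 hsound hsorted
    · simp

end Framework

/-! ### Start of a service -/

namespace Framework

/-- The ledger after the start of a service of level `j + 1` at time `t`. The transmissions of `σ`
between `floor j` and `t` are charged by level `j`, and no request of a level up to `j` remains, so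
that the levels up to `j + 1` are no longer live. -/
def Ledger.start (g : Ledger P N) (j : ℤ) (t : ℝ) : Ledger P N where
  work := g.work + 2 ^ (j + 1)
  floor := fun k => if k ≤ j then t else g.floor k
  charged := fun T => if g.floor j ≤ T ∧ T < t then insert j (g.charged T) else g.charged T
  live := g.live.filter fun k => j + 1 < k
  credit := g.credit
  horizon := g.horizon
  served := g.served

theorem Ledger.sum_charged_start (g : Ledger P N) (c : P.Elem N → ℝ≥0) (σ : Schedule P N) (j : ℤ)
    (t : ℝ) (h : ∀ T k, k ∈ g.charged T → T < g.floor k) :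
    (σ.map fun x => ∑ k ∈ (g.start j t).charged x.1, load c x.2 k).sum
      = (σ.map fun x => ∑ k ∈ g.charged x.1, load c x.2 k).sum
        + loadWithin c σ j (g.floor j) t := by
  unfold loadWithin
  rw [← List.sum_map_add]
  congr 1
  refine List.map_congr_left fun x _ => ?_
  by_cases hx : g.floor j ≤ x.1 ∧ x.1 < t
  · have hj : j ∉ g.charged x.1 := fun hj => absurd (h _ _ hj) (not_lt.2 hx.1)
    simp only [Ledger.start, if_pos hx, Finset.sum_insert hj]
    ring
  · simp only [Ledger.start, if_neg hx, add_zero]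

/-- The credit of level `j` is released when a service of level `j + 1` starts. -/
theorem Ledger.sum_credit_start {g : Ledger P N} {c : P.Elem N → ℝ≥0} {σ : Schedule P N}
    (hg : g.Backed c σ) (j : ℤ) (t : ℝ) :
    ∑ k ∈ (g.start j t).live, g.credit k + (if j ∈ g.live then g.credit j else 0)
      ≤ ∑ k ∈ g.live, g.credit k := by
  have hnot : j ∉ g.live.filter fun k => j + 1 < k := by simp
  change ∑ k ∈ g.live.filter (fun k => j + 1 < k), g.credit k + _ ≤ _
  split
  · rename_i hj
    rw [add_comm, ← Finset.sum_insert (f := g.credit) hnot]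
    refine Finset.sum_le_sum_of_subset_of_nonneg ?_ fun k hk _ => (hg k hk).1
    exact Finset.insert_subset hj (Finset.filter_subset _ _)
  · rw [add_zero]
    exact Finset.sum_le_sum_of_subset_of_nonneg (Finset.filter_subset _ _)
      fun k hk _ => (hg k hk).1

theorem filter_not_le (L : List (Pending P N)) (ℓ : ℤ) :
    (L.filter fun q => ℓ < q.level) = L.filter fun q => !decide (q.level ≤ ℓ) :=
  List.filter_congr fun q _ => by rw [← decide_not, decide_eq_decide, not_le]

theorem clean_sound {γ : ℝ} {c : P.Elem N → ℝ≥0} {Q : List (Arrival P N)} {q : Pending P N}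
    (h : Sound γ c Q q) (t : ℝ) : Sound γ c Q (q.clean t) :=
  ⟨h.mem, h.serves, h.price_pos, h.price_le, h.home_le,
    add_nonneg h.counter_nonneg (residual_nonneg q t)⟩

theorem paid_clean_le (Q : List (Arrival P N)) (q : Pending P N) (t : ℝ) :
    paid Q (q.clean t) ≤ paid Q q + late Q q t := by
  have h1 : q.delay t - paid Q q ≤ late Q q t := le_max_right _ _
  have h2 : 0 ≤ late Q q t := le_max_left _ _
  have h3 : q.counter ≤ paid Q q := le_max_left _ _
  have h4 : q.delay (release Q q) ≤ paid Q q := le_max_right _ _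
  refine max_le ?_ (h4.trans (by linarith))
  change q.counter + q.residual t ≤ _
  rcases (residual_nonneg q t).eq_or_lt with h | h
  · linarith
  · rw [counter_add_residual_of_pos h]; linarith

/-- The start of a service preserves the invariant: the charges of `charge` pay for the work of the
service, and the work in turn pays for cleaning the eligible requests, leaving `γ * 2 ^ v.level` in
reserve. -/
theorem critical_step {γ : ℝ} (hγ : 1 ≤ γ) {c : P.Elem N → ℝ≥0} {Q : List (Arrival P N)}
    (hQ : ValidInput Q) {σ : Schedule P N} (hσ : σ.Feasible Q) {g : Ledger P N} {st : State P N}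
    {now s : ℝ} {future : List (Arrival P N)} {log : Schedule P N} {m : ℕ}
    (h : Idle γ c Q σ g st now (.wakeAt s) future log m) (hfuture : ∀ a ∈ future, s ≤ a.release) :
    now ≤ s ∧ ∃ g' v m', m' < m ∧
      (uponCritical c st s).val.transmit = none ∧
      Busy γ c Q σ g' (uponCritical c st s).val.state v 0 s (uponCritical c st s).val.next future
        log m' := by
  have hacc := h.accounted
  obtain ⟨hnow, hfirst⟩ : (∀ a ∈ future, now ≤ a.release) ∧ FirstCritical st.pending now s := by
    rcases h.next_eq with ⟨h1, -⟩ | ⟨h1, s', h2, h3⟩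
    · cases h1
    · cases h2; exact ⟨h1, h3⟩
  have hs := hfirst.le
  refine ⟨hs, ?_⟩
  obtain ⟨j, hcrit, ⟨q₀, hq₀, hq₀j⟩, hlow, hval⟩ := uponCritical_val c st s hfirst.critical
  rw [hval]
  set L := st.pending with hLdef
  set low := L.filter fun q => q.level ≤ j + 1 with hlowdef
  set high := L.filter fun q => j + 1 < q.level with hhighdef
  have hmem_low : ∀ {q}, q ∈ low ↔ q ∈ L ∧ q.level ≤ j + 1 := by simp [hlowdef]
  have hmem_high : ∀ {q}, q ∈ high ↔ q ∈ L ∧ j + 1 < q.level := by simp [hhighdef]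
  set elig := low.map fun q => q.clean s with heligdef
  have hsplit : ∀ φ : Pending P N → ℝ, (high.map φ).sum + (low.map φ).sum = (L.map φ).sum := by
    intro φ
    rw [add_comm]
    exact sum_filter_add_sum_filter_not L (fun q => q.level ≤ j + 1) (fun q => j + 1 < q.level)
      (fun q => not_le.symm) φ
  have hpow : (0 : ℝ) < 2 ^ (j + 1) := by positivity
  have hlate := late_le_of_firstCritical hQ.2 hacc.sound hfirst hs le_rfl h.late_le
  -- `σ` has not been charged by level `j` since `floor j`, so this charge is a new one.
  have hcharge := charge hγ hQ.2 hσ hacc.backed hacc.sound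
    (fun q hq hqj => h.floor_le q hq j hqj) h.tracks hcrit hlow
  have hcard : high.length + low.length = L.length := by
    have := List.length_eq_length_filter_add (l := L) fun q => decide (q.level ≤ j + 1)
    rw [hhighdef, filter_not_le, this, add_comm]
  refine ⟨g.start j s, newService c L s (j + 1),
    future.length * (rounds Q + 1) + (high.length + (low.length - 1)) * rounds Q
      + 2 * low.length + 1, ?_, rfl, ?_⟩
  · have h1 : L.length ≤ Q.length := by
      have := hacc.perm.length_eq
      simp at this
      omega
    have h2 : 0 < low.length := List.length_pos_of_mem (hmem_low.2 ⟨hq₀, by omega⟩)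
    have h3 := h.fuel
    obtain ⟨l, hl⟩ : ∃ l, low.length = l + 1 := ⟨low.length - 1, by omega⟩
    have h4 : L.length = high.length + l + 1 := by omega
    rw [← hLdef, h4] at h3
    have h5 : 2 * low.length + 1 < rounds Q := by unfold rounds; omega
    rw [hl] at h5 ⊢
    simp only [Nat.add_sub_cancel]
    nlinarith
  have hfl : ∀ k, g.floor k ≤ (g.start j s).floor k := by
    intro k
    change _ ≤ if k ≤ j then s else g.floor k
    split
    · exact (hacc.floor_le_now k).trans hs
    · exact le_rfl
  have hfl' : ∀ k, j < k → (g.start j s).floor k = g.floor k := fun k hk =>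
    if_neg (not_le.2 hk)
  constructor
  · constructor
    · refine List.Perm.trans ?_ hacc.perm
      refine List.Perm.append_right _ (List.Perm.append_left _ ?_)
      have h1 : elig.map (arrival Q) = low.map (arrival Q) := by
        rw [heligdef, List.map_map]; rfl
      change ((high ++ elig).map (arrival Q)).Perm _
      rw [List.map_append, h1, ← List.map_append]
      refine List.Perm.map _ ?_
      rw [hhighdef, filter_not_le]
      exact List.perm_append_comm.trans (List.filter_append_perm _ _)
    · intro q hq
      rcases List.mem_append.1 hq with hq | hq
      · exact hacc.sound q (hmem_high.1 hq).1
      · obtain ⟨p, hp, rfl⟩ := List.mem_map.1 hq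
        exact clean_sound (hacc.sound p (hmem_low.1 hp).1) s
    · intro q hq
      rcases List.mem_append.1 hq with hq | hq
      · exact (hacc.release_le q (hmem_high.1 hq).1).trans hs
      · obtain ⟨p, hp, rfl⟩ := List.mem_map.1 hq
        exact (hacc.release_le p (hmem_low.1 hp).1).trans hs
    · intro k
      change (if k ≤ j then s else g.floor k) ≤ s
      split
      · exact le_rfl
      · exact (hacc.floor_le_now k).trans hs
    · intro a ha k
      change (if k ≤ j then s else g.floor k) ≤ _
      split
      · exact hfuture a ha
      · exact hacc.floor_le_future a ha k
    · intro T k hk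
      by_cases hT : g.floor j ≤ T ∧ T < s
      · have hk' : k ∈ insert j (g.charged T) := by simpa [Ledger.start, hT] using hk
        rcases Finset.mem_insert.1 hk' with rfl | hk'
        · simpa [Ledger.start] using hT.2
        · exact (hacc.charged_lt T k hk').trans_le (hfl k)
      · have hk' : k ∈ g.charged T := by simpa only [Ledger.start, if_neg hT] using hk
        exact (hacc.charged_lt T k hk').trans_le (hfl k)
    · intro k hk
      obtain ⟨hk1, hk2⟩ := Finset.mem_filter.1 hk
      rw [hfl' k (by omega)]
      exact hacc.backed k hk1
    · exact hacc.served
    · -- The new work `2 ^ (j + 1)` is paid by loads, by newly covered delay, and by the credit of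
      -- level `j`, which is given up.
      have h1 := hacc.budget
      have h2 := g.sum_charged_start c σ j s hacc.charged_lt
      have h3 := Ledger.sum_credit_start hacc.backed j s
      have h4 := hsplit fun q => covered σ Q q q.counter
      have h5 : (elig.map fun q => covered σ Q q q.counter).sum
          = (low.map fun q => covered σ Q q q.counter).sum
            + (low.map fun q => covered σ Q q (q.counter + q.residual s)
              - covered σ Q q q.counter).sum := by
        rw [← List.sum_map_add, heligdef, List.map_map]
        congr 1
        refine List.map_congr_left fun q _ => ?_
        rw [add_sub_cancel]
        rfl
      rw [h2]
      change g.work + 2 ^ (j + 1) + 4 * ∑ k ∈ (g.start j s).live, g.credit k ≤ _ + 4 *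
        (((high ++ elig).map fun q => covered σ Q q q.counter).sum + (g.served.map σ.due).sum)
      rw [List.map_append, List.sum_append, h5]
      linarith
    · -- Level `j + 1` was not overcritical, which bounds the investment.
      have h1 := hacc.delays
      have h2 := hsplit (paid Q)
      have h3 := hsplit fun q => q.delay (release Q q)
      have h4 : (elig.map (paid Q)).sum ≤ (low.map (paid Q)).sum + 2 ^ (j + 1) := by
        refine le_trans ?_ (add_le_add_right (hlate (j + 1)) _)
        rw [← List.sum_map_add, heligdef, List.map_map]
        exact sum_map_le _ _ _ fun q _ => paid_clean_le Q q s
      have h5 : (elig.map fun q => q.delay (release Q q)).sum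
          = (low.map fun q => q.delay (release Q q)).sum := by
        rw [heligdef, List.map_map]; rfl
      change (g.served.map log.due).sum + ((high ++ elig).map (paid Q)).sum + 2 * (γ * 2 ^ (j + 1))
        ≤ (g.served.map fun a => a.delay a.release).sum
          + ((high ++ elig).map fun q => q.delay (release Q q)).sum
          + 3 * γ * (g.work + 2 ^ (j + 1))
      simp only [List.map_append, List.sum_append, h5]
      nlinarith
    · have h1 := hacc.buys
      change _ + 3 * (γ * 2 ^ (j + 1)) ≤ 3 * γ * (g.work + 2 ^ (j + 1))
      linarith
  · rfl
  · exact h.future_eq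
  · exact hfuture
  · intro q hq k hk
    have hq' := hmem_high.1 hq
    rw [hfl' k (by omega)]
    exact h.floor_le q hq'.1 k hk
  · intro q hq k hk
    obtain ⟨p, hp, rfl⟩ := List.mem_map.1 hq
    have hk' : j + 1 ≤ k := hk
    rw [hfl' k (by omega)]
    exact h.floor_le p (hmem_low.1 hp).1 k ((hmem_low.1 hp).2.trans hk')
  · intro q hq hne
    have hq' := hmem_high.1 hq
    obtain ⟨h1, h2⟩ := h.tracks q hq'.1 hne
    exact ⟨Finset.mem_filter.2 ⟨h1, hq'.2⟩, h2⟩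
  · intro k
    refine le_trans ?_ (hlate k)
    change ((high.filter fun q => q.level ≤ k).map fun q => late Q q s).sum ≤ _
    rw [hhighdef, List.filter_comm]
    exact sum_filter_le _ (fun q : Pending P N => j + 1 < q.level) _ fun q _ _ => le_max_left _ _
  · rfl
  · exact fun q hq => (hmem_high.1 hq).2
  · exact fun k hk => (Finset.mem_filter.1 hk).2
  · intro q hq
    obtain ⟨p, hp, rfl⟩ := List.mem_map.1 hq
    exact (hmem_low.1 hp).2
  · intro q hq
    obtain ⟨p, hp, rfl⟩ := List.mem_map.1 hq
    exact le_counter_add_residual p s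
  · refine List.ne_nil_of_mem (a := q₀.clean s) ?_
    exact List.mem_map_of_mem (hmem_low.2 ⟨hq₀, by omega⟩)
  · rfl
  · exact le_rfl
  · intro i hi
    exact absurd hi (Finset.notMem_empty i)
  · exact (Finset.sum_empty).le.trans (by change (0 : ℝ) ≤ γ * 2 ^ (j + 1); positivity)
  · have : ∀ i : Fin (newService c L s (j + 1)).eligible.length,
        ((newService c L s (j + 1)).eligible.get i).residual s = 0 := by
      intro i
      obtain ⟨p, hp, hpi⟩ := List.mem_map.1 (List.get_mem (newService c L s (j + 1)).eligible i)
      rw [← hpi]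
      refine max_eq_left (sub_nonpos.2 ?_)
      exact le_counter_add_residual p s
    refine (Finset.sum_eq_zero fun i _ => this i).le.trans ?_
    change (0 : ℝ) ≤ γ * 2 ^ (j + 1)
    positivity
  · rw [Nat.cast_zero, zero_mul]
    refine Finset.sum_nonneg fun i _ => le_min (residual_nonneg _ _) ?_
    change (0 : ℝ) ≤ 2 * (γ * 2 ^ (j + 1))
    positivity
  · have h2 : 0 < low.length := List.length_pos_of_mem (hmem_low.2 ⟨hq₀, by omega⟩)
    have h6 : (newService c L s (j + 1)).eligible.length = low.length := by
      change elig.length = _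
      rw [heligdef, List.length_map]
    change future.length * (rounds Q + 1)
      + (high.length + (newService c L s (j + 1)).eligible.length) * rounds Q
      + 2 * (newService c L s (j + 1)).eligible.length + 1 ≤ _
    rw [h6]
    obtain ⟨l, hl⟩ : ∃ l, low.length = l + 1 := ⟨low.length - 1, by omega⟩
    rw [hl]
    simp only [Nat.add_sub_cancel]
    nlinarith

end Framework

/-! ### Time forwarding and the end of a service -/

namespace Framework

theorem price_cheapAt_le (c : P.Elem N → ℝ≥0) (ℓ : ℤ) : price c (cheapAt c ℓ) ≤ 2 ^ ℓ := by
  have hpos : (0 : ℝ) < 2 ^ ℓ := by positivity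
  have h1 : price c (cheapAt c ℓ)
      ≤ (cheapAt c ℓ).card • ((2 : ℝ) ^ ℓ / (Fintype.card (P.Elem N) : ℝ)) :=
    Finset.sum_le_card_nsmul _ _ _ fun e he => (Finset.mem_filter.1 he).2
  refine h1.trans ?_
  rw [nsmul_eq_mul, mul_div_left_comm]
  refine mul_le_of_le_one_right hpos.le (div_le_one_of_le₀ ?_ (Nat.cast_nonneg _))
  exact_mod_cast Finset.card_le_univ _

theorem reducedCost_le (c : P.Elem N → ℝ≥0) (cheap : Finset (P.Elem N)) (e : P.Elem N) :
    (reducedCost c cheap e : ℝ) ≤ c e := by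
  unfold reducedCost
  split
  · exact NNReal.coe_nonneg _
  · exact le_rfl

theorem price_union_le (c : P.Elem N → ℝ≥0) (cheap E : Finset (P.Elem N)) :
    price c (cheap ∪ E) ≤ price c cheap + ∑ e ∈ E, (reducedCost c cheap e : ℝ) := by
  unfold price
  rw [← Finset.union_sdiff_self_eq_union, Finset.sum_union Finset.disjoint_sdiff]
  refine add_le_add_right ?_ _
  calc ∑ e ∈ E \ cheap, (c e : ℝ) = ∑ e ∈ E \ cheap, (reducedCost c cheap e : ℝ) :=
        Finset.sum_congr rfl fun e he => by
          simp [reducedCost, (Finset.mem_sdiff.1 he).2]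
    _ ≤ _ := Finset.sum_le_sum_of_subset_of_nonneg Finset.sdiff_subset
        fun _ _ _ => NNReal.coe_nonneg _

/-- A list of sets has a common superset whose total weight is at most the sum of theirs. -/
theorem exists_superset_sum_le {E : Type*} [DecidableEq E] (w : E → ℝ) (hw : ∀ e, 0 ≤ w e)
    {α : Type*} (l : List α) (s : α → Finset E) :
    ∃ U : Finset E, (∀ x ∈ l, s x ⊆ U) ∧ ∑ e ∈ U, w e ≤ (l.map fun x => ∑ e ∈ s x, w e).sum := by
  induction l with
  | nil => exact ⟨∅, by simp⟩
  | cons x l ih =>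
    obtain ⟨U, hU, hsum⟩ := ih
    refine ⟨s x ∪ U, ?_, ?_⟩
    · intro y hy
      rcases List.mem_cons.1 hy with rfl | hy
      · exact Finset.subset_union_left
      · exact (hU y hy).trans Finset.subset_union_right
    · have h1 := Finset.sum_union_inter (s₁ := s x) (s₂ := U) (f := w)
      have h2 : 0 ≤ ∑ e ∈ s x ∩ U, w e := Finset.sum_nonneg fun e _ => hw e
      simp only [List.map_cons, List.sum_cons]
      linarith

/-- The lower bound behind a service that leaves requests behind at horizon `τ`: the transmissions of
`σ` before `τ`, together with the penalties of the requests that `σ` does not serve before `τ`, form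
a prize-collecting solution of cost at least `2 ^ v.level`. -/
theorem claim_of_le_cost {γ : ℝ} {c : P.Elem N → ℝ≥0} {Q : List (Arrival P N)}
    {σ : Schedule P N} (hσ : σ.Feasible Q) {v : Service P N} {fl τ : ℝ}
    (hsound : ∀ q ∈ v.eligible, Sound γ c Q q) (hfl : ∀ q ∈ v.eligible, fl ≤ release Q q)
    (hcheap : v.cheap = cheapAt c v.level)
    (hcost : ∀ S : (forwardInstance c v τ).Solution, S.Feasible → 2 ^ v.level ≤ S.cost) :
    2 ^ v.level ≤ loadWithin c σ v.level fl τ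
      + ∑ i with τ ≤ sInf (σ.servingTimes (arrival Q (v.eligible.get i))),
          (v.eligible.get i).residual τ := by
  set first := fun i => sInf (σ.servingTimes (arrival Q (v.eligible.get i))) with hfirst
  set l := σ.filter fun x => fl ≤ x.1 ∧ x.1 < τ with hl
  obtain ⟨U, hU, hsum⟩ := exists_superset_sum_le (fun e => (reducedCost c v.cheap e : ℝ))
    (fun e => NNReal.coe_nonneg _) l Prod.snd
  have h1 := hcost ⟨U, Finset.univ.filter fun i => first i < τ⟩ (by
    intro i hi
    obtain ⟨E, hE, hr, hs⟩ := Schedule.sInf_mem_servingTimes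
      (hσ _ (hsound _ (List.get_mem v.eligible i)).mem)
    change P.Serves U (v.eligible.get i).req
    refine P.serves_mono (hU (first i, E) ?_) hs
    refine List.mem_filter.2 ⟨hE, decide_eq_true ⟨?_, (Finset.mem_filter.1 hi).2⟩⟩
    exact (hfl _ (List.get_mem v.eligible i)).trans hr)
  rw [forwardInstance_cost] at h1
  change _ ≤ ∑ e ∈ U, (reducedCost c v.cheap e : ℝ)
    + ∑ i ∈ (Finset.univ.filter fun i : Fin v.eligible.length => first i < τ)ᶜ,
      (v.eligible.get i).residual τ at h1
  have h2 : (Finset.univ.filter fun i : Fin v.eligible.length => first i < τ)ᶜ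
      = Finset.univ.filter fun i => τ ≤ first i := by
    ext i; simp
  have h3 : ∑ i with τ ≤ first i, (v.eligible.get i).residual τ
      = ∑ i ∈ (Finset.univ.filter fun i : Fin v.eligible.length => first i < τ)ᶜ,
          (v.eligible.get i).residual τ := by rw [h2]
  have h4 : 0 ≤ ∑ i with τ ≤ first i, (v.eligible.get i).residual τ :=
    Finset.sum_nonneg fun i _ => residual_nonneg _ _
  have hload : loadWithin c σ v.level fl τ = (l.map fun x => load c x.2 v.level).sum := by
    unfold loadWithin
    rw [hl]
    clear * -
    induction σ with
    | nil => simp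
    | cons x σ ih => by_cases hx : fl ≤ x.1 ∧ x.1 < τ <;> simp [hx, ih]
  -- An element that is not truncated settles the claim; otherwise every set of elements has load
  -- at least its reduced cost.
  by_cases hbig : ∃ x ∈ l, ∃ e ∈ x.2, (2 : ℝ) ^ v.level ≤ c e
  · obtain ⟨x, hx, e, he, hce⟩ := hbig
    obtain ⟨hxσ, hxt⟩ := List.mem_filter.1 hx
    have hxt' := of_decide_eq_true hxt
    have h5 := load_le_loadWithin c σ v.level hxσ hxt'.1 hxt'.2
    have h6 : (c e : ℝ) ≤ price c x.2 :=
      Finset.single_le_sum (f := fun e => (c e : ℝ)) (fun _ _ => NNReal.coe_nonneg _) he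
    have h7 : (2 : ℝ) ^ v.level ≤ load c x.2 v.level := by
      unfold load
      rw [if_pos (hce.trans h6)]
      refine le_add_of_nonneg_right (Finset.sum_nonneg fun e _ => ?_)
      split
      · exact le_min (NNReal.coe_nonneg _) (by positivity)
      · exact le_rfl
    linarith
  · push Not at hbig
    have h5 : (l.map fun x => ∑ e ∈ x.2, (reducedCost c v.cheap e : ℝ)).sum
        ≤ (l.map fun x => load c x.2 v.level).sum := by
      refine sum_map_le _ _ _ fun x hx => ?_
      unfold load
      refine le_add_of_nonneg_of_le (by split <;> positivity) (Finset.sum_le_sum fun e he => ?_)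
      unfold reducedCost
      by_cases hc : e ∈ v.cheap
      · rw [if_pos hc]
        split
        · exact le_min (NNReal.coe_nonneg _) (by positivity)
        · exact le_rfl
      · have hlt : (2 : ℝ) ^ v.level < Fintype.card (P.Elem N) * (c e : ℝ) := by
          have hn : (0 : ℝ) < Fintype.card (P.Elem N) := by
            exact_mod_cast Fintype.card_pos_iff.2 ⟨e⟩
          rw [hcheap, cheapAt, Finset.mem_filter, not_and] at hc
          have := not_le.1 (hc (Finset.mem_univ e))
          rwa [div_lt_iff₀ hn, mul_comm] at this
        rw [if_neg hc, if_pos hlt, min_eq_left (hbig x hx e he).le]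
    rw [hload, h3]
    linarith

/-- What a service transmits serves a request, and everything that the loop has found to be served;
its cost is bounded also if the solution for a single request is used, since the home level of that
request is at most the level of the service. -/
theorem choice_spec {γ : ℝ} (hγ : 1 ≤ γ) {c : P.Elem N → ℝ≥0} {Q : List (Arrival P N)}
    {σ : Schedule P N} {g : Ledger P N} {st : State P N} {v : Service P N} {k : ℕ} {now : ℝ}
    {next : Next} {future : List (Arrival P N)} {log : Schedule P N} {m : ℕ}
    (h : Busy γ c Q σ g st v k now next future log m) :
    (choice v).1.Nonempty ∧ v.served ⊆ (choice v).1 ∧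
      (∀ i ∈ (choice v).1, P.Serves (v.cheap ∪ (choice v).2) (v.eligible.get i).req) ∧
      price c (v.cheap ∪ (choice v).2) ≤ 3 * (γ * 2 ^ v.level) := by
  have hpow : (0 : ℝ) < 2 ^ v.level := by positivity
  have hcheap := price_cheapAt_le c v.level
  rw [← h.cheap] at hcheap
  have hunion := fun E => price_union_le c v.cheap E
  by_cases hs : v.served = ∅
  · have hlen : 0 < v.eligible.length := List.length_pos_iff.2 h.nonempty
    have hch : choice v = ({⟨0, hlen⟩}, (v.eligible.get ⟨0, hlen⟩).single) := by
      simp [choice, hs, hlen]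
    have hsound := h.accounted.sound _ (List.mem_append_right _ (List.get_mem v.eligible ⟨0, hlen⟩))
    have h1 := hsound.price_single_le hγ (h.low _ (List.get_mem _ _))
    rw [hch]
    refine ⟨Finset.singleton_nonempty _, by simp [hs], ?_, ?_⟩
    · intro i hi
      rw [Finset.mem_singleton.1 hi]
      exact P.serves_mono Finset.subset_union_right hsound.serves
    · have h2 := Finset.sum_le_sum fun e (_ : e ∈ (v.eligible.get ⟨0, hlen⟩).single) =>
        reducedCost_le c v.cheap e
      refine (hunion _).trans ?_
      change _ ≤ price c _ at h2
      nlinarith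
  · have hch : choice v = (v.served, v.elems) := by simp [choice, hs]
    rw [hch]
    refine ⟨Finset.nonempty_of_ne_empty hs, subset_rfl, ?_, ?_⟩
    · exact fun i hi => P.serves_mono Finset.subset_union_right (h.serves i hi)
    · refine (hunion _).trans ?_
      have := h.elems_le
      nlinarith

/-- The number of rounds of a service is at most twice the number of its requests. -/
theorem Busy.round_le {γ : ℝ} (hγ : 1 ≤ γ) {c : P.Elem N → ℝ≥0} {Q : List (Arrival P N)}
    {σ : Schedule P N} {g : Ledger P N} {st : State P N} {v : Service P N} {k : ℕ} {now : ℝ}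
    {next : Next} {future : List (Arrival P N)} {log : Schedule P N} {m : ℕ}
    (h : Busy γ c Q σ g st v k now next future log m) : k ≤ 2 * v.eligible.length := by
  have hB : 0 < γ * (2 : ℝ) ^ v.level := mul_pos (by linarith) (by positivity)
  have h1 : (k : ℝ) * (γ * 2 ^ v.level) ≤ v.eligible.length * (2 * (γ * 2 ^ v.level)) := by
    refine h.progress.trans ?_
    refine (Finset.sum_le_sum fun i _ => min_le_right _ _).trans ?_
    simp
  have h2 : (k : ℝ) ≤ 2 * v.eligible.length := by
    by_contra! hlt
    nlinarith
  exact_mod_cast h2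

/-- The ledger after a service `v` ends with horizon `τ`. If the service leaves requests behind, then
its level becomes live, with the penalties that `σ` pays as its credit. -/
def Ledger.finish (g : Ledger P N) (Q : List (Arrival P N)) (σ : Schedule P N) (v : Service P N)
    (τ : ℝ) : Ledger P N where
  work := g.work
  floor := g.floor
  charged := g.charged
  live := if ∀ i, i ∈ v.served then g.live else insert v.level g.live
  credit := Function.update g.credit v.level
    (∑ i with τ ≤ sInf (σ.servingTimes (arrival Q (v.eligible.get i))),
      (v.eligible.get i).residual τ)
  horizon := Function.update g.horizon v.level τ
  served := g.served ++ ((List.finRange v.eligible.length).filter fun i => i ∈ (choice v).1).map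
    fun i => arrival Q (v.eligible.get i)

/-- The end of a service with horizon `τ` preserves the invariant. The delay that requests have in
`σ` becomes covered when they are served, or left behind with their counters raised to horizon `τ`;
this gain pays for the credit of the new live level. -/
theorem finish_step {γ : ℝ} (hγ : 1 ≤ γ) {c : P.Elem N → ℝ≥0} {Q : List (Arrival P N)}
    (hQ : ValidInput Q) {σ : Schedule P N} {g : Ledger P N} {st : State P N}
    {v : Service P N} {k : ℕ} {now : ℝ} {next : Next} {future : List (Arrival P N)}
    {log : Schedule P N} {m : ℕ} (h : Busy γ c Q σ g st v k now next future log m) {τ : ℝ}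
    (hunserved : ∑ i with i ∉ v.served, (v.eligible.get i).residual τ ≤ 2 * (γ * 2 ^ v.level))
    (hclaim : (∃ i, i ∉ v.served) → 2 ^ v.level ≤ loadWithin c σ v.level (g.floor v.level) τ
      + ∑ i with τ ≤ sInf (σ.servingTimes (arrival Q (v.eligible.get i))),
          (v.eligible.get i).residual τ)
    {r : Response P N (State P N)} (hr : r = (finishService st v now τ).val) :
    ∃ g' m', m' < m ∧ Idle γ c Q σ g' r.state now r.next future
      (log ++ r.transmit.toList.map fun E => (now, E)) m' := by
  rw [finishService_val] at hr
  subst hr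
  obtain ⟨hne, hsub, hserves, hprice⟩ := choice_spec hγ h
  have hacc := h.accounted
  set ℓ := v.level with hℓ
  set B := γ * (2 : ℝ) ^ ℓ with hB
  set n := v.eligible.length with hn
  set ch := (choice v).1 with hch
  set el : Fin n → Pending P N := fun i => v.eligible.get i with hel
  set first := fun i => sInf (σ.servingTimes (arrival Q (el i))) with hfirst
  set D := ∑ i with τ ≤ first i, (el i).residual τ with hD
  have hD0 : 0 ≤ D := Finset.sum_nonneg fun i _ => residual_nonneg _ _
  have hmem : ∀ i, el i ∈ v.eligible := fun i => List.get_mem _ _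
  have hsound : ∀ i, Sound γ c Q (el i) := fun i =>
    hacc.sound _ (List.mem_append_right _ (hmem i))
  have hℓlive : ℓ ∉ g.live := fun hmem => lt_irrefl _ (h.live_high ℓ hmem)
  have hservedQ : ∀ b ∈ g.served, b ∈ Q := fun b hb => hacc.perm.subset (by simp [hb])
  have hsumElig : ∀ φ : Pending P N → ℝ, (v.eligible.map φ).sum = ∑ i, φ (el i) :=
    fun φ => (sum_get v.eligible φ).symm
  have hsumLeft : ∀ φ : Pending P N → ℝ, ((leftover v τ).map φ).sum
      = ∑ i with i ∉ ch, φ ((el i).upgrade τ ℓ) := by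
    intro φ
    rw [leftover, List.map_map]
    exact sum_finRange_filter (fun i => i ∉ ch) _
  set sv := ((List.finRange n).filter fun i => i ∈ ch).map fun i => arrival Q (el i) with hsv
  have hsumSv : ∀ φ : Arrival P N → ℝ, (sv.map φ).sum = ∑ i with i ∈ ch, φ (arrival Q (el i)) := by
    intro φ
    rw [hsv, List.map_map]
    exact sum_finRange_filter (fun i => i ∈ ch) _
  have hpart : ∀ φ : Fin n → ℝ, ∑ i with i ∈ ch, φ i + ∑ i with i ∉ ch, φ i = ∑ i, φ i :=
    fun φ => Finset.sum_filter_add_sum_filter_not _ _ _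
  have hleft : ∀ q ∈ leftover v τ, ∃ i, i ∉ ch ∧ q = (el i).upgrade τ ℓ := by
    intro q hq
    obtain ⟨i, hi, rfl⟩ := List.mem_map.1 hq
    exact ⟨i, of_decide_eq_true (List.mem_filter.1 hi).2, rfl⟩
  have hupSound : ∀ i, Sound γ c Q ((el i).upgrade τ ℓ) := fun i =>
    ⟨(hsound i).mem, (hsound i).serves, (hsound i).price_pos, (hsound i).price_le,
      (hsound i).home_le.trans (h.low _ (hmem i)),
      add_nonneg (hsound i).counter_nonneg (residual_nonneg _ _)⟩
  have hsound' : ∀ q ∈ st.pending ++ leftover v τ, Sound γ c Q q := by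
    intro q hq
    rcases List.mem_append.1 hq with hq | hq
    · exact hacc.sound q (List.mem_append_left _ hq)
    · obtain ⟨i, -, rfl⟩ := hleft q hq
      exact hupSound i
  have hservedTime : ∀ i ∈ ch,
      now ∈ Schedule.servingTimes (log ++ [(now, v.cheap ∪ (choice v).2)]) (arrival Q (el i)) :=
    fun i hi => ⟨_, by simp, hacc.release_le _ (List.mem_append_right _ (hmem i)), hserves i hi⟩
  have hcounter : ∀ i, (el i).delay now ≤ (el i).counter := fun i => h.clean _ (hmem i)
  refine ⟨g.finish Q σ v τ,
    future.length * (rounds Q + 1) + (st.pending.length + (leftover v τ).length) * rounds Q,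
    ?_, ?_⟩
  · have h1 : (leftover v τ).length < n := by
      obtain ⟨i, hi⟩ := hne
      rw [leftover, List.length_map]
      conv_rhs => rw [← List.length_finRange (n := n)]
      exact List.length_filter_lt_length_iff_exists.2 ⟨i, List.mem_finRange i, by simp [hch ▸ hi]⟩
    have h2 := h.fuel
    have h3 := h.round_le hγ
    have h4 : ((leftover v τ).length + 1) * rounds Q ≤ n * rounds Q :=
      Nat.mul_le_mul_right _ h1
    rw [← hn] at h2 h3
    nlinarith
  have hbacked : (g.finish Q σ v τ).Backed c σ := by
    intro j hj
    by_cases hjl : j = ℓ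
    · subst hjl
      have hnot : ∃ i, i ∉ v.served := by
        by_contra! hall
        have : (g.finish Q σ v τ).live = g.live := if_pos hall
        rw [this] at hj
        exact hℓlive hj
      simp only [Ledger.finish, ← hℓ, Function.update_self]
      exact ⟨hD0, hclaim hnot⟩
    · have hj' : j ∈ g.live := by
        simp only [Ledger.finish] at hj
        split at hj
        · exact hj
        · exact (Finset.mem_insert.1 hj).resolve_left hjl
      simp only [Ledger.finish, ← hℓ, Function.update_of_ne hjl]
      exact hacc.backed j hj'
  constructor
  · simp only [Option.toList_some, List.map_cons, List.map_nil]
    constructor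
    · refine List.Perm.trans ?_ hacc.perm
      refine List.Perm.append_right _ ?_
      change (g.served ++ sv ++ (st.pending ++ leftover v τ).map (arrival Q)).Perm _
      have h1 : (leftover v τ).map (arrival Q)
          = ((List.finRange n).filter fun i => i ∉ ch).map fun i => arrival Q (el i) := by
        rw [leftover, List.map_map]; rfl
      have h2 : v.eligible.map (arrival Q) = (List.finRange n).map fun i => arrival Q (el i) := by
        conv_lhs => rw [← List.map_get_finRange v.eligible, List.map_map]
        rfl
      have h3 : (sv ++ (leftover v τ).map (arrival Q)).Perm (v.eligible.map (arrival Q)) := by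
        rw [h1, h2, hsv, ← List.map_append]
        refine List.Perm.map _ ?_
        simpa using List.filter_append_perm (fun i => decide (i ∈ ch)) (List.finRange n)
      rw [List.map_append, List.map_append]
      classical
      rw [List.perm_iff_count] at h3 ⊢
      intro x
      have := h3 x
      simp only [List.count_append] at this ⊢
      omega
    · exact hsound'
    · intro q hq
      rcases List.mem_append.1 hq with hq | hq
      · exact hacc.release_le q (List.mem_append_left _ hq)
      · obtain ⟨i, -, rfl⟩ := hleft q hq
        exact hacc.release_le (el i) (List.mem_append_right _ (hmem i))
    · exact hacc.floor_le_now
    · exact hacc.floor_le_future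
    · exact hacc.charged_lt
    · exact hbacked
    · intro b hb
      rcases List.mem_append.1 hb with hb | hb
      · exact (hacc.served b hb).mono (Schedule.servingTimes_append _ _ _)
      · obtain ⟨i, hi, rfl⟩ := List.mem_map.1 hb
        exact ⟨_, hservedTime i (of_decide_eq_true (List.mem_filter.1 hi).2)⟩
    · -- Eligible requests that `σ` serves at `τ` or later contribute their residual delay to the
      -- credit; their covered delay grows by as much, whether they are served or left behind.
      have h1 := hacc.budget
      have h2 : ∑ j ∈ (g.finish Q σ v τ).live, (g.finish Q σ v τ).credit j
          = ∑ j ∈ g.live, g.credit j + if ∀ i, i ∈ v.served then 0 else D := by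
        have h3 : ∑ j ∈ g.live, (g.finish Q σ v τ).credit j = ∑ j ∈ g.live, g.credit j :=
          Finset.sum_congr rfl fun j hj =>
            Function.update_of_ne (fun (e : j = ℓ) => hℓlive (e ▸ hj)) _ _
        have h4 : (g.finish Q σ v τ).credit ℓ = D := Function.update_self _ _ _
        by_cases hall : ∀ i, i ∈ v.served
        · have : (g.finish Q σ v τ).live = g.live := if_pos hall
          rw [this, h3, if_pos hall, add_zero]
        · have : (g.finish Q σ v τ).live = insert ℓ g.live := if_neg hall
          rw [this, Finset.sum_insert hℓlive, h3, h4, if_neg hall, add_comm]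
      have hcovdue : ∀ i x, covered σ Q (el i) x ≤ σ.due (arrival Q (el i)) :=
        fun i x => min_le_right _ _
      have h5 : ∑ i, covered σ Q (el i) (el i).counter + (if ∀ i, i ∈ v.served then 0 else D)
          ≤ ∑ i with i ∈ ch, σ.due (arrival Q (el i))
            + ∑ i with i ∉ ch, covered σ Q (el i) ((el i).counter + (el i).residual τ) := by
        by_cases hall : ∀ i, i ∈ v.served
        · have hfil : (Finset.univ.filter fun i => i ∉ ch) = ∅ :=
            Finset.filter_eq_empty_iff.2 fun i _ => not_not.2 (hsub (hall i))
          rw [if_pos hall, ← hpart, hfil, Finset.sum_empty, Finset.sum_empty, add_zero, add_zero,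
            add_zero]
          exact Finset.sum_le_sum fun i _ => hcovdue i _
        · rw [if_neg hall, hD, Finset.sum_filter, ← Finset.sum_add_distrib, ← hpart]
          refine add_le_add (Finset.sum_le_sum fun i _ => ?_) (Finset.sum_le_sum fun i _ => ?_)
          · split
            · have := covered_residual (hsound i) hQ.2 σ ‹_›
              linarith [hcovdue i ((el i).counter + (el i).residual τ)]
            · linarith [hcovdue i (el i).counter]
          · split
            · have := covered_residual (hsound i) hQ.2 σ ‹_›
              linarith
            · rw [add_zero]
              exact covered_mono σ Q (el i) (by linarith [residual_nonneg (el i) τ])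
      have h6 := hsumLeft fun q => covered σ Q q q.counter
      have h7 := hsumSv σ.due
      have h8 := hsumElig fun q => covered σ Q q q.counter
      rw [h2]
      change g.work + _ ≤ 4 * (σ.map fun x => ∑ j ∈ g.charged x.1, load c x.2 j).sum
        + 4 * (((st.pending ++ leftover v τ).map fun q => covered σ Q q q.counter).sum
          + ((g.served ++ sv).map σ.due).sum)
      simp only [List.map_append, List.sum_append] at h1 ⊢
      rw [h6, h7]
      rw [h8] at h1
      have h9 : ∑ i with i ∉ ch, covered σ Q ((el i).upgrade τ ℓ) ((el i).upgrade τ ℓ).counter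
        = ∑ i with i ∉ ch, covered σ Q (el i) ((el i).counter + (el i).residual τ) := rfl
      rw [h9]
      linarith
    · -- The counters of the served requests dominate their delays, and the reserve pays for the
      -- investment in the others.
      have h1 := hacc.delays
      have h2 := sum_due_append_le hQ.2 hservedQ hacc.served [(now, v.cheap ∪ (choice v).2)]
      have h3 := hsumLeft (paid Q)
      have h4 := hsumLeft fun q => q.delay (release Q q)
      have h5 := hsumSv (Schedule.due (log ++ [(now, v.cheap ∪ (choice v).2)]))
      have h6 := hsumSv fun a => a.delay a.release
      have h7 := hsumElig (paid Q)
      have h8 := hsumElig fun q => q.delay (release Q q)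
      have h9 : ∑ i with i ∉ ch, (el i).residual τ ≤ 2 * B := by
        refine le_trans ?_ hunserved
        refine Finset.sum_le_sum_of_subset_of_nonneg ?_ fun i _ _ => residual_nonneg _ _
        intro i hi
        simp only [Finset.mem_filter, Finset.mem_univ, true_and] at hi ⊢
        exact fun hi' => hi (hsub hi')
      have h10 : ∑ i with i ∈ ch,
          Schedule.due (log ++ [(now, v.cheap ∪ (choice v).2)]) (arrival Q (el i))
          ≤ ∑ i with i ∈ ch, paid Q (el i) := by
        refine Finset.sum_le_sum fun i hi => ?_
        have := Schedule.due_le ((hsound i).mono hQ.2) (hservedTime i (Finset.mem_filter.1 hi).2)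
        exact this.trans ((hcounter i).trans (le_max_left _ _))
      have h11 : ∑ i with i ∉ ch, paid Q ((el i).upgrade τ ℓ)
          ≤ ∑ i with i ∉ ch, paid Q (el i) + 2 * B := by
        refine le_trans ?_ (add_le_add_right h9 _)
        rw [← Finset.sum_add_distrib]
        refine Finset.sum_le_sum fun i _ => ?_
        have hr0 := residual_nonneg (el i) τ
        refine max_le (add_le_add_left (le_max_left _ _) _) ?_
        exact le_add_of_le_of_nonneg (le_max_right _ _) hr0
      have h12 := hpart fun i => paid Q (el i)
      have h13 := hpart fun i => (el i).delay (release Q (el i))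
      change ((g.served ++ sv).map (Schedule.due (log ++ [(now, v.cheap ∪ (choice v).2)]))).sum
        + ((st.pending ++ leftover v τ).map (paid Q)).sum + 2 * 0
        ≤ ((g.served ++ sv).map fun a => a.delay a.release).sum
          + ((st.pending ++ leftover v τ).map fun q => q.delay (release Q q)).sum
          + 3 * γ * g.work
      simp only [List.map_append, List.sum_append] at h1 ⊢
      rw [h3, h4, h5, h6]
      rw [h7, h8, ← h12, ← h13] at h1
      have h14 : ∑ i with i ∉ ch, ((el i).upgrade τ ℓ).delay (release Q ((el i).upgrade τ ℓ))
        = ∑ i with i ∉ ch, (el i).delay (release Q (el i)) := rfl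
      have h15 : ∑ i with i ∈ ch, (arrival Q (el i)).delay (arrival Q (el i)).release
        = ∑ i with i ∈ ch, (el i).delay (release Q (el i)) := rfl
      rw [h14, h15]
      linarith
    · have h1 := hacc.buys
      simp only [List.map_append, List.sum_append, List.map_cons, List.map_nil, List.sum_cons,
        List.sum_nil]
      change _ ≤ 3 * γ * g.work
      linarith
  · rfl
  · exact h.future_eq
  · intro q hq j hj
    rcases List.mem_append.1 hq with hq | hq
    · exact h.floor_le q hq j hj
    · obtain ⟨i, -, rfl⟩ := hleft q hq
      exact h.floor_le_eligible _ (hmem i) j hj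
  · intro q hq hhome
    rcases List.mem_append.1 hq with hq | hq
    · obtain ⟨h1, h2⟩ := h.tracks q hq hhome
      have h3 : q.level ≠ ℓ := (h.high q hq).ne'
      refine ⟨?_, ?_⟩
      · simp only [Ledger.finish]
        split
        · exact h1
        · exact Finset.mem_insert_of_mem h1
      · simp only [Ledger.finish, ← hℓ, Function.update_of_ne h3]
        exact h2
    · obtain ⟨i, hi, rfl⟩ := hleft q hq
      have hnot : ¬ ∀ i, i ∈ v.served := fun hall => hi (hsub (hall i))
      refine ⟨?_, ?_⟩
      · change ℓ ∈ if ∀ i, i ∈ v.served then g.live else insert ℓ g.live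
        rw [if_neg hnot]
        exact Finset.mem_insert_self _ _
      · change (el i).delay (Function.update g.horizon ℓ τ ℓ) ≤ _
        rw [Function.update_self]
        exact le_counter_add_residual (el i) τ
  · intro j
    have h1 := h.late_le j
    have h2 : (((leftover v τ).filter fun q => q.level ≤ j).map fun q => late Q q now).sum ≤ 0 := by
      refine (sum_map_le _ _ (fun _ => 0) fun q hq => ?_).trans (by simp)
      obtain ⟨i, -, rfl⟩ := hleft q (List.mem_of_mem_filter hq)
      have h3 : (el i).counter + (el i).residual τ ≤ paid Q ((el i).upgrade τ ℓ) := le_max_left _ _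
      refine max_le le_rfl (sub_nonpos.2 ?_)
      change (el i).delay now ≤ _
      linarith [hcounter i, residual_nonneg (el i) τ]
    simp only [List.filter_append, List.map_append, List.sum_append]
    linarith
  · exact nextCritical_eq hQ.2 hsound' h.now_le
  · simp

/-- A round of the time-forwarding loop ends the service or preserves the invariant of a service. -/
theorem forward_step {A : PCAlgorithm P} {γ : P.Net → ℝ} (hγ : 1 ≤ γ N) (hA : A.IsApprox γ)
    {c : P.Elem N → ℝ≥0} {Q : List (Arrival P N)} (hQ : ValidInput Q) {σ : Schedule P N}
    (hσ : σ.Feasible Q) {g : Ledger P N} {st : State P N} {v : Service P N} {k : ℕ} {now : ℝ}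
    {next : Next} {future : List (Arrival P N)} {log : Schedule P N} {m : ℕ}
    (h : Busy (γ N) c Q σ g st v k now next future log m)
    {r : Response P N (State P N)} (hr : r ∈ (forwardTime A (γ N) c st v now).vals) :
    (∃ g' m', m' < m ∧ Idle (γ N) c Q σ g' r.state now r.next future
      (log ++ r.transmit.toList.map fun E => (now, E)) m') ∨
    (∃ v' m', m' < m ∧ Busy (γ N) c Q σ g r.state v' (k + 1) now r.next future
      (log ++ r.transmit.toList.map fun E => (now, E)) m') := by
  have hacc := h.accounted
  have hγ0 : 0 < γ N := by linarith
  have hpow : (0 : ℝ) < 2 ^ v.level := by positivity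
  have hB : 0 < γ N * (2 : ℝ) ^ v.level := mul_pos hγ0 hpow
  have hsound : ∀ i, Sound (γ N) c Q (v.eligible.get i) := fun i =>
    hacc.sound _ (List.mem_append_right _ (List.get_mem _ _))
  have hmono : ∀ i, Monotone (v.eligible.get i).residual := fun i =>
    residual_mono ((hsound i).mono hQ.2)
  have hcases := mem_vals_forwardTime hr
  generalize hτ : nextTime (γ N) v now = τ at hcases
  rcases hcases with ⟨hall, hr⟩ | ⟨⟨i₀, hi₀⟩, sol, hsol, hcase⟩
  · left
    refine finish_step hγ hQ h ?_ (fun ⟨i, hi⟩ => absurd (hall i) hi) hr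
    linarith [h.unserved_le]
  · obtain ⟨hfeas, hopt⟩ := feasible_and_cost_le_of_mem_vals hA hsol
    set f : ℝ → ℝ := fun s => ∑ i with i ∉ v.served,
      ((v.eligible.get i).residual s - (v.eligible.get i).residual v.time) with hf
    have hfc : Continuous f := continuous_finsetSum _ fun i _ =>
      (residual_continuous ((hsound i).cont hQ.2)).sub continuous_const
    have hft : Tendsto f atTop atTop := by
      have h1 : Tendsto (fun s => (v.eligible.get i₀).residual s
          - ∑ i with i ∉ v.served, (v.eligible.get i).residual v.time) atTop atTop :=
        tendsto_atTop_add_const_right _ _ (residual_tendsto ((hsound i₀).tendsto hQ.2))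
      refine tendsto_atTop_mono (fun s => ?_) h1
      simp only [hf, Finset.sum_sub_distrib]
      refine sub_le_sub_right ?_ _
      exact Finset.single_le_sum (f := fun i => (v.eligible.get i).residual s)
        (fun i _ => residual_nonneg _ _) (by simp [hi₀])
    have hfneg : ∀ s, s ≤ v.time → f s ≤ 0 := fun s hs =>
      Finset.sum_nonpos fun i _ => sub_nonpos.2 (hmono i hs)
    have hfτ : f τ = γ N * 2 ^ v.level := by
      rw [← hτ]
      exact firstHit_eq hfc hft ((hfneg now h.time_le).trans hB.le)
    have hτtime : v.time ≤ τ := by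
      by_contra! hlt
      linarith [hfneg τ hlt.le]
    have hfτ' : ∑ i with i ∉ v.served, (v.eligible.get i).residual τ
        = ∑ i with i ∉ v.served, (v.eligible.get i).residual v.time + γ N * 2 ^ v.level := by
      rw [← hfτ]
      simp only [hf, Finset.sum_sub_distrib]
      ring
    rcases hcase with ⟨hfull, hr⟩ | ⟨hfull, rfl⟩
    · left
      refine finish_step hγ hQ h (by linarith [h.unserved_le]) (fun _ => ?_) hr
      refine claim_of_le_cost hσ (fun q hq => hacc.sound q (List.mem_append_right _ hq))
        (fun q hq => h.floor_le_eligible q hq _ le_rfl) h.cheap fun S hS => ?_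
      exact le_of_mul_le_mul_left (hfull.trans (hopt S hS)) hγ0
    · right
      have hround := h.round_le hγ
      have hlen : 0 < v.eligible.length := List.length_pos_iff.2 h.nonempty
      have hfuel := h.fuel
      obtain ⟨m', rfl⟩ : ∃ m', m = m' + 1 := by
        refine ⟨m - 1, ?_⟩
        have : rounds Q ≤ (st.pending.length + v.eligible.length) * rounds Q :=
          Nat.le_mul_of_pos_left _ (by omega)
        omega
      have hcost := forwardInstance_cost c v τ sol
      have hpen : 0 ≤ ∑ i ∈ sol.servedᶜ, (v.eligible.get i).residual τ :=
        Finset.sum_nonneg fun i _ => residual_nonneg _ _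
      have hel : 0 ≤ ∑ e ∈ sol.elems, (reducedCost c v.cheap e : ℝ) :=
        Finset.sum_nonneg fun e _ => NNReal.coe_nonneg _
      simp only [Option.toList_none, List.map_nil, List.append_nil]
      refine ⟨{ level := v.level, cheap := v.cheap, eligible := v.eligible, time := τ,
                served := sol.served, elems := sol.elems }, m', Nat.lt_succ_self _, ?_⟩
      constructor
      · exact hacc
      · rfl
      · exact h.future_eq
      · exact h.now_le
      · exact h.floor_le
      · exact h.floor_le_eligible
      · exact h.tracks
      · exact h.late_le
      · rfl
      · exact h.high
      · exact h.live_high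
      · exact h.low
      · exact h.clean
      · exact h.nonempty
      · exact h.cheap
      · exact h.time_le.trans hτtime
      · exact hfeas
      · change ∑ e ∈ sol.elems, (reducedCost c v.cheap e : ℝ) ≤ γ N * 2 ^ v.level
        linarith
      · have h1 : ∀ S : Finset (Fin v.eligible.length),
            ∑ i with i ∉ S, (v.eligible.get i).residual τ
              = ∑ i ∈ Sᶜ, (v.eligible.get i).residual τ := by
          intro S
          congr 1
          ext i
          simp
        refine (h1 sol.served).trans_le ?_
        change ∑ i ∈ sol.servedᶜ, (v.eligible.get i).residual τ ≤ γ N * 2 ^ v.level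
        linarith
      · -- The requests that were not served before cannot be truncated at either time.
        have h1 : ∑ i, min ((v.eligible.get i).residual v.time) (2 * (γ N * 2 ^ v.level))
            + γ N * 2 ^ v.level
            ≤ ∑ i, min ((v.eligible.get i).residual τ) (2 * (γ N * 2 ^ v.level)) := by
          have h2 : γ N * 2 ^ v.level = ∑ i, if i ∉ v.served then
              ((v.eligible.get i).residual τ - (v.eligible.get i).residual v.time) else 0 := by
            rw [← hfτ, ← Finset.sum_filter]
          have h3 : ∀ i, min ((v.eligible.get i).residual v.time) (2 * (γ N * 2 ^ v.level))
              + (if i ∉ v.served then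
                ((v.eligible.get i).residual τ - (v.eligible.get i).residual v.time) else 0)
              ≤ min ((v.eligible.get i).residual τ) (2 * (γ N * 2 ^ v.level)) := by
            intro i
            split
            · rename_i hi
              have hmem : i ∈ Finset.univ.filter fun i => i ∉ v.served := by simp [hi]
              have h4 : (v.eligible.get i).residual τ ≤ 2 * (γ N * 2 ^ v.level) := by
                have h5 := Finset.single_le_sum
                  (f := fun i => (v.eligible.get i).residual τ)
                  (fun i _ => residual_nonneg _ _) hmem
                linarith [h.unserved_le]
              rw [min_eq_left h4]
              linarith [min_le_left ((v.eligible.get i).residual v.time)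
                (2 * (γ N * 2 ^ v.level))]
            · rw [add_zero]
              exact min_le_min_right _ (hmono i hτtime)
          have h4 := Finset.sum_le_sum fun i (_ : i ∈ Finset.univ) => h3 i
          rw [Finset.sum_add_distrib, ← h2] at h4
          exact h4
        have h2 := h.progress
        change ((k + 1 : ℕ) : ℝ) * (γ N * 2 ^ v.level)
          ≤ ∑ i, min ((v.eligible.get i).residual τ) (2 * (γ N * 2 ^ v.level))
        push_cast
        linarith
      · change future.length * (rounds Q + 1)
          + (st.pending.length + v.eligible.length) * rounds Q + 2 * v.eligible.length + 1 ≤ _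
        omega

end Framework

/-! ### Runs -/

namespace OnlineAlgorithm

theorem activate_eq {alg : OnlineAlgorithm P N} (x : alg.Config) (t : ℝ)
    (future : List (Arrival P N)) (r : RTimed (Response P N alg.State)) :
    alg.activate x t future r = r.toPMF.map fun y =>
      { state := y.val.state
        now := t
        next := y.val.next
        future := future
        log := x.log ++ (y.val.transmit.toList.map fun E => (t, E))
        clock := x.clock + y.steps + 1 } := rfl

theorem mem_support_activate {alg : OnlineAlgorithm P N} {x y : alg.Config} {t : ℝ}
    {future : List (Arrival P N)} {r : RTimed (Response P N alg.State)}
    (h : y ∈ (alg.activate x t future r).support) :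
    ∃ z ∈ r.vals, y.state = z.state ∧ y.now = t ∧ y.next = z.next ∧ y.future = future ∧
      y.log = x.log ++ z.transmit.toList.map fun E => (t, E) := by
  rw [activate_eq, PMF.mem_support_map_iff] at h
  obtain ⟨z, hz, rfl⟩ := h
  exact ⟨z.val, ⟨z, hz, rfl⟩, rfl, rfl, rfl, rfl, rfl⟩

variable (alg : OnlineAlgorithm P N) {x : alg.Config}

theorem step_resume (h : x.next = .resume) :
    alg.step x = alg.activate x x.now x.future (alg.onWake x.state x.now) := by
  unfold step
  rw [h]

theorem step_sleep_cons {a : Arrival P N} {future : List (Arrival P N)} (h : x.next = .sleep)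
    (hf : x.future = a :: future) :
    alg.step x = alg.activate x a.release future (alg.onRequest x.state a.release a) := by
  unfold step
  rw [h, hf]

theorem step_wakeAt_nil {s : ℝ} (h : x.next = .wakeAt s) (hf : x.future = []) :
    alg.step x = alg.activate x (max x.now s) [] (alg.onWake x.state (max x.now s)) := by
  unfold step
  rw [h, hf]

theorem step_wakeAt_cons {s : ℝ} {a : Arrival P N} {future : List (Arrival P N)}
    (h : x.next = .wakeAt s) (hf : x.future = a :: future) :
    alg.step x = if a.release ≤ max x.now s then
        alg.activate x a.release future (alg.onRequest x.state a.release a)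
      else
        alg.activate x (max x.now s) (a :: future) (alg.onWake x.state (max x.now s)) := by
  unfold step
  rw [h, hf]

theorem step_halted (h : x.Halted) : alg.step x = PMF.pure x := by
  unfold step
  rw [h.1, h.2]

end OnlineAlgorithm

namespace Framework

/-- The invariant of the framework, for a snapshot of a run. -/
def Inv {A : PCAlgorithm P} {γ : ℝ} {c : P.Elem N → ℝ≥0} (Q : List (Arrival P N))
    (σ : Schedule P N) (x : (algorithm A γ c).Config) (m : ℕ) : Prop :=
  (∃ g, Idle γ c Q σ g x.state x.now x.next x.future x.log m) ∨
    ∃ g v k, Busy γ c Q σ g x.state v k x.now x.next x.future x.log m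

section
variable {A : PCAlgorithm P} {γ : P.Net → ℝ} {c : P.Elem N → ℝ≥0} {Q : List (Arrival P N)}
  {σ : Schedule P N}

theorem onWake_none {γ : ℝ} {st : State P N} (h : st.service = none) (t : ℝ) :
    (algorithm A γ c).onWake st t = liftM (uponCritical c st t) := by
  change (match st.service with
    | none => (liftM (uponCritical c st t) : RTimed (Response P N (State P N)))
    | some v => forwardTime A γ c st v t) = _
  rw [h]

theorem onWake_some {γ : ℝ} {st : State P N} {v : Service P N} (h : st.service = some v) (t : ℝ) :
    (algorithm A γ c).onWake st t = forwardTime A γ c st v t := by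
  change (match st.service with
    | none => (liftM (uponCritical c st t) : RTimed (Response P N (State P N)))
    | some v => forwardTime A γ c st v t) = _
  rw [h]

/-- The possible activations in a snapshot that satisfies the invariant and is not halted. -/
inductive Activation (A : PCAlgorithm P) (γ : ℝ) (c : P.Elem N → ℝ≥0) (Q : List (Arrival P N))
    (σ : Schedule P N) (x : (algorithm A γ c).Config) (m : ℕ) : Prop
  | request (g : Ledger P N) (a : Arrival P N) (future : List (Arrival P N))
      (inv : Idle γ c Q σ g x.state x.now x.next (a :: future) x.log m)
      (early : ∀ s, x.next = .wakeAt s → a.release ≤ max x.now s)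
      (step : (algorithm A γ c).step x = (algorithm A γ c).activate x a.release future
        (uponRequest A γ c x.state a.release a))
  | critical (g : Ledger P N) (s : ℝ)
      (inv : Idle γ c Q σ g x.state x.now (.wakeAt s) x.future x.log m)
      (late : ∀ a ∈ x.future, s ≤ a.release)
      (step : (algorithm A γ c).step x = (algorithm A γ c).activate x s x.future
        (liftM (uponCritical c x.state s)))
  | forward (g : Ledger P N) (v : Service P N) (k : ℕ)
      (inv : Busy γ c Q σ g x.state v k x.now x.next x.future x.log m)
      (step : (algorithm A γ c).step x = (algorithm A γ c).activate x x.now x.future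
        (forwardTime A γ c x.state v x.now))

theorem Inv.halted_or_activation {γ : ℝ} (hQ : ValidInput Q) {x : (algorithm A γ c).Config}
    {m : ℕ} (h : Inv Q σ x m) : x.Halted ∨ Activation A γ c Q σ x m := by
  rcases h with ⟨g, h⟩ | ⟨g, v, k, h⟩
  · rcases h.next_eq with ⟨h1, -⟩ | ⟨h1, s, h2, h3⟩
    · rcases hf : x.future with - | ⟨a, future⟩
      · exact Or.inl ⟨h1, hf⟩
      · rw [hf] at h
        exact Or.inr (.request g a future h (fun s hs => by rw [h1] at hs; cases hs)
          (OnlineAlgorithm.step_sleep_cons _ h1 hf))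
    · right
      have hmax : max x.now s = s := max_eq_right h3.le
      rcases hf : x.future with - | ⟨a, future⟩
      · have hstep := OnlineAlgorithm.step_wakeAt_nil _ h2 hf
        rw [hmax, onWake_none h.service, ← hf] at hstep
        exact .critical g s (h2 ▸ h) (by simp [hf]) hstep
      · have hstep := OnlineAlgorithm.step_wakeAt_cons _ h2 hf
        by_cases hle : a.release ≤ max x.now s
        · rw [if_pos hle] at hstep
          rw [hf] at h
          refine .request g a future h (fun s' hs' => ?_) hstep
          rw [h2] at hs'
          cases hs'
          exact hle
        · rw [if_neg hle, hmax, onWake_none h.service, ← hf] at hstep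
          rw [hmax] at hle
          refine .critical g s (h2 ▸ h) (fun b hb => ?_) hstep
          have hsorted : (a :: future).Pairwise fun q q' => q.release ≤ q'.release := by
            rw [← hf, h.future_eq]
            exact hQ.1.sublist (List.drop_sublist _ _)
          rw [hf] at hb
          rcases List.mem_cons.1 hb with rfl | hb
          · exact (not_le.1 hle).le
          · exact (not_le.1 hle).le.trans ((List.pairwise_cons.1 hsorted).1 b hb)
  · have hstep := OnlineAlgorithm.step_resume _ h.next_eq
    rw [onWake_some h.service] at hstep
    exact Or.inr (.forward g v k h hstep)

theorem Inv.step (hγ : 1 ≤ γ N) (hA : A.IsApprox γ) (hQ : ValidInput Q) (hσ : σ.Feasible Q)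
    {x y : (algorithm A (γ N) c).Config} {m : ℕ} (h : Inv Q σ x m) (hx : ¬ x.Halted)
    (hy : y ∈ ((algorithm A (γ N) c).step x).support) : ∃ m', m' < m ∧ Inv Q σ y m' := by
  rcases (h.halted_or_activation hQ).resolve_left hx with
    ⟨g, a, future, hinv, hearly, hstep⟩ | ⟨g, s, hinv, hlate, hstep⟩ | ⟨g, v, k, hinv, hstep⟩
  all_goals
    rw [hstep] at hy
    obtain ⟨z, hz, h1, h2, h3, h4, h5⟩ := OnlineAlgorithm.mem_support_activate hy
  · obtain ⟨g', m', hm', h'⟩ := request_step hγ hA hQ hσ hinv hearly hz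
    refine ⟨m', hm', Or.inl ⟨g', ?_⟩⟩
    rw [h1, h2, h3, h4, h5]
    exact h'
  · have hz := RTimed.mem_vals_lift.1 hz
    obtain ⟨-, g', v, m', hm', htr, h'⟩ := critical_step hγ hQ hσ hinv hlate
    refine ⟨m', hm', Or.inr ⟨g', v, 0, ?_⟩⟩
    rw [h1, h2, h3, h4, h5, hz, htr]
    simpa using h'
  · rcases forward_step hγ hA hQ hσ hinv hz with ⟨g', m', hm', h'⟩ | ⟨v', m', hm', h'⟩
    · refine ⟨m', hm', Or.inl ⟨g', ?_⟩⟩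
      rw [h1, h2, h3, h4, h5]
      exact h'
    · refine ⟨m', hm', Or.inr ⟨g, v', k + 1, ?_⟩⟩
      rw [h1, h2, h3, h4, h5]
      exact h'

theorem exists_le_release (Q : List (Arrival P N)) :
    ∃ b : ℝ, b ≤ 0 ∧ ∀ a ∈ Q, b ≤ a.release := by
  induction Q with
  | nil => exact ⟨0, le_rfl, by simp⟩
  | cons a Q ih =>
    obtain ⟨b, hb, h⟩ := ih
    refine ⟨min b a.release, (min_le_left _ _).trans hb, fun a' ha' => ?_⟩
    rcases List.mem_cons.1 ha' with rfl | ha'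
    · exact min_le_right _ _
    · exact (min_le_left _ _).trans (h a' ha')

/-- A bound for the number of activations. -/
def maxActivations (Q : List (Arrival P N)) : ℕ := Q.length * (rounds Q + 1)

/-- The number of remaining activations decreases in each activation until the run halts. -/
theorem inv_run (hγ : 1 ≤ γ N) (hA : A.IsApprox γ) (hQ : ValidInput Q) (hσ : σ.Feasible Q)
    (n : ℕ) : ∀ x ∈ ((algorithm A (γ N) c).run Q n).support,
      ∃ m, Inv Q σ x m ∧ (x.Halted ∨ m + n ≤ maxActivations Q) := by
  induction n with
  | zero =>
    intro x hx
    obtain rfl : x = _ := (PMF.mem_support_pure_iff _ _).1 hx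
    obtain ⟨b, hb0, hb⟩ := exists_le_release Q
    refine ⟨maxActivations Q, Or.inl ⟨⟨0, fun _ => b, fun _ => ∅, ∅, fun _ => 0, fun _ => 0, []⟩, ?_⟩,
      Or.inr le_rfl⟩
    constructor
    · constructor
      · exact List.Perm.refl _
      · exact fun q hq => absurd hq List.not_mem_nil
      · exact fun q hq => absurd hq List.not_mem_nil
      · exact fun _ => hb0
      · exact fun a ha _ => hb a ha
      · exact fun T j hj => absurd hj (Finset.notMem_empty j)
      · exact fun j hj => absurd hj (Finset.notMem_empty j)
      · exact fun a ha => absurd ha List.not_mem_nil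
      · simp [algorithm]
      · simp [algorithm]
      · simp
    · rfl
    · rfl
    · exact fun q hq => absurd hq List.not_mem_nil
    · exact fun q hq => absurd hq List.not_mem_nil
    · intro j
      change (0 : ℝ) ≤ 2 ^ j
      positivity
    · exact Or.inl ⟨rfl, rfl⟩
    · simp [algorithm, maxActivations]
  | succ n ih =>
    intro y hy
    obtain ⟨x, hx, hy⟩ := (PMF.mem_support_bind_iff _ _ _).1 hy
    obtain ⟨m, hm, hxm⟩ := ih x hx
    by_cases hhalt : x.Halted
    · rw [OnlineAlgorithm.step_halted _ hhalt] at hy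
      obtain rfl := (PMF.mem_support_pure_iff _ _).1 hy
      exact ⟨m, hm, Or.inl hhalt⟩
    · obtain ⟨m', hm', h'⟩ := hm.step hγ hA hQ hσ hhalt hy
      have := hxm.resolve_left hhalt
      exact ⟨m', h', Or.inr (by omega)⟩

theorem halted_run (hγ : 1 ≤ γ N) (hA : A.IsApprox γ) (hQ : ValidInput Q) (hσ : σ.Feasible Q)
    {n : ℕ} (hn : maxActivations Q < n) :
    ∀ x ∈ ((algorithm A (γ N) c).run Q n).support, x.Halted := by
  intro x hx
  obtain ⟨m, -, h | h⟩ := inv_run hγ hA hQ hσ n x hx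
  · exact h
  · omega

/-- Transmitting everything at a late time is a feasible schedule. -/
theorem exists_feasible (Q : List (Arrival P N)) : ∃ σ : Schedule P N, σ.Feasible Q := by
  have h : ∃ T : ℝ, ∀ a ∈ Q, a.release ≤ T := by
    induction Q with
    | nil => exact ⟨0, by simp⟩
    | cons a Q ih =>
      obtain ⟨T, hT⟩ := ih
      refine ⟨max T a.release, fun a' ha' => ?_⟩
      rcases List.mem_cons.1 ha' with rfl | ha'
      · exact le_max_right _ _
      · exact (hT a' ha').trans (le_max_left _ _)
  obtain ⟨T, hT⟩ := h
  refine ⟨[(T, Finset.univ)], fun a ha => ⟨T, Finset.univ, by simp, hT a ha, ?_⟩⟩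
  obtain ⟨E, hE⟩ := P.exists_serves a.req
  exact P.serves_mono (Finset.subset_univ E) hE

/-! ### Competitiveness -/

theorem Inv.idle_of_halted {γ : ℝ} {x : (algorithm A γ c).Config} {m : ℕ} (h : Inv Q σ x m)
    (hx : x.Halted) : ∃ g : Ledger P N, g.served.Perm Q ∧
      Accounted γ c Q σ g [] x.now [] x.log 0 := by
  rcases h with ⟨g, h⟩ | ⟨g, v, k, h⟩
  · rcases h.next_eq with ⟨-, hp⟩ | ⟨-, s, h2, -⟩
    · have hacc := h.accounted
      rw [hp, hx.2] at hacc
      exact ⟨g, by simpa using hacc.perm, hacc⟩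
    · rw [hx.1] at h2; cases h2
  · have := h.next_eq
    rw [hx.1] at this
    cases this

theorem totalCost_eq (σ : Schedule P N) (c : P.Elem N → ℝ≥0) (Q : List (Arrival P N)) :
    σ.totalCost c Q = (σ.map fun x => price c x.2).sum + (Q.map σ.due).sum := rfl

/-- Evaluation of the cost accounting at the end of a run: with `T` the cost of the transmissions of
`σ` and `D` its delay cost, the work is at most `20 (1 + log |ℰ|) T + 4 D`, and the framework pays at
most `D` and `6 γ` times the work. -/
theorem totalCost_le {γ : ℝ} (hγ : 1 ≤ γ) (hQ : ValidInput Q) (hσ : σ.Feasible Q)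
    {g : Ledger P N} {now : ℝ} {log : Schedule P N} (hperm : g.served.Perm Q)
    (h : Accounted γ c Q σ g [] now [] log 0) :
    log.totalCost c Q ≤ 121 * γ * (1 + Real.log (Fintype.card (P.Elem N))) * σ.totalCost c Q := by
  have hlog : 0 ≤ Real.log (Fintype.card (P.Elem N)) := Real.log_natCast_nonneg _
  set lg := 1 + Real.log (Fintype.card (P.Elem N)) with hlg
  have h1 : (g.served.map log.due).sum = (Q.map log.due).sum := (hperm.map _).sum_eq
  have h2 : (g.served.map σ.due).sum = (Q.map σ.due).sum := (hperm.map _).sum_eq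
  have h3 : (g.served.map fun a => a.delay a.release).sum
      = (Q.map fun a => a.delay a.release).sum := (hperm.map _).sum_eq
  have h4 : (Q.map fun a => a.delay a.release).sum ≤ (Q.map σ.due).sum :=
    sum_map_le _ _ _ fun a ha => Schedule.delay_release_le_due (hQ.2 a ha).2.1 (hσ a ha)
  have h5 : 0 ≤ (Q.map σ.due).sum :=
    (sum_map_nonneg _ _ fun a ha => (hQ.2 a ha).2.2.1).trans h4
  have h6 : 0 ≤ (σ.map fun x => price c x.2).sum := sum_map_nonneg _ _ fun x _ => price_nonneg c _
  have h7 : (σ.map fun x => ∑ j ∈ g.charged x.1, load c x.2 j).sum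
      ≤ 5 * lg * (σ.map fun x => price c x.2).sum := by
    rw [← List.sum_map_mul_left]
    exact sum_map_le _ _ _ fun x _ => sum_load_le c x.2 (g.charged x.1)
  have h8 : 0 ≤ ∑ j ∈ g.live, g.credit j := Finset.sum_nonneg fun j hj => (h.backed j hj).1
  have hbudget := h.budget
  have hdelays := h.delays
  have hbuys := h.buys
  simp only [List.map_nil, List.sum_nil, zero_add, add_zero, mul_zero] at hbudget hdelays hbuys
  rw [h2] at hbudget
  rw [h1, h3] at hdelays
  rw [totalCost_eq, totalCost_eq]
  set T := (σ.map fun x => price c x.2).sum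
  set D := (Q.map σ.due).sum
  have hlg1 : 1 ≤ lg := by linarith
  have hw : g.work ≤ 20 * lg * T + 4 * D := by linarith
  have hw' : g.work ≤ 20 * (lg * (T + D)) := by nlinarith
  have hγw : γ * g.work ≤ γ * (20 * (lg * (T + D))) := mul_le_mul_of_nonneg_left hw' (by linarith)
  have hD : D ≤ γ * (lg * (T + D)) := by
    have h9 : T + D ≤ lg * (T + D) := le_mul_of_one_le_left (by linarith) hlg1
    have h10 : lg * (T + D) ≤ γ * (lg * (T + D)) :=
      le_mul_of_one_le_left (by linarith) hγ
    linarith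
  have hfinal : 121 * γ * lg * (T + D) = 121 * (γ * (lg * (T + D))) := by ring
  rw [hfinal]
  linarith

theorem isCompetitive {P : NDClass} {γ : P.Net → ℝ} {A : PCAlgorithm P} (hγ : ∀ N, 1 ≤ γ N)
    (hA : A.IsApprox γ) :
    (delayFramework A γ).IsCompetitive
      (fun N => 121 * γ N * (1 + Real.log (Fintype.card (P.Elem N)))) := by
  intro N c Q hQ
  refine ⟨maxActivations Q + 1, fun x hx => ?_⟩
  obtain ⟨σ₀, hσ₀⟩ := exists_feasible Q
  have hhalt : x.Halted := halted_run (hγ N) hA hQ hσ₀ (Nat.lt_succ_self _) x hx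
  have hfinal : ∀ σ : Schedule P N, σ.Feasible Q → ∃ g : Ledger P N, g.served.Perm Q ∧
      Accounted (γ N) c Q σ g [] x.now [] x.log 0 := by
    intro σ hσ
    obtain ⟨m, hm, -⟩ := inv_run (hγ N) hA hQ hσ _ x hx
    exact hm.idle_of_halted hhalt
  refine ⟨hhalt, ?_, fun σ hσ => ?_⟩
  · obtain ⟨g, hperm, hacc⟩ := hfinal σ₀ hσ₀
    exact fun a ha => hacc.served a (hperm.mem_iff.2 ha)
  · obtain ⟨g, hperm, hacc⟩ := hfinal σ hσ
    exact totalCost_le (hγ N) hQ hσ hperm hacc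

end

end Framework

/-! ### Running time -/

namespace Framework

theorem nextCritical_steps (L : List (Pending P N)) (t : ℝ) :
    (nextCritical L t).steps = 2 * L.length ^ 2 + 4 * L.length := by
  have h : ∀ n : ℕ, n + ∑ _i : Fin n, (n + (1 + (n + 1))) + n = 2 * n ^ 2 + 4 * n := by
    intro n
    simp only [Finset.sum_const, Finset.card_univ, Fintype.card_fin, smul_eq_mul]
    ring
  rw [← h L.length]
  unfold nextCritical
  simp only [Timed.steps_bind]
  cases L <;>
    simp [Timed.each, Timed.select, Timed.op, Timed.hittingTime, Timed.tick]

theorem nextCritical_steps_le {L : List (Pending P N)} {M : ℕ} (h : L.length ≤ M) (t : ℝ) :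
    (nextCritical L t).steps ≤ 4 * (M + 1) ^ 2 := by
  rw [nextCritical_steps]
  nlinarith

theorem uponCritical_steps_le (c : P.Elem N → ℝ≥0) (st : State P N) (t : ℝ) {M : ℕ}
    (hL : st.pending.length ≤ M) (hE : Fintype.card (P.Elem N) ≤ M) :
    (uponCritical c st t).steps ≤ 40 * (M + 1) ^ 2 := by
  have hnext := nextCritical_steps_le hL t
  have hfil : ∀ p : Pending P N → Bool, (st.pending.filter p).length ≤ st.pending.length :=
    fun p => List.length_filter_le _ _
  unfold uponCritical
  simp only [Timed.steps_bind]
  split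
  · simp only [Timed.steps_bind, Timed.steps_pure, Timed.each, Timed.select, Timed.op, Timed.ops,
      Timed.sumOn, Timed.tick, Fintype.card_fin, Finset.sum_const, Finset.card_univ, smul_eq_mul,
      List.length_map]
    generalize hl : (List.filter _ st.pending).length = l
    have hl' : l ≤ st.pending.length := hl ▸ hfil _
    nlinarith
  · simp only [Timed.steps_bind, Timed.steps_pure, Timed.each, Timed.select, Timed.op, Timed.ops,
      Timed.sumOn, Fintype.card_fin, Finset.sum_const, Finset.card_univ, smul_eq_mul]
    nlinarith

theorem finishService_steps_le (st : State P N) (v : Service P N) (t τ : ℝ) {M : ℕ}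
    (hL : st.pending.length + v.eligible.length ≤ M) (hE : Fintype.card (P.Elem N) ≤ M) :
    (finishService st v t τ).steps ≤ 20 * (M + 1) ^ 2 := by
  have h1 : (finishService st v t τ).steps
      = (v.eligible.length + Fintype.card (P.Elem N))
        + ((v.eligible.length + v.eligible.length * 5)
        + ((v.eligible.length + st.pending.length + Fintype.card (P.Elem N))
        + ((nextCritical (st.pending ++ leftover v τ) t).steps + 0))) := by
    have : (Timed.each fun i : Fin v.eligible.length =>
        Timed.ops 5 ((v.eligible.get i).upgrade τ v.level)).steps
        = v.eligible.length + v.eligible.length * 5 := by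
      simp [Timed.each, Timed.ops]
    rw [← this]
    rfl
  have h2 : (st.pending ++ leftover v τ).length ≤ M := by
    refine le_trans ?_ hL
    rw [List.length_append, leftover, List.length_map]
    refine Nat.add_le_add_left ((List.length_filter_le _ _).trans ?_) _
    rw [List.length_finRange]
  have h3 := nextCritical_steps_le h2 t
  rw [h1]
  nlinarith

theorem expectedSteps_call (A : PCAlgorithm P) (I : PCInstance P N) :
    (call A I).expectedSteps
      = ((2 * (Fintype.card (P.Elem N) + I.n) : ℕ) : ℝ≥0∞) + (A N I).expectedSteps := by
  unfold call
  rw [RTimed.expectedSteps_lift_bind]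
  rfl

theorem uponRequest_expectedSteps_le {A : PCAlgorithm P} {γ : ℝ} {c : P.Elem N → ℝ≥0}
    {st : State P N} {t : ℝ} {a : Arrival P N} {M : ℕ} (hL : st.pending.length + 1 ≤ M)
    (hE : Fintype.card (P.Elem N) ≤ M) {B : ℝ≥0∞}
    (hB : (A N (singleInstance γ c a)).expectedSteps ≤ B) :
    (uponRequest A γ c st t a).expectedSteps ≤ ((40 * (M + 1) ^ 2 : ℕ) : ℝ≥0∞) + B := by
  set e := Fintype.card (P.Elem N) with he
  unfold uponRequest
  rw [RTimed.expectedSteps_lift_bind, RTimed.expectedSteps_lift_bind,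
    RTimed.expectedSteps_lift_bind]
  refine (add_le_add_right (add_le_add_right (add_le_add_right
    (RTimed.expectedSteps_bind_le _ _
      ((e + (1 + (1 + (1 + (4 * (M + 1) ^ 2 + 2)))) : ℕ) : ℝ≥0∞)
      fun sol _ => ?_) _) _) _).trans ?_
  · rw [RTimed.expectedSteps_lift_bind, RTimed.expectedSteps_lift_bind]
    have h1 : (Timed.sumOn sol.elems fun e => (c e : ℝ)).steps = e := rfl
    rw [h1]
    have h2 : ∀ b : Bool, (Timed.op b).steps = 1 := fun _ => rfl
    rw [h2]
    push_cast
    refine add_le_add_right ?_ _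
    refine add_le_add le_rfl ?_
    split
    · rw [RTimed.expectedSteps_lift_bind, RTimed.expectedSteps_pure]
      have h3 := nextCritical_steps_le (L := st.pending) (M := M) (by omega) t
      have : (nextCritical st.pending t).steps + 0 ≤ 1 + (1 + (4 * (M + 1) ^ 2 + 2)) := by omega
      exact_mod_cast this
    · rw [RTimed.expectedSteps_lift_bind, RTimed.expectedSteps_lift_bind,
        RTimed.expectedSteps_lift_bind, RTimed.expectedSteps_lift_bind, RTimed.expectedSteps_pure]
      refine add_le_add (le_of_eq Nat.cast_one) (add_le_add (le_of_eq Nat.cast_one) ?_)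
      have h3 : ∀ q : Pending P N, (nextCritical (st.pending ++ [q]) t).steps + (2 + 0)
          ≤ 4 * (M + 1) ^ 2 + 2 := by
        intro q
        have := nextCritical_steps_le (L := st.pending ++ [q]) (M := M) (by simpa using hL) t
        omega
      exact_mod_cast h3 _
  · rw [expectedSteps_call]
    have h1 : (Timed.sumOn Finset.univ fun e => (c e : ℝ)).steps = e := rfl
    have h2 : ∀ b : ℝ, (Timed.op b).steps = 1 := fun _ => rfl
    rw [h1, h2, h2]
    change (e : ℝ≥0∞) + ((1 : ℕ) + ((1 : ℕ) + (((2 * (e + 1) : ℕ) : ℝ≥0∞)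
      + (A N (singleInstance γ c a)).expectedSteps + _))) ≤ _
    have h3 : e + (1 + (1 + (2 * (e + 1) + (e + (1 + (1 + (1 + (4 * (M + 1) ^ 2 + 2))))))))
        ≤ 40 * (M + 1) ^ 2 := by nlinarith
    have h4 : ((e + (1 + (1 + (2 * (e + 1) + (e + (1 + (1 + (1 + (4 * (M + 1) ^ 2 + 2)))))))) : ℕ)
        : ℝ≥0∞) ≤ ((40 * (M + 1) ^ 2 : ℕ) : ℝ≥0∞) := by exact_mod_cast h3
    refine le_trans (le_of_eq ?_) (add_le_add h4 hB)
    push_cast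
    ring

theorem forwardTime_expectedSteps_le {A : PCAlgorithm P} {γ : ℝ} {c : P.Elem N → ℝ≥0}
    {st : State P N} {v : Service P N} {t : ℝ} {M : ℕ}
    (hL : st.pending.length + v.eligible.length ≤ M) (hE : Fintype.card (P.Elem N) ≤ M)
    {B : ℝ≥0∞} (hB : ∀ s, (A N (forwardInstance c v s)).expectedSteps ≤ B) :
    (forwardTime A γ c st v t).expectedSteps ≤ ((60 * (M + 1) ^ 2 : ℕ) : ℝ≥0∞) + B := by
  set e := Fintype.card (P.Elem N) with he
  set n := v.eligible.length with hn
  have hfin := fun τ => finishService_steps_le st v t τ hL hE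
  unfold forwardTime
  rw [RTimed.expectedSteps_lift_bind]
  have h0 : (Timed.select fun i => i ∉ v.served).steps = n := Fintype.card_fin n
  rw [h0]
  split
  · rw [RTimed.expectedSteps_lift]
    have h1 : n + (finishService st v t v.time).steps ≤ 60 * (M + 1) ^ 2 := by
      have := hfin v.time
      nlinarith
    refine le_add_right ?_
    exact_mod_cast h1
  · simp only [RTimed.expectedSteps_lift_bind]
    have hop : ∀ {α : Type} (b : α), (Timed.op b).steps = 1 := fun _ => rfl
    have hres : ∀ φ : Fin n → ℝ, (Timed.each fun i => Timed.ops 3 (φ i)).steps = n + n * 3 := by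
      intro φ; simp [Timed.each, Timed.ops]
    have hred : ∀ φ : P.Elem N → ℝ≥0, (Timed.each fun i => Timed.ops 2 (φ i)).steps
        = e + e * 2 := by
      intro φ; simp [Timed.each, Timed.ops, he]
    have hhit : ∀ (T : Finset (Fin n)) f (s θ : ℝ), (Timed.hittingTime T f s θ).steps = n + 1 := by
      intro T f s θ; simp [Timed.hittingTime]
    simp only [hop]
    rw [hres, hres, hred, hhit]
    refine (add_le_add_right (add_le_add_right (add_le_add_right (add_le_add_right
      (add_le_add_right (add_le_add_right (add_le_add_right
        (RTimed.expectedSteps_bind_le _ _ ((e + (n + (1 + (1 + 20 * (M + 1) ^ 2))) : ℕ) : ℝ≥0∞)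
          fun sol _ => ?_) _) _) _) _) _) _) _).trans ?_
    · simp only [RTimed.expectedSteps_lift_bind, hop]
      have h1 : ∀ (T : Finset (P.Elem N)) φ, (Timed.sumOn T φ).steps = e := fun _ _ => rfl
      have h2 : ∀ (T : Finset (Fin n)) φ, (Timed.sumOn T φ).steps = n := fun _ _ =>
        Fintype.card_fin n
      rw [h1]
      push_cast
      refine add_le_add le_rfl (add_le_add ?_ (add_le_add le_rfl (add_le_add le_rfl ?_)))
      · exact le_of_eq (congrArg _ (h2 _ _))
      · split
        · rw [RTimed.expectedSteps_lift]
          exact_mod_cast hfin _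
        · rw [RTimed.expectedSteps_pure]
          exact zero_le
    · rw [expectedSteps_call]
      have h3 : n + (1 + (1 + ((n + n * 3) + ((n + 1) + ((n + n * 3) + ((e + e * 2)
          + (2 * (e + n) + (e + (n + (1 + (1 + 20 * (M + 1) ^ 2))))))))))) ≤ 60 * (M + 1) ^ 2 := by
        nlinarith
      have h4 : ((n + (1 + (1 + ((n + n * 3) + ((n + 1) + ((n + n * 3) + ((e + e * 2)
          + (2 * (e + n) + (e + (n + (1 + (1 + 20 * (M + 1) ^ 2))))))))))) : ℕ) : ℝ≥0∞)
          ≤ ((60 * (M + 1) ^ 2 : ℕ) : ℝ≥0∞) := by exact_mod_cast h3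
      refine le_trans (le_of_eq ?_) (add_le_add h4 (hB (nextTime γ v t)))
      change (n : ℝ≥0∞) + (((1 : ℕ) : ℝ≥0∞) + (((1 : ℕ) : ℝ≥0∞) + (((n + n * 3 : ℕ) : ℝ≥0∞)
        + (((n + 1 : ℕ) : ℝ≥0∞) + (((n + n * 3 : ℕ) : ℝ≥0∞) + (((e + e * 2 : ℕ) : ℝ≥0∞)
        + ((((2 * (e + n) : ℕ) : ℝ≥0∞)
          + (A N (forwardInstance c v (nextTime γ v t))).expectedSteps)
        + ((e + (n + (1 + (1 + 20 * (M + 1) ^ 2))) : ℕ) : ℝ≥0∞)))))))) = _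
      push_cast
      ring

end Framework

/-! ### Polynomial bounds -/

theorem polynomial_eval_mono (p : Polynomial ℕ) : Monotone fun n => p.eval n := by
  intro a b h
  simp only [Polynomial.eval_eq_sum_range]
  exact Finset.sum_le_sum fun i _ => Nat.mul_le_mul_left _ (Nat.pow_le_pow_left h i)

theorem length_le_inputSize (Q : List (Arrival P N)) : Q.length ≤ inputSize Q := by
  have h : Q.length ≤ (Q.map fun q => 1 + P.reqSize q.req).sum := by
    induction Q with
    | nil => simp
    | cons a Q ih =>
      simp only [List.length_cons, List.map_cons, List.sum_cons]
      omega
  unfold inputSize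
  omega

theorem network_add_reqSize_le_inputSize {Q : List (Arrival P N)} {a : Arrival P N} (ha : a ∈ Q) :
    P.netSize N + Fintype.card (P.Elem N) + (1 + P.reqSize a.req) ≤ inputSize Q := by
  have h : 1 + P.reqSize a.req ≤ (Q.map fun q => 1 + P.reqSize q.req).sum :=
    List.single_le_sum (fun _ _ => Nat.zero_le _) _ (List.mem_map_of_mem ha)
  unfold inputSize
  omega

theorem OnlineAlgorithm.expectedClock_activate (alg : OnlineAlgorithm P N) (x : alg.Config) (t : ℝ)
    (future : List (Arrival P N)) (r : RTimed (Response P N alg.State)) :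
    ∑' y, alg.activate x t future r y * (y.clock : ℝ≥0∞)
      = x.clock + (r.expectedSteps + 1) := by
  rw [OnlineAlgorithm.activate_eq, tsum_map_mul, RTimed.expectedSteps_def]
  push_cast
  simp only [add_assoc, mul_add]
  rw [ENNReal.tsum_add, ENNReal.tsum_add, ENNReal.tsum_mul_right, ENNReal.tsum_mul_right,
    PMF.tsum_coe, one_mul, one_mul]

namespace Framework

variable {A : PCAlgorithm P} {γ : P.Net → ℝ} {c : P.Elem N → ℝ≥0} {Q : List (Arrival P N)}
  {σ : Schedule P N}

theorem singleInstance_size_le {γ : ℝ} {a : Arrival P N} (ha : a ∈ Q) :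
    (singleInstance γ c a).size ≤ inputSize Q + inputSize Q * inputSize Q := by
  have h1 := network_add_reqSize_le_inputSize ha
  have h2 : (singleInstance γ c a).size
      = P.netSize N + Fintype.card (P.Elem N) + ∑ _i : Fin 1, (1 + P.reqSize a.req) := rfl
  rw [h2, Fin.sum_univ_one]
  exact h1.trans (Nat.le_add_right _ _)

theorem forwardInstance_size_le {γ : ℝ} {v : Service P N} (hv : ∀ q ∈ v.eligible, Sound γ c Q q)
    (hlen : v.eligible.length ≤ Q.length) (s : ℝ) :
    (forwardInstance c v s).size ≤ inputSize Q + inputSize Q * inputSize Q := by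
  have h1 : (forwardInstance c v s).size = P.netSize N + Fintype.card (P.Elem N)
      + ∑ i : Fin v.eligible.length, (1 + P.reqSize (v.eligible.get i).req) := rfl
  have h2 : ∑ i : Fin v.eligible.length, (1 + P.reqSize (v.eligible.get i).req)
      ≤ ∑ _i : Fin v.eligible.length, inputSize Q := by
    refine Finset.sum_le_sum fun i _ => ?_
    have := network_add_reqSize_le_inputSize (hv _ (List.get_mem v.eligible i)).mem
    change _ + (1 + P.reqSize (v.eligible.get i).req) ≤ _ at this
    omega
  simp only [Finset.sum_const, Finset.card_univ, Fintype.card_fin, smul_eq_mul] at h2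
  have h3 : v.eligible.length * inputSize Q ≤ inputSize Q * inputSize Q :=
    Nat.mul_le_mul_right _ (hlen.trans (length_le_inputSize Q))
  have h4 : P.netSize N + Fintype.card (P.Elem N) ≤ inputSize Q := by
    unfold inputSize; omega
  omega

/-- An activation takes a polynomial number of steps in expectation. The argument of `p` is quadratic
because the instances for time forwarding repeat the descriptions of up to all requests. -/
theorem expectedClock_step_le (hQ : ValidInput Q) {γ : ℝ} {p : Polynomial ℕ}
    (hp : ∀ I : PCInstance P N, (A N I).expectedSteps ≤ ((p.eval I.size : ℕ) : ℝ≥0∞))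
    {x : (algorithm A γ c).Config} {m : ℕ} (h : Inv Q σ x m) :
    ∑' y, (algorithm A γ c).step x y * (y.clock : ℝ≥0∞) ≤ x.clock
      + ((60 * (inputSize Q + 1) ^ 2 + p.eval (inputSize Q + inputSize Q * inputSize Q) + 1 : ℕ)
        : ℝ≥0∞) := by
  set M := inputSize Q with hM
  have hE : Fintype.card (P.Elem N) ≤ M := by
    rw [hM]; unfold inputSize; omega
  have hQM : Q.length ≤ M := length_le_inputSize Q
  have hpoly : ∀ I : PCInstance P N, I.size ≤ M + M * M →
      (A N I).expectedSteps ≤ ((p.eval (M + M * M) : ℕ) : ℝ≥0∞) := fun I hI =>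
    (hp I).trans (by exact_mod_cast polynomial_eval_mono p hI)
  rcases h.halted_or_activation hQ with hx |
    ⟨g, a, future, hinv, -, hstep⟩ | ⟨g, s, hinv, -, hstep⟩ | ⟨g, v, k, hinv, hstep⟩
  · rw [OnlineAlgorithm.step_halted _ hx, tsum_eq_single x]
    · simp
    · intro b hb
      simp [PMF.pure_apply, hb]
  all_goals
    rw [hstep]
    refine (OnlineAlgorithm.expectedClock_activate _ x _ _ _).le.trans (add_le_add_right ?_ _)
    push_cast
    refine add_le_add ?_ le_rfl
    have hlen := hinv.accounted.perm.length_eq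
    simp only [List.length_append, List.length_map] at hlen
  · rw [List.length_cons] at hlen
    have haQ : a ∈ Q := hinv.accounted.perm.subset (by simp)
    refine (uponRequest_expectedSteps_le (by omega) hE
      (hpoly _ (singleInstance_size_le haQ))).trans ?_
    refine add_le_add ?_ le_rfl
    have : 40 * (M + 1) ^ 2 ≤ 60 * (M + 1) ^ 2 := by nlinarith
    exact_mod_cast this
  · refine (RTimed.expectedSteps_lift (uponCritical c x.state s)).le.trans ?_
    have h1 : (uponCritical c x.state s).steps ≤ 60 * (M + 1) ^ 2 :=
      (uponCritical_steps_le c x.state s (by omega) hE).trans (by nlinarith)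
    refine le_add_right ?_
    exact_mod_cast h1
  · refine (forwardTime_expectedSteps_le (M := M) (by omega) hE fun s =>
      hpoly _ (forwardInstance_size_le
        (fun q hq => hinv.accounted.sound q (List.mem_append_right _ hq)) (by omega) s)).trans ?_
    push_cast
    exact le_rfl

theorem expectedClock_le (hγ : 1 ≤ γ N) (hA : A.IsApprox γ) (hQ : ValidInput Q)
    {p : Polynomial ℕ}
    (hp : ∀ I : PCInstance P N, (A N I).expectedSteps ≤ ((p.eval I.size : ℕ) : ℝ≥0∞)) (n : ℕ) :
    (algorithm A (γ N) c).expectedClock Q n ≤ (((maxActivations Q + 1)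
      * (60 * (inputSize Q + 1) ^ 2 + p.eval (inputSize Q + inputSize Q * inputSize Q) + 1) : ℕ)
        : ℝ≥0∞) := by
  obtain ⟨σ, hσ⟩ := exists_feasible Q
  set R := 60 * (inputSize Q + 1) ^ 2 + p.eval (inputSize Q + inputSize Q * inputSize Q) + 1
    with hR
  have hclock : ∀ n, (algorithm A (γ N) c).expectedClock Q n
      ≤ ((min n (maxActivations Q + 1) * R : ℕ) : ℝ≥0∞) := by
    intro n
    induction n with
    | zero =>
      unfold OnlineAlgorithm.expectedClock OnlineAlgorithm.run
      rw [ENNReal.tsum_eq_zero.2]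
      · exact zero_le
      · intro x
        rw [PMF.pure_apply]
        split
        · rename_i h
          rw [h]; simp
        · simp
    | succ n ih =>
      unfold OnlineAlgorithm.expectedClock OnlineAlgorithm.run
      rw [tsum_bind_mul]
      rcases le_or_gt n (maxActivations Q) with hn | hn
      · have hmin : min (n + 1) (maxActivations Q + 1) * R
            = min n (maxActivations Q + 1) * R + R := by
          rw [min_eq_left (by omega), min_eq_left (by omega)]; ring
        rw [hmin]
        calc _ ≤ ∑' x, (algorithm A (γ N) c).run Q n x * ((x.clock : ℝ≥0∞) + (R : ℕ)) := by
              refine ENNReal.tsum_le_tsum fun x => ?_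
              by_cases hx : x ∈ ((algorithm A (γ N) c).run Q n).support
              · obtain ⟨m, hm, -⟩ := inv_run hγ hA hQ hσ n x hx
                gcongr
                exact expectedClock_step_le hQ hp hm
              · rw [PMF.mem_support_iff, not_not] at hx
                simp [hx]
          _ = (algorithm A (γ N) c).expectedClock Q n + (R : ℕ) := by
              simp only [mul_add]
              rw [ENNReal.tsum_add, ENNReal.tsum_mul_right, PMF.tsum_coe, one_mul]
              rfl
          _ ≤ _ := by
              push_cast at ih ⊢
              exact add_le_add ih le_rfl
      · have hmin : min (n + 1) (maxActivations Q + 1) = min n (maxActivations Q + 1) := by omega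
        rw [hmin]
        refine le_trans (ENNReal.tsum_le_tsum fun x => ?_) ih
        by_cases hx : x ∈ ((algorithm A (γ N) c).run Q n).support
        · rw [OnlineAlgorithm.step_halted _ (halted_run hγ hA hQ hσ hn x hx)]
          gcongr
          rw [tsum_eq_single x]
          · simp
          · intro b hb
            simp [PMF.pure_apply, hb]
        · rw [PMF.mem_support_iff, not_not] at hx
          simp [hx]
  refine (hclock n).trans ?_
  exact_mod_cast Nat.mul_le_mul_right R (min_le_right _ _)

theorem polyTime {P : NDClass} {γ : P.Net → ℝ} {A : PCAlgorithm P} (hγ : ∀ N, 1 ≤ γ N)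
    (hA : A.IsApprox γ) (h : A.PolyTime) : (delayFramework A γ).PolyTime := by
  obtain ⟨p, hp⟩ := h
  open Polynomial in
  refine ⟨(X * (2 * X + 4) + 1) * (60 * (X + 1) ^ 2 + p.comp (X + X * X) + 1), ?_⟩
  intro N c Q hQ n
  refine (expectedClock_le (hγ N) hA hQ (hp N) n).trans ?_
  have h1 : maxActivations Q + 1 ≤ inputSize Q * (2 * inputSize Q + 4) + 1 := by
    have := length_le_inputSize Q
    exact Nat.add_le_add_right (Nat.mul_le_mul this (by unfold rounds; omega)) 1
  have h2 := Nat.mul_le_mul_right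
    (60 * (inputSize Q + 1) ^ 2 + p.eval (inputSize Q + inputSize Q * inputSize Q) + 1) h1
  simp only [Polynomial.eval_mul, Polynomial.eval_add, Polynomial.eval_X, Polynomial.eval_one,
    Polynomial.eval_pow, Polynomial.eval_comp, Polynomial.eval_ofNat]
  exact_mod_cast h2

end Framework

end NetworkDesign

end

theorem mainTheorem2 :
    ∃ C : ℝ, 0 < C ∧
      ∀ (P : NetworkDesign.NDClass) (γ : P.Net → ℝ) (A : NetworkDesign.PCAlgorithm P),
        (∀ N, 1 ≤ γ N) → A.IsApprox γ →
          (NetworkDesign.delayFramework A γ).IsCompetitive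
              (fun N => C * γ N * (1 + Real.log (Fintype.card (P.Elem N)))) ∧
            (A.IsDeterministic → (NetworkDesign.delayFramework A γ).IsDeterministic) ∧
            (A.PolyTime → (NetworkDesign.delayFramework A γ).PolyTime) := by
  refine ⟨121, by norm_num, fun P γ A hγ hA => ⟨NetworkDesign.Framework.isCompetitive hγ hA,
    fun h N c => NetworkDesign.Framework.algorithm_isDeterministic h (γ N) c,
    NetworkDesign.Framework.polyTime hγ hA⟩⟩
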